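/- **Setting.** Momenta lie in $\mathbb R^4$. Let $K$ be a cutoff function: $K$ smooth, $K=1$ on $[0,1]$, $K=0$ on $[4,\infty)$. For $\Lambda_R>0$ and real constants $A,B$ with $|B|\le\Lambda_R^2$, $|A|\le\Lambda_R^3$ put $\Delta_\Lambda(k)=K(k^2/\Lambda^2)/(k^2+B)$ and $\dot\Delta_\Lambda=\frac{d}{d\Lambda}\Delta_\Lambda$. A family of perturbative scalar vertex functions assigns to $n\ge1$, $r_1,r_2\ge 0$, every UV cutoff $\Lambda_0>\Lambda_R$ and every scale $\Lambda_R\le\Lambda\le\Lambda_0$ a real function $L_n^{(r_1,r_2)}(k_1,\dots,k_n,\Lambda)$ of momenta with $\sum_i k_i=0$, such that: for each $\Lambda_0$ it is smooth in $(\Lambda,k_1,\dots,k_n)$; it is symmetric and $O(4)$-invariant in the momenta; $L_n^{(0,0)}=0$; $L_n^{(r_1,r_2)}=0$ for $n>2(r_1+r_2)+2$; and the Polchinski equation holds, $$\frac{d}{d\Lambda}L_n^{(r_1,r_2)}(k_1,\dots,k_n)=-\frac12\sum_{S\subseteq\{1,\dots,n\}}\ \sum_{s_1=0}^{r_1}\sum_{s_2=0}^{r_2}\dot\Delta_\Lambda(K_S)\,L^{(s_1,s_2)}_{|S|+1}(k_S,-K_S)\,L^{(r_1-s_1,r_2-s_2)}_{n-|S|+1}(k_{S^c},K_S)$$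 $$\qquad-\frac12\int\frac{d^4q}{(2\pi)^4}L^{(r_1,r_2)}_{n+2}(k_1,\dots,k_n,q,-q)\,\dot\Delta_\Lambda(q)-\frac12 A\,L^{(r_1,r_2)}_{n+1}(k_1,\dots,k_n,0)\,\dot\Delta_\Lambda(0),\qquad K_S=\sum_{i\in S}k_i ,$$ all functions being taken at the scale $\Lambda$. Put $A_n^{(r_1,r_2)}=\Lambda^{n+r_1-4}L_n^{(r_1,r_2)}$. Write $\partial^\mu_{i,j}=\partial/\partial k_i^\mu-\partial/\partial k_j^\mu$, let $\partial^p$ be any product of $p$ such derivatives, and for a function at the scale $\Lambda$ let $\|f\|=\max\{|f(k_1,\dots,k_n)|:\ \sum_i k_i=0,\ k_i^2\le4\Lambda^2\ \forall i\}$. Write $Pln(z)$ for a polynomial in $\ln z$ with nonnegative coefficients, possibly a different one at each occurrence and for each $(n,p,r_1,r_2)$. **Theorem (Convergence).** Impose, for every $\Lambda_0>\Lambda_R$ and to all orders $(r_1,r_2)$, the renormalization conditions at $\Lambda=\Lambda_R$: $L_1^{(r_1,r_2)}(0)=0$, $L_2^{(r_1,r_2)}(0,0)=0$, $\partial^\mu_{1,2}\partial^\nu_{1,2}L_2^{(r_1,r_2)}(0,0)=0$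 for all $\mu,\nu$, $L_3^{(r_1,r_2)}(0,0,0)=\delta_{r_1,1}\delta_{r_2,0}$, $L_4^{(r_1,r_2)}(0,0,0,0)=\delta_{r_1,0}\delta_{r_2,1}$. Fix orders $R_1,R_2$ and assume that for all $n\ge1$, $r_1\le R_1$, $r_2\le R_2$, all $\partial^p$ and all $\Lambda_R\le\Lambda\le\Lambda_0$, $\Lambda_0>\Lambda_R$, $$\|\partial^pA_n^{(r_1,r_2)}(\Lambda)\|\le\Lambda^{-p}\Big(\frac{\Lambda}{\Lambda_R}\Big)^{r_1}Pln\Big(\frac{\Lambda_0}{\Lambda_R}\Big),$$ and that if moreover $n+p\ge5$ the bare functions $\Lambda_0\mapsto\partial^pA_n^{(r_1,r_2)}(k_1,\dots,k_n,\Lambda_0)$ (scale and cutoff both equal to $\Lambda_0$) are differentiable for momenta with $\sum_i k_i=0$, $k_i^2\le4\Lambda_0^2$, and $$\Big\|\Lambda_0\frac{d}{d\Lambda_0}\partial^pA_n^{(r_1,r_2)}(\Lambda_0)\Big\|\le\Lambda_0^{-p}\Big(\frac{\Lambda_0}{\Lambda_R}\Big)^{r_1}Pln\Big(\frac{\Lambda_0}{\Lambda_R}\Big).$$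 Then for all $n\ge1$, $r_1\le R_1$, $r_2\le R_2$, all $\partial^p$ and all $\Lambda_R\le\Lambda\le\Lambda_0$, $\Lambda_0>\Lambda_R$, the derivative in $\Lambda_0$ at fixed $\Lambda$ (from the right if $\Lambda=\Lambda_0$) of $\partial^pA_n^{(r_1,r_2)}(k_1,\dots,k_n,\Lambda)$ exists for $\sum_i k_i=0$, $k_i^2\le4\Lambda^2$, and $$\Big\|\Lambda_0\frac{d}{d\Lambda_0}\partial^pA_n^{(r_1,r_2)}(\Lambda)\Big\|\le\Lambda^{-p}\Big(\frac{\Lambda}{\Lambda_R}\Big)^{r_1}\frac{\Lambda}{\Lambda_0}Pln\Big(\frac{\Lambda_0}{\Lambda_R}\Big).$$ Hence the limits $A_n^{cont\,(r_1,r_2)}(\Lambda)=\lim_{\Lambda_0\to\infty}A_n^{(r_1,r_2)}(\Lambda,\Lambda_0)$ exist for momenta with $\sum_i k_i=0$, $k_i^2\le4\Lambda^2$, and $$\|A_n^{(r_1,r_2)}(\Lambda,\Lambda_0)-A_n^{cont\,(r_1,r_2)}(\Lambda)\|\le\Big(\frac{\Lambda}{\Lambda_R}\Big)^{r_1}\frac{\Lambda}{\Lambda_0}Pln\Big(\frac{\Lambda_0}{\Lambda_R}\Big).$$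 The polynomials in the conclusions depend only on $K$, $R_1$, $R_2$, the polynomials in the assumptions and the indices $n,p,r_1,r_2$; not on $\Lambda_R,A,B$ or the family. -/

import Mathlib

open scoped ContDiff

/-- Euclidean four-momenta. -/
abbrev Momentum : Type := EuclideanSpace ℝ (Fin 4)

/-- A cutoff function: smooth, equal to `1` on `[0,1]` and to `0` on `[4,∞)`. -/
structure IsCutoff (K : ℝ → ℝ) : Prop where
  smooth : ContDiff ℝ ∞ K
  eq_one : ∀ z, 0 ≤ z → z ≤ 1 → K z = 1
  eq_zero : ∀ z, 4 ≤ z → K z = 0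

/-- The regularized propagator `Δ_Λ(k) = K(k²/Λ²) / (k² + B)`. -/
noncomputable def regProp (K : ℝ → ℝ) (B Λ : ℝ) (k : Momentum) : ℝ :=
  K (‖k‖ ^ 2 / Λ ^ 2) / (‖k‖ ^ 2 + B)

/-- The scale derivative `(d/dΛ) Δ_Λ(k)`. -/
noncomputable def regPropDeriv (K : ℝ → ℝ) (B Λ : ℝ) (k : Momentum) : ℝ :=
  deriv (fun s => regProp K B s k) Λ

/-- `(k, q) ↦ (k₁, …, kₙ, q)`. -/
def addMomentum {n : ℕ} (k : Fin n → Momentum) (q : Momentum) : Fin (n + 1) → Momentum :=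
  Fin.snoc (α := fun _ => Momentum) k q

/-- The subfamily of the momenta with labels in `S`, in increasing order of the labels. -/
def subMomenta {n : ℕ} (k : Fin n → Momentum) (S : Finset (Fin n)) : Fin S.card → Momentum :=
  fun i => k (S.orderEmbOfFin rfl i)

/-- The momentum derivative `∂^μ_{i,j} = ∂/∂k_i^μ - ∂/∂k_j^μ`. -/
noncomputable def momDiff {n : ℕ} (i j : Fin n) (μ : Fin 4)
    (f : (Fin n → Momentum) → ℝ) : (Fin n → Momentum) → ℝ :=
  fun k => fderiv ℝ f k
    (Pi.single i (EuclideanSpace.single μ 1) - Pi.single j (EuclideanSpace.single μ 1))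

/-- The iterated derivative `∂^p = ∂^{μ₁}_{i₁,j₁} ⋯ ∂^{μ_p}_{i_p,j_p}`; the order `p` is the
length of the list of index triples `(i, j, μ)`. -/
noncomputable def multiDiff {n : ℕ} (I : List (Fin n × Fin n × Fin 4))
    (f : (Fin n → Momentum) → ℝ) : (Fin n → Momentum) → ℝ :=
  I.foldr (fun q g => momDiff q.1 q.2.1 q.2.2 g) f

/-- The set over which the norm `‖·‖` at scale `Λ` takes the maximum: momentum-conserving
configurations with `k_i² ≤ 4Λ²` for all `i`. -/
def momentumBall (n : ℕ) (Λ : ℝ) : Set (Fin n → Momentum) :=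
  {k | ∑ i, k i = 0 ∧ ∀ i, ‖k i‖ ^ 2 ≤ 4 * Λ ^ 2}

/-- `‖f‖ ≤ C` for the norm at scale `Λ`, the maximum of `|f|` over `momentumBall n Λ`. -/
def NormLE {n : ℕ} (Λ : ℝ) (f : (Fin n → Momentum) → ℝ) (C : ℝ) : Prop :=
  ∀ k ∈ momentumBall n Λ, |f k| ≤ C

/-- Families of expansion coefficients: `L n r₁ r₂ Λ₀ Λ k` stands for
`L_n^{(r₁,r₂)}(k₁, …, kₙ, Λ)` in the theory with UV cutoff `Λ₀`. Only the values on
`∑ i, k i = 0` and on `Λ ≤ Λ₀` are meaningful. -/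
abbrev VertexFamily : Type :=
  (n : ℕ) → ℕ → ℕ → ℝ → ℝ → (Fin n → Momentum) → ℝ

/-- The right-hand side of the Polchinski equation
`(d/dΛ) L_n^{(r₁,r₂)}(k₁, …, kₙ, Λ) = …`, at a fixed UV cutoff, where `ℓ n r₁ r₂` is
`L_n^{(r₁,r₂)}(·, Λ)`. The first sum runs over all ways to distribute the external momenta over
two vertex functions. -/
noncomputable def flowRHS (K : ℝ → ℝ) (A B : ℝ)
    (ℓ : (n : ℕ) → ℕ → ℕ → (Fin n → Momentum) → ℝ) (Λ : ℝ)
    (n r₁ r₂ : ℕ) (k : Fin n → Momentum) : ℝ :=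
  - (1 / 2) * ∑ S : Finset (Fin n),
      ∑ a ∈ Finset.HasAntidiagonal.antidiagonal r₁, ∑ b ∈ Finset.HasAntidiagonal.antidiagonal r₂,
        regPropDeriv K B Λ (∑ i ∈ S, k i) *
          ℓ (S.card + 1) a.1 b.1 (addMomentum (subMomenta k S) (-∑ i ∈ S, k i)) *
          ℓ (Sᶜ.card + 1) a.2 b.2 (addMomentum (subMomenta k Sᶜ) (∑ i ∈ S, k i))
  - (1 / 2) * ((1 / (2 * Real.pi) ^ 4) *
      ∫ q : Momentum, ℓ (n + 2) r₁ r₂ (addMomentum (addMomentum k q) (-q)) *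
        regPropDeriv K B Λ q)
  - (1 / 2) * A * ℓ (n + 1) r₁ r₂ (addMomentum k 0) * regPropDeriv K B Λ 0

/-- `L` is a family, indexed by the UV cutoff `Λ₀ > ΛR`, of perturbative vertex functions of a
scalar field on the scales `ΛR ≤ Λ ≤ Λ₀`: smooth, Bose symmetric, `O(4)`-invariant, vanishing to
zeroth order, with `L_n^{(r₁,r₂)} = 0` for `n > 2 (r₁ + r₂) + 2`, and solving the Polchinski
equation to every order. -/
structure IsVertexFamily (K : ℝ → ℝ) (A B ΛR : ℝ) (L : VertexFamily) : Prop where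
  smooth : ∀ n r₁ r₂ : ℕ, 1 ≤ n → ∀ Λ₀ : ℝ, ΛR < Λ₀ →
    ContDiffOn ℝ ∞ (fun x : ℝ × (Fin n → Momentum) => L n r₁ r₂ Λ₀ x.1 x.2)
      (Set.Icc ΛR Λ₀ ×ˢ Set.univ)
  symm : ∀ n r₁ r₂ : ℕ, 1 ≤ n → ∀ Λ₀ Λ : ℝ, ΛR < Λ₀ → Λ ∈ Set.Icc ΛR Λ₀ →
    ∀ k : Fin n → Momentum, ∑ i, k i = 0 → ∀ σ : Equiv.Perm (Fin n),
      L n r₁ r₂ Λ₀ Λ (fun i => k (σ i)) = L n r₁ r₂ Λ₀ Λ k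
  orthogonal : ∀ n r₁ r₂ : ℕ, 1 ≤ n → ∀ Λ₀ Λ : ℝ, ΛR < Λ₀ → Λ ∈ Set.Icc ΛR Λ₀ →
    ∀ k : Fin n → Momentum, ∑ i, k i = 0 → ∀ G : Momentum ≃ₗᵢ[ℝ] Momentum,
      L n r₁ r₂ Λ₀ Λ (fun i => G (k i)) = L n r₁ r₂ Λ₀ Λ k
  zeroth : ∀ n : ℕ, 1 ≤ n → ∀ Λ₀ Λ : ℝ, ΛR < Λ₀ → Λ ∈ Set.Icc ΛR Λ₀ →
    ∀ k : Fin n → Momentum, ∑ i, k i = 0 → L n 0 0 Λ₀ Λ k = 0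
  truncated : ∀ n r₁ r₂ : ℕ, 2 * (r₁ + r₂) + 2 < n → ∀ Λ₀ Λ : ℝ, ΛR < Λ₀ →
    Λ ∈ Set.Icc ΛR Λ₀ → ∀ k : Fin n → Momentum, ∑ i, k i = 0 → L n r₁ r₂ Λ₀ Λ k = 0
  flow : ∀ n r₁ r₂ : ℕ, 1 ≤ n → ∀ Λ₀ Λ : ℝ, ΛR < Λ₀ → Λ ∈ Set.Icc ΛR Λ₀ →
    ∀ k : Fin n → Momentum, ∑ i, k i = 0 →
      HasDerivWithinAt (fun s => L n r₁ r₂ Λ₀ s k)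
        (flowRHS K A B (fun m s₁ s₂ => L m s₁ s₂ Λ₀ Λ) Λ n r₁ r₂ k)
        (Set.Icc ΛR Λ₀) Λ

/-- The renormalization conditions `ρ₁ = ρ₂ = ρ₃ = 0`, `ρ₄ = ρ₄^R`, `ρ₅ = ρ₅^R` at the scale
`ΛR`, to every order in `ρ₄^R` and `ρ₅^R`, where `ρ₁ = L₁(0)`, `ρ₂ = L₂(0,0)`,
`ρ₃ δ^{μν} = ∂^μ_{1,2} ∂^ν_{1,2} L₂` at zero momenta, `ρ₄ = L₃(0,0,0)` and `ρ₅ = L₄(0,0,0,0)`. -/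
structure RenormalizationConditions (ΛR : ℝ) (L : VertexFamily) : Prop where
  rho1 : ∀ r₁ r₂ : ℕ, ∀ Λ₀ : ℝ, ΛR < Λ₀ → L 1 r₁ r₂ Λ₀ ΛR 0 = 0
  rho2 : ∀ r₁ r₂ : ℕ, ∀ Λ₀ : ℝ, ΛR < Λ₀ → L 2 r₁ r₂ Λ₀ ΛR 0 = 0
  rho3 : ∀ r₁ r₂ : ℕ, ∀ Λ₀ : ℝ, ΛR < Λ₀ → ∀ μ ν : Fin 4,
    momDiff 0 1 μ (momDiff 0 1 ν (L 2 r₁ r₂ Λ₀ ΛR)) 0 = 0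
  rho4 : ∀ r₁ r₂ : ℕ, ∀ Λ₀ : ℝ, ΛR < Λ₀ →
    L 3 r₁ r₂ Λ₀ ΛR 0 = if r₁ = 1 ∧ r₂ = 0 then 1 else 0
  rho5 : ∀ r₁ r₂ : ℕ, ∀ Λ₀ : ℝ, ΛR < Λ₀ →
    L 4 r₁ r₂ Λ₀ ΛR 0 = if r₁ = 0 ∧ r₂ = 1 then 1 else 0

/-- The dimensionless vertex functions `A_n^{(r₁,r₂)} = Λ^{n + r₁ - 4} L_n^{(r₁,r₂)}`. -/
noncomputable def dimless (L : VertexFamily) (n r₁ r₂ : ℕ) (Λ₀ Λ : ℝ)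
    (k : Fin n → Momentum) : ℝ :=
  Λ ^ ((n : ℤ) + (r₁ : ℤ) - 4) * L n r₁ r₂ Λ₀ Λ k

/-- `Pln(z)`: a polynomial, with coefficients that are to be nonnegative, in `ln z`. -/
noncomputable def Pln (P : Polynomial ℝ) (z : ℝ) : ℝ := P.eval (Real.log z)

/-- All coefficients of `P` are nonnegative. -/
def NonnegCoeffs (P : Polynomial ℝ) : Prop := ∀ i, 0 ≤ P.coeff i

/-! Strip the powers of `Λ` from `A_n`. The hypothesis on values says that `∂^p L_n` is of size
`Λ^(4-n-p) ΛR^(-r₁)`, and the claim is that its derivative in `Λ₀` is of size `Λ^(5-n-p) ΛR^(-r₁)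
Λ₀^(-2)`, both up to polynomials in `ln (Λ₀/ΛR)`. This pair of bounds (`UBound`; `Adm` when imposed
on all tangential derivatives) is stable under sums, products and loop integration, so it passes
from vertex functions to the right-hand side of the flow equation (`adm_reducedRHS`). There the term
with `A` drops out because the scale derivative of the propagator vanishes at zero momentum. Since
the zeroth order vanishes, only trees with two factors of strictly lower order survive, while the
loop has `n + 2` legs at the same order. Hence the induction runs upward in `r₁ + r₂` and, at each
order, downward in `n` from the range where the vertex functions are zero (`Theory.adm_vertex`).

With the right-hand side under control there are three cases. If `n + p ≥ 5`, the flow is integrated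
down from `Λ₀` (`Theory.derBound_of_irrelevant`): the bare datum and the moving endpoint contribute
`Λ₀^(3-n-p) ≤ Λ^(5-n-p) Λ₀^(-2)`, and the integral costs one logarithm. If `n + p ≤ 4` and the
momenta vanish, it is integrated up from `ΛR` (`Theory.derBound_at_zero`), where the boundary value
does not depend on `Λ₀`, by the renormalization conditions and symmetry. Nonzero momenta are reached
by Taylor's formula from the case `p + 1` (`Theory.derBound_of_taylor`), so `p` also descends.

Existence of the `Λ₀`-derivative at a fixed scale is part of the claim. It is obtained by
differentiating the integrated flow (`exists_hasDerivWithinAt_integral`,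
`exists_hasDerivWithinAt_flow_integral`), with domination supplied by `DerBound.lipschitz`.

The propagator may be singular: for `B = -ΛR²` its denominator vanishes on the inner edge of the
shell carrying its scale derivative at `Λ = ΛR`. The cutoff is flat there to infinite order, so the
quotient stays smooth, with bounds uniform in `B` (`norm_shellQuot_le`, `hasFDerivAt_shellQuot`).

Finally `Λ₀^(-2)` times a polynomial in the logarithm is integrable at infinity, which gives the
limit and its rate (`exists_tendsto_of_deriv_le`). Every estimate is quantified over a type of
theories after its polynomial is chosen; this is what makes the polynomials independent of the
family. -/

set_option autoImplicit false

/-! ### Tangential momentum derivatives -/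

/-- The tangent vector `e_i^μ - e_j^μ` attached to an index triple `(i, j, μ)`. -/
noncomputable def dirVec {n : ℕ} (q : Fin n × Fin n × Fin 4) : Fin n → Momentum :=
  Pi.single q.1 (EuclideanSpace.single q.2.2 1) - Pi.single q.2.1 (EuclideanSpace.single q.2.2 1)

lemma sum_dirVec {n : ℕ} (q : Fin n × Fin n × Fin 4) : ∑ i, dirVec q i = 0 := by
  simp [dirVec, Finset.sum_sub_distrib]

lemma momDiff_apply {n : ℕ} (q : Fin n × Fin n × Fin 4) (f : (Fin n → Momentum) → ℝ)
    (k : Fin n → Momentum) :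
    momDiff q.1 q.2.1 q.2.2 f k = fderiv ℝ f k (dirVec q) := rfl

@[simp] lemma multiDiff_nil {n : ℕ} (f : (Fin n → Momentum) → ℝ) : multiDiff [] f = f := rfl

lemma multiDiff_cons {n : ℕ} (q : Fin n × Fin n × Fin 4) (I : List (Fin n × Fin n × Fin 4))
    (f : (Fin n → Momentum) → ℝ) :
    multiDiff (q :: I) f = momDiff q.1 q.2.1 q.2.2 (multiDiff I f) := rfl

lemma multiDiff_concat {n : ℕ} (q : Fin n × Fin n × Fin 4) (I : List (Fin n × Fin n × Fin 4))
    (f : (Fin n → Momentum) → ℝ) :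
    multiDiff (I ++ [q]) f = multiDiff I (momDiff q.1 q.2.1 q.2.2 f) := by
  simp [multiDiff]

lemma ContDiff.momDiff {n : ℕ} {f : (Fin n → Momentum) → ℝ} (hf : ContDiff ℝ ∞ f)
    (i j : Fin n) (μ : Fin 4) : ContDiff ℝ ∞ (momDiff i j μ f) :=
  (hf.fderiv_right (m := ∞) (by simp)).clm_apply contDiff_const

lemma ContDiff.multiDiff {n : ℕ} {f : (Fin n → Momentum) → ℝ} (hf : ContDiff ℝ ∞ f)
    (I : List (Fin n × Fin n × Fin 4)) : ContDiff ℝ ∞ (multiDiff I f) := by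
  induction I with
  | nil => exact hf
  | cons q I ih => exact ih.momDiff _ _ _

lemma ContDiff.diffAt {E F : Type*} [NormedAddCommGroup E] [NormedSpace ℝ E]
    [NormedAddCommGroup F] [NormedSpace ℝ F] {f : E → F}
    (hf : ContDiff ℝ ∞ f) (x : E) : DifferentiableAt ℝ f x :=
  (hf.differentiable (by simp)).differentiableAt

lemma momDiff_add {n : ℕ} {f g : (Fin n → Momentum) → ℝ} (hf : ContDiff ℝ ∞ f)
    (hg : ContDiff ℝ ∞ g) (i j : Fin n) (μ : Fin 4) :
    momDiff i j μ (fun k => f k + g k) = fun k => momDiff i j μ f k + momDiff i j μ g k := by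
  funext k
  simp only [momDiff]
  rw [fderiv_fun_add (hf.diffAt k) (hg.diffAt k)]
  rfl

lemma momDiff_mul {n : ℕ} {f g : (Fin n → Momentum) → ℝ} (hf : ContDiff ℝ ∞ f)
    (hg : ContDiff ℝ ∞ g) (i j : Fin n) (μ : Fin 4) :
    momDiff i j μ (fun k => f k * g k) =
      fun k => momDiff i j μ f k * g k + f k * momDiff i j μ g k := by
  funext k
  simp only [momDiff]
  rw [fderiv_fun_mul (hf.diffAt k) (hg.diffAt k)]
  simp
  ring

lemma momDiff_const_mul {n : ℕ} {f : (Fin n → Momentum) → ℝ} (hf : ContDiff ℝ ∞ f) (c : ℝ)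
    (i j : Fin n) (μ : Fin 4) :
    momDiff i j μ (fun k => c * f k) = fun k => c * momDiff i j μ f k := by
  funext k
  simp only [momDiff]
  rw [fderiv_const_mul (hf.diffAt k)]
  rfl

lemma multiDiff_add {n : ℕ} {f g : (Fin n → Momentum) → ℝ} (hf : ContDiff ℝ ∞ f)
    (hg : ContDiff ℝ ∞ g) (I : List (Fin n × Fin n × Fin 4)) :
    multiDiff I (fun k => f k + g k) = fun k => multiDiff I f k + multiDiff I g k := by
  induction I with
  | nil => rfl
  | cons q I ih => rw [multiDiff_cons, ih, momDiff_add (hf.multiDiff I) (hg.multiDiff I)]; rfl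

lemma multiDiff_const_mul {n : ℕ} {f : (Fin n → Momentum) → ℝ} (hf : ContDiff ℝ ∞ f) (c : ℝ)
    (I : List (Fin n × Fin n × Fin 4)) :
    multiDiff I (fun k => c * f k) = fun k => c * multiDiff I f k := by
  induction I with
  | nil => rfl
  | cons q I ih => rw [multiDiff_cons, ih, momDiff_const_mul (hf.multiDiff I)]; rfl

lemma multiDiff_zero {n : ℕ} (I : List (Fin n × Fin n × Fin 4)) :
    multiDiff I (fun _ => 0) = fun _ => 0 := by
  induction I with
  | nil => rfl
  | cons q I ih =>
    rw [multiDiff_cons, ih]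
    funext k
    simp [momDiff]

lemma Filter.EventuallyEq.multiDiff {n : ℕ} {f g : (Fin n → Momentum) → ℝ}
    {k : Fin n → Momentum} (h : f =ᶠ[nhds k] g) (I : List (Fin n × Fin n × Fin 4)) :
    multiDiff I f =ᶠ[nhds k] multiDiff I g := by
  induction I with
  | nil => exact h
  | cons q I ih =>
    refine (ih.fderiv (𝕜 := ℝ)).mono fun x hx => ?_
    simp only [multiDiff_cons, momDiff_apply, hx]

/-- Tangential derivatives on the hyperplane of momentum conservation only depend on the values
there. -/
lemma multiDiff_eq_of_eqOn {n : ℕ} {f g : (Fin n → Momentum) → ℝ} (hf : ContDiff ℝ ∞ f)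
    (hg : ContDiff ℝ ∞ g) (h : ∀ k, ∑ i, k i = 0 → f k = g k)
    (I : List (Fin n × Fin n × Fin 4)) :
    ∀ k, ∑ i, k i = 0 → multiDiff I f k = multiDiff I g k := by
  induction I with
  | nil => exact h
  | cons q I ih =>
    intro k hk
    have key : ∀ u : (Fin n → Momentum) → ℝ, ContDiff ℝ ∞ u →
        HasDerivAt (fun t : ℝ => u (k + t • dirVec q)) (fderiv ℝ u k (dirVec q)) 0 := by
      intro u hu
      have h1 : HasFDerivAt u (fderiv ℝ u k) (k + (0 : ℝ) • dirVec q) := by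
        simpa using (hu.diffAt k).hasFDerivAt
      have h2 : HasDerivAt (fun t : ℝ => k + t • dirVec q) (dirVec q) 0 := by
        simpa using ((hasDerivAt_id (0 : ℝ)).smul_const (dirVec q)).const_add k
      exact h1.comp_hasDerivAt 0 h2
    have e : (fun t : ℝ => multiDiff I f (k + t • dirVec q)) =
        fun t : ℝ => multiDiff I g (k + t • dirVec q) := by
      funext t
      apply ih
      simp only [Pi.add_apply, Pi.smul_apply, Finset.sum_add_distrib, hk, ← Finset.smul_sum,
        sum_dirVec]
      simp
    have h1 := key _ (hf.multiDiff I)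
    rw [e] at h1
    exact h1.unique (key _ (hg.multiDiff I))

lemma multiDiff_comp {m n : ℕ} {f : (Fin m → Momentum) → ℝ} (hf : ContDiff ℝ ∞ f)
    {φ : (Fin n → Momentum) → (Fin m → Momentum)}
    {A : (Fin n → Momentum) →L[ℝ] (Fin m → Momentum)} (hφ : ∀ k, HasFDerivAt φ A k)
    {τ : Fin n → Fin m}
    (hA : ∀ i j μ, A (dirVec (i, j, μ)) = dirVec (τ i, τ j, μ))
    (I : List (Fin n × Fin n × Fin 4)) :
    multiDiff I (fun k => f (φ k)) =
      fun k => multiDiff (I.map fun q => (τ q.1, τ q.2.1, q.2.2)) f (φ k) := by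
  induction I with
  | nil => rfl
  | cons q I ih =>
    rw [multiDiff_cons, ih]
    funext k
    have h1 := ((hf.multiDiff (I.map fun q => (τ q.1, τ q.2.1, q.2.2))).diffAt
      (φ k)).hasFDerivAt.comp k (hφ k)
    rw [List.map_cons, multiDiff_cons, momDiff_apply, momDiff_apply]
    erw [h1.fderiv]
    rw [ContinuousLinearMap.comp_apply]
    exact congrArg _ (hA _ _ _)

/-! ### Linear momentum maps of the tree and loop terms -/

/-- `k ↦ (k_S, -K_S)`, linear in `k`. -/
noncomputable def cutMomenta {n : ℕ} (S : Finset (Fin n)) :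
    (Fin n → Momentum) →L[ℝ] (Fin (S.card + 1) → Momentum) :=
  LinearMap.toContinuousLinearMap
    { toFun := fun k => addMomentum (subMomenta k S) (-∑ i ∈ S, k i)
      map_add' := fun k l => by
        funext j
        refine Fin.lastCases ?_ (fun j => ?_) j
        · simp [addMomentum, Finset.sum_add_distrib, add_comm]
        · simp [addMomentum, subMomenta]
      map_smul' := fun c k => by
        funext j
        refine Fin.lastCases ?_ (fun j => ?_) j
        · simp [addMomentum, Finset.smul_sum]
        · simp [addMomentum, subMomenta] }

lemma cutMomenta_apply {n : ℕ} (S : Finset (Fin n)) (k : Fin n → Momentum) :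
    cutMomenta S k = addMomentum (subMomenta k S) (-∑ i ∈ S, k i) := rfl

/-- The label of `k_i` in `(k_S, -K_S)`; momenta outside `S` are sent to the last label. -/
def cutIndex {n : ℕ} (S : Finset (Fin n)) (i : Fin n) : Fin (S.card + 1) :=
  if h : i ∈ S then Fin.castSucc ((S.orderIsoOfFin rfl).symm ⟨i, h⟩) else Fin.last _

lemma cutMomenta_single {n : ℕ} (S : Finset (Fin n)) (i : Fin n) (v : Momentum) :
    cutMomenta S (Pi.single i v) = Pi.single (cutIndex S i) v - Pi.single (Fin.last _) v := by
  rw [cutMomenta_apply]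
  funext j
  refine Fin.lastCases ?_ (fun j => ?_) j
  · by_cases h : i ∈ S
    · simp [addMomentum, cutIndex, h, Pi.single_apply, (Fin.castSucc_ne_last _).symm]
    · simp [addMomentum, cutIndex, h, Pi.single_apply]
  · by_cases h : i ∈ S
    · have : (S.orderEmbOfFin rfl j = i) ↔ j = (S.orderIsoOfFin rfl).symm ⟨i, h⟩ := by
        rw [OrderIso.eq_symm_apply, Subtype.ext_iff]
        rfl
      simp [addMomentum, subMomenta, cutIndex, h, Pi.single_apply, this, Fin.castSucc_ne_last]
    · have : S.orderEmbOfFin rfl j ≠ i := fun e => h (e ▸ S.orderEmbOfFin_mem rfl j)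
      simp [addMomentum, subMomenta, cutIndex, h, Pi.single_apply, this, Fin.castSucc_ne_last]

/-- The contribution of `-K_S` to the last slot cancels in the difference. This is why labels
outside `S` can all be sent to the last label. -/
lemma cutMomenta_dirVec {n : ℕ} (S : Finset (Fin n)) (i j : Fin n) (μ : Fin 4) :
    cutMomenta S (dirVec (i, j, μ)) = dirVec (cutIndex S i, cutIndex S j, μ) := by
  simp only [dirVec, map_sub, cutMomenta_single]
  abel

lemma sum_cutMomenta {n : ℕ} (S : Finset (Fin n)) (k : Fin n → Momentum) :
    ∑ i, cutMomenta S k i = 0 := by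
  rw [cutMomenta_apply, Fin.sum_univ_castSucc]
  have : ∑ i, subMomenta k S i = ∑ i ∈ S, k i := by
    rw [← Finset.sum_coe_sort S]
    exact (S.orderIsoOfFin rfl).toEquiv.sum_comp fun i => k i
  simp [addMomentum, this]

/-- `k ↦ (k, 0, 0)`. -/
noncomputable def padMomenta (n : ℕ) : (Fin n → Momentum) →L[ℝ] (Fin (n + 2) → Momentum) :=
  LinearMap.toContinuousLinearMap
    { toFun := fun k => addMomentum (addMomentum k 0) 0
      map_add' := fun k l => by
        funext j
        refine Fin.lastCases ?_ (fun j => ?_) j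
        · simp [addMomentum]
        · refine Fin.lastCases ?_ (fun j => ?_) j <;> simp [addMomentum]
      map_smul' := fun c k => by
        funext j
        refine Fin.lastCases ?_ (fun j => ?_) j
        · simp [addMomentum]
        · refine Fin.lastCases ?_ (fun j => ?_) j <;> simp [addMomentum] }

lemma padMomenta_apply {n : ℕ} (k : Fin n → Momentum) :
    padMomenta n k = addMomentum (addMomentum k 0) 0 := rfl

/-- `q ↦ (0, q, -q)`. -/
noncomputable def pairMomenta (n : ℕ) : Momentum →L[ℝ] (Fin (n + 2) → Momentum) :=
  LinearMap.toContinuousLinearMap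
    { toFun := fun q => addMomentum (addMomentum 0 q) (-q)
      map_add' := fun k l => by
        funext j
        refine Fin.lastCases ?_ (fun j => ?_) j
        · simp [addMomentum, add_comm]
        · refine Fin.lastCases ?_ (fun j => ?_) j <;> simp [addMomentum]
      map_smul' := fun c k => by
        funext j
        refine Fin.lastCases ?_ (fun j => ?_) j
        · simp [addMomentum]
        · refine Fin.lastCases ?_ (fun j => ?_) j <;> simp [addMomentum] }

lemma pairMomenta_apply {n : ℕ} (q : Momentum) :
    pairMomenta n q = addMomentum (addMomentum 0 q) (-q) := rfl

lemma addMomentum_pair {n : ℕ} (k : Fin n → Momentum) (q : Momentum) :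
    addMomentum (addMomentum k q) (-q) = padMomenta n k + pairMomenta n q := by
  rw [padMomenta_apply, pairMomenta_apply]
  funext j
  refine Fin.lastCases ?_ (fun j => ?_) j
  · simp [addMomentum]
  · refine Fin.lastCases ?_ (fun j => ?_) j <;> simp [addMomentum]

lemma padMomenta_single {n : ℕ} (i : Fin n) (v : Momentum) :
    padMomenta n (Pi.single i v) = Pi.single i.castSucc.castSucc v := by
  rw [padMomenta_apply]
  funext j
  refine Fin.lastCases ?_ (fun j => ?_) j
  · simp [addMomentum, (Fin.castSucc_ne_last _).symm]
  · refine Fin.lastCases ?_ (fun j => ?_) j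
    · have : Fin.last n ≠ i.castSucc := (Fin.castSucc_ne_last _).symm
      simp [addMomentum, this]
    · simp [addMomentum, Pi.single_apply]

lemma padMomenta_dirVec {n : ℕ} (i j : Fin n) (μ : Fin 4) :
    padMomenta n (dirVec (i, j, μ)) =
      dirVec (i.castSucc.castSucc, j.castSucc.castSucc, μ) := by
  simp only [dirVec, map_sub, padMomenta_single]

/-! ### Joint smoothness in scale and momenta -/

/-- Momentum derivatives preserve joint smoothness in the scale and the momenta, and commute with
the scale derivative. -/
lemma contDiffOn_momDiff {n : ℕ} {a b : ℝ} (hab : a < b) {f : ℝ → (Fin n → Momentum) → ℝ}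
    (hf : ContDiffOn ℝ ∞ (fun x : ℝ × (Fin n → Momentum) => f x.1 x.2)
      (Set.Icc a b ×ˢ Set.univ)) (i j : Fin n) (μ : Fin 4) :
    ContDiffOn ℝ ∞ (fun x : ℝ × (Fin n → Momentum) => momDiff i j μ (f x.1) x.2)
      (Set.Icc a b ×ˢ Set.univ) := by
  have hU : UniqueDiffOn ℝ (Set.Icc a b ×ˢ (Set.univ : Set (Fin n → Momentum))) :=
    (uniqueDiffOn_Icc hab).prod uniqueDiffOn_univ
  have h1 : ContDiffOn ℝ ∞ (fun x : ℝ × (Fin n → Momentum) =>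
      fderivWithin ℝ (fun x : ℝ × (Fin n → Momentum) => f x.1 x.2) (Set.Icc a b ×ˢ Set.univ) x
        (0, dirVec (i, j, μ))) (Set.Icc a b ×ˢ Set.univ) :=
    (hf.fderivWithin hU (m := ∞) (by simp)).clm_apply contDiffOn_const
  refine h1.congr fun x hx => ?_
  have h2 := (hf.differentiableOn (by simp) x hx).hasFDerivWithinAt
  have h3 : HasFDerivAt (fun k => (x.1, k))
      (ContinuousLinearMap.inr ℝ ℝ (Fin n → Momentum)) x.2 := hasFDerivAt_prodMk_right _ _
  have hm : Set.MapsTo (fun k : Fin n → Momentum => (x.1, k)) Set.univ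
      (Set.Icc a b ×ˢ Set.univ) := fun k _ => ⟨hx.1, trivial⟩
  have h4 := (h2.comp (s := Set.univ) x.2 h3.hasFDerivWithinAt hm).hasFDerivAt_of_univ
  have h5 : momDiff i j μ (f x.1) x.2 = fderiv ℝ (f x.1) x.2 (dirVec (i, j, μ)) := rfl
  rw [h5]
  erw [h4.fderiv]
  simp

lemma contDiffOn_multiDiff {n : ℕ} {a b : ℝ} (hab : a < b) {f : ℝ → (Fin n → Momentum) → ℝ}
    (hf : ContDiffOn ℝ ∞ (fun x : ℝ × (Fin n → Momentum) => f x.1 x.2)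
      (Set.Icc a b ×ˢ Set.univ)) (I : List (Fin n × Fin n × Fin 4)) :
    ContDiffOn ℝ ∞ (fun x : ℝ × (Fin n → Momentum) => multiDiff I (f x.1) x.2)
      (Set.Icc a b ×ˢ Set.univ) := by
  induction I with
  | nil => exact hf
  | cons q I ih => exact contDiffOn_momDiff (f := fun s => multiDiff I (f s)) hab ih _ _ _

lemma ContDiffOn.slice {n : ℕ} {s : Set ℝ} {f : ℝ → (Fin n → Momentum) → ℝ}
    (hf : ContDiffOn ℝ ∞ (fun x : ℝ × (Fin n → Momentum) => f x.1 x.2) (s ×ˢ Set.univ))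
    {t : ℝ} (ht : t ∈ s) : ContDiff ℝ ∞ (f t) := by
  rw [← contDiffOn_univ]
  exact hf.comp (contDiff_prodMk_right t).contDiffOn (fun k _ => ⟨ht, trivial⟩)

/-- The one-sided scale derivative of a family that is smooth on a strip. -/
noncomputable def scaleDeriv {n : ℕ} (a b : ℝ) (f : ℝ → (Fin n → Momentum) → ℝ) (t : ℝ)
    (k : Fin n → Momentum) : ℝ :=
  fderivWithin ℝ (fun x : ℝ × (Fin n → Momentum) => f x.1 x.2) (Set.Icc a b ×ˢ Set.univ) (t, k)
    (1, 0)

lemma contDiffOn_scaleDeriv {n : ℕ} {a b : ℝ} (hab : a < b) {f : ℝ → (Fin n → Momentum) → ℝ}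
    (hf : ContDiffOn ℝ ∞ (fun x : ℝ × (Fin n → Momentum) => f x.1 x.2)
      (Set.Icc a b ×ˢ Set.univ)) :
    ContDiffOn ℝ ∞ (fun x : ℝ × (Fin n → Momentum) => scaleDeriv a b f x.1 x.2)
      (Set.Icc a b ×ˢ Set.univ) :=
  (hf.fderivWithin ((uniqueDiffOn_Icc hab).prod uniqueDiffOn_univ) (m := ∞) (by simp)).clm_apply
    contDiffOn_const

lemma hasDerivWithinAt_scaleDeriv {n : ℕ} {a b : ℝ} {f : ℝ → (Fin n → Momentum) → ℝ}
    (hf : ContDiffOn ℝ ∞ (fun x : ℝ × (Fin n → Momentum) => f x.1 x.2)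
      (Set.Icc a b ×ˢ Set.univ)) {t : ℝ} (ht : t ∈ Set.Icc a b) (k : Fin n → Momentum) :
    HasDerivWithinAt (fun s => f s k) (scaleDeriv a b f t k) (Set.Icc a b) t := by
  have h2 := (hf.differentiableOn (by simp) (t, k) ⟨ht, trivial⟩).hasFDerivWithinAt
  have h3 : HasDerivWithinAt (fun s : ℝ => (s, k)) ((1 : ℝ), (0 : Fin n → Momentum))
      (Set.Icc a b) t := ((hasDerivAt_id t).prodMk (hasDerivAt_const t k)).hasDerivWithinAt
  have hm : Set.MapsTo (fun s : ℝ => (s, k)) (Set.Icc a b)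
      (Set.Icc a b ×ˢ (Set.univ : Set (Fin n → Momentum))) := fun s hs => ⟨hs, trivial⟩
  exact h2.comp_hasDerivWithinAt t h3 hm

/-- Both sides are values of the second derivative within the strip, taken in opposite orders, so
symmetry of that derivative decides. -/
lemma scaleDeriv_momDiff {n : ℕ} {a b : ℝ} (hab : a < b) {f : ℝ → (Fin n → Momentum) → ℝ}
    (hf : ContDiffOn ℝ ∞ (fun x : ℝ × (Fin n → Momentum) => f x.1 x.2)
      (Set.Icc a b ×ˢ Set.univ)) (i j : Fin n) (μ : Fin 4) {t : ℝ} (ht : t ∈ Set.Icc a b) :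
    scaleDeriv a b (fun s => momDiff i j μ (f s)) t = momDiff i j μ (scaleDeriv a b f t) := by
  funext k
  set U := Set.Icc a b ×ˢ (Set.univ : Set (Fin n → Momentum)) with hUdef
  have hU : UniqueDiffOn ℝ U := (uniqueDiffOn_Icc hab).prod uniqueDiffOn_univ
  set F := fun x : ℝ × (Fin n → Momentum) => f x.1 x.2 with hF
  have hx : ((t, k) : ℝ × (Fin n → Momentum)) ∈ U := ⟨ht, trivial⟩
  have slice : ∀ {G : ℝ × (Fin n → Momentum) → ℝ}, DifferentiableOn ℝ G U → ∀ s ∈ Set.Icc a b,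
      ∀ l, fderiv ℝ (fun k => G (s, k)) l (dirVec (i, j, μ)) =
        fderivWithin ℝ G U (s, l) (0, dirVec (i, j, μ)) := by
    intro G hG s hs l
    have h2 := (hG (s, l) ⟨hs, trivial⟩).hasFDerivWithinAt
    have h3 : HasFDerivAt (fun k => (s, k))
        (ContinuousLinearMap.inr ℝ ℝ (Fin n → Momentum)) l := hasFDerivAt_prodMk_right _ _
    have h4 := (h2.comp (s := Set.univ) l h3.hasFDerivWithinAt
      (fun k _ => ⟨hs, trivial⟩)).hasFDerivAt_of_univ
    erw [h4.fderiv]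
    simp
  have hF' : ContDiffOn ℝ ∞ (fderivWithin ℝ F U) U := hf.fderivWithin hU (m := ∞) (by simp)
  have hdF := (hF'.differentiableOn (by simp) _ hx)
  have happ : ∀ v w : ℝ × (Fin n → Momentum),
      fderivWithin ℝ (fun x => fderivWithin ℝ F U x v) U (t, k) w =
        fderivWithin ℝ (fderivWithin ℝ F U) U (t, k) w v := by
    intro v w
    have := (hdF.hasFDerivWithinAt.clm_apply (hasFDerivWithinAt_const v (t, k) U)).fderivWithin
      (hU _ hx)
    rw [this]
    simp
  have hL : scaleDeriv a b (fun s => momDiff i j μ (f s)) t k =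
      fderivWithin ℝ (fderivWithin ℝ F U) U (t, k) (1, 0) (0, dirVec (i, j, μ)) := by
    rw [← happ]
    refine congrFun (congrArg _ (fderivWithin_congr (fun x hx' => ?_) ?_)) _
    · exact slice (hf.differentiableOn (by simp)) x.1 hx'.1 x.2
    · exact slice (hf.differentiableOn (by simp)) t ht k
  have hR : momDiff i j μ (scaleDeriv a b f t) k =
      fderivWithin ℝ (fderivWithin ℝ F U) U (t, k) (0, dirVec (i, j, μ)) (1, 0) := by
    rw [← happ]
    exact slice ((contDiffOn_scaleDeriv hab hf).differentiableOn (by simp)) t ht k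
  rw [hL, hR]
  -- Symmetry also holds on the boundary of the strip, whose points lie in the closure of the
  -- interior.
  have hsymm : IsSymmSndFDerivWithinAt ℝ F U (t, k) := by
    refine ContDiffWithinAt.isSymmSndFDerivWithinAt (n := ∞) (hf _ hx)
      (by rw [minSmoothness_of_isRCLikeNormedField]
          exact WithTop.coe_le_coe.2 (le_top (a := (2 : ℕ∞))))
      hU ?_ hx
    rw [hUdef, interior_prod_eq, closure_prod_eq, interior_Icc, closure_Ioo hab.ne]
    simpa using ht
  exact hsymm _ _

/-- The list is consumed from its innermost derivative, which is absorbed into `f`; hence `f` is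
quantified after the list. -/
lemma hasDerivWithinAt_multiDiff {n : ℕ} {a b : ℝ} (hab : a < b)
    (I : List (Fin n × Fin n × Fin 4)) : ∀ {f : ℝ → (Fin n → Momentum) → ℝ},
    ContDiffOn ℝ ∞ (fun x : ℝ × (Fin n → Momentum) => f x.1 x.2) (Set.Icc a b ×ˢ Set.univ) →
    ∀ {t : ℝ}, t ∈ Set.Icc a b → ∀ k : Fin n → Momentum,
    HasDerivWithinAt (fun s => multiDiff I (f s) k) (multiDiff I (scaleDeriv a b f t) k)
      (Set.Icc a b) t := by
  induction I using List.reverseRecOn with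
  | nil => exact fun hf _ ht k => hasDerivWithinAt_scaleDeriv hf ht k
  | append_singleton I q ih =>
    intro f hf t ht k
    simp only [multiDiff_concat]
    rw [← scaleDeriv_momDiff hab hf _ _ _ ht]
    exact ih (contDiffOn_momDiff hab hf _ _ _) ht k

/-! ### Shell functions divided by a possibly vanishing denominator -/

/-- Smooth functions of a momentum supported in the shell `1 ≤ ‖y‖ ≤ 2`. -/
structure IsShellFun {E : Type} [NormedAddCommGroup E] [NormedSpace ℝ E] (ψ : Momentum → E) :
    Prop where
  smooth : ContDiff ℝ ∞ ψ
  inner : ∀ y, ‖y‖ ≤ 1 → ψ y = 0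
  outer : ∀ y, 2 ≤ ‖y‖ → ψ y = 0

section Shell

variable {E : Type} [NormedAddCommGroup E] [NormedSpace ℝ E]

lemma fderiv_eq_zero_of_closure {ψ : Momentum → E} (hψ : ContDiff ℝ ∞ ψ) {U : Set Momentum}
    (hU : IsOpen U) (h : ∀ y ∈ U, ψ y = 0) : ∀ y ∈ closure U, fderiv ℝ ψ y = 0 := by
  have hc : IsClosed {y | fderiv ℝ ψ y = 0} :=
    isClosed_eq (hψ.continuous_fderiv (by simp)) continuous_const
  refine fun y hy => closure_minimal (fun z hz => ?_) hc hy
  have : ψ =ᶠ[nhds z] fun _ => 0 := by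
    filter_upwards [hU.mem_nhds hz] with w hw using h w hw
  simp [this.fderiv_eq]

lemma IsShellFun.fderiv {ψ : Momentum → E} (hψ : IsShellFun ψ) : IsShellFun (fderiv ℝ ψ) where
  smooth := hψ.smooth.fderiv_right (by simp)
  inner y hy := by
    refine fderiv_eq_zero_of_closure hψ.smooth (U := Metric.ball 0 1) Metric.isOpen_ball
      (fun z hz => hψ.inner z (by simpa using (Metric.mem_ball.1 hz).le)) y ?_
    rw [closure_ball 0 one_ne_zero]
    simpa using hy
  outer y hy := by
    refine fderiv_eq_zero_of_closure hψ.smooth (U := (Metric.closedBall 0 2)ᶜ)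
      Metric.isClosed_closedBall.isOpen_compl
      (fun z hz => hψ.outer z (by simp at hz; exact hz.le)) y ?_
    rw [closure_compl, interior_closedBall 0 two_ne_zero]
    simpa using hy

lemma IsShellFun.bound {ψ : Momentum → E} (hψ : IsShellFun ψ) :
    ∃ C, 0 ≤ C ∧ ∀ y, ‖ψ y‖ ≤ C := by
  obtain ⟨C, hC⟩ := (isCompact_closedBall (0 : Momentum) 2).exists_bound_of_continuousOn
    hψ.smooth.continuous.continuousOn
  refine ⟨C, (norm_nonneg _).trans (hC 0 (by simp)), fun y => ?_⟩
  by_cases hy : ‖y‖ ≤ 2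
  · exact hC y (by simpa using hy)
  · rw [hψ.outer y (not_le.1 hy).le, norm_zero]
    exact (norm_nonneg _).trans (hC 0 (by simp))

/-- A shell function vanishes to infinite order at the unit sphere. -/
lemma IsShellFun.flat (m : ℕ) : ∀ {E : Type} [NormedAddCommGroup E] [NormedSpace ℝ E]
    {ψ : Momentum → E}, IsShellFun ψ →
    ∃ C, 0 ≤ C ∧ ∀ y, 1 ≤ ‖y‖ → ‖ψ y‖ ≤ C * (‖y‖ - 1) ^ m := by
  induction m with
  | zero =>
    intro E _ _ ψ hψ
    obtain ⟨C, h0, hC⟩ := hψ.bound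
    exact ⟨C, h0, fun y _ => by simpa using hC y⟩
  | succ m ih =>
    intro E _ _ ψ hψ
    obtain ⟨C, h0, hC⟩ := ih hψ.fderiv
    refine ⟨C, h0, fun y hy => ?_⟩
    have hy0 : 0 < ‖y‖ := one_pos.trans_le hy
    have hn : ‖‖y‖⁻¹ • y‖ = 1 := by rw [norm_smul]; simp [hy0.ne']
    -- Mean value inequality along the radial segment from the unit sphere to `y`, on which the norm
    -- stays between `1` and `‖y‖`.
    have hz : ∀ z ∈ segment ℝ (‖y‖⁻¹ • y) y, ‖_root_.fderiv ℝ ψ z‖ ≤ C * (‖y‖ - 1) ^ m := by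
      rintro z ⟨a, b, ha, hb, hab, rfl⟩
      have e : a • ‖y‖⁻¹ • y + b • y = (a * ‖y‖⁻¹ + b) • y := by rw [add_smul, mul_smul]
      have e2 : ‖a • ‖y‖⁻¹ • y + b • y‖ = a + b * ‖y‖ := by
        rw [e, norm_smul, Real.norm_of_nonneg (by positivity)]
        field_simp
      have h1 : 1 ≤ a + b * ‖y‖ := by nlinarith
      have h2 : a + b * ‖y‖ ≤ ‖y‖ := by nlinarith
      refine (hC _ (by rw [e2]; exact h1)).trans ?_
      rw [e2]
      gcongr
    have := (convex_segment (‖y‖⁻¹ • y) y).norm_image_sub_le_of_norm_fderiv_le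
      (fun z _ => hψ.smooth.diffAt z) hz (left_mem_segment ℝ _ _) (right_mem_segment ℝ _ _)
    rw [hψ.inner _ hn.le, sub_zero] at this
    refine this.trans (le_of_eq ?_)
    have e3 : y - ‖y‖⁻¹ • y = (1 - ‖y‖⁻¹) • y := by rw [sub_smul, one_smul]
    rw [e3, norm_smul, Real.norm_of_nonneg (sub_nonneg.2 (inv_le_one_of_one_le₀ hy)), sub_mul,
      inv_mul_cancel₀ hy0.ne', pow_succ]
    ring

/-- `ψ(y) / (y² + b)^m`. -/
noncomputable def shellQuot (ψ : Momentum → E) (b : ℝ) (m : ℕ) (y : Momentum) : E :=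
  ((‖y‖ ^ 2 + b) ^ m)⁻¹ • ψ y

lemma shellQuot_inner {ψ : Momentum → E} (hψ : IsShellFun ψ) (b : ℝ) (m : ℕ) {y : Momentum}
    (hy : ‖y‖ ≤ 1) : shellQuot ψ b m y = 0 := by
  simp [shellQuot, hψ.inner y hy]

lemma shellQuot_outer {ψ : Momentum → E} (hψ : IsShellFun ψ) (b : ℝ) (m : ℕ) {y : Momentum}
    (hy : 2 ≤ ‖y‖) : shellQuot ψ b m y = 0 := by
  simp [shellQuot, hψ.outer y hy]

/-- For `b ≥ -1` and `‖y‖ ≥ 1` the denominator is at least `(‖y‖ - 1) ^ m`. Flatness of `ψ` to order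
`m + j` pays for it and leaves `j` powers, uniformly in `b`. -/
lemma norm_shellQuot_le {ψ : Momentum → E} (hψ : IsShellFun ψ) (m j : ℕ) :
    ∃ C, 0 ≤ C ∧ ∀ b, -1 ≤ b → ∀ y, 1 ≤ ‖y‖ → ‖shellQuot ψ b m y‖ ≤ C * (‖y‖ - 1) ^ j := by
  obtain ⟨C, h0, hC⟩ := IsShellFun.flat (m + j) hψ
  refine ⟨C, h0, fun b hb y hy => ?_⟩
  rcases hy.eq_or_lt with hy | hy
  · rw [shellQuot_inner hψ b m hy.symm.le, norm_zero, ← hy]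
    positivity
  · have h1 : 0 < ‖y‖ - 1 := sub_pos.2 hy
    have h2 : ‖y‖ - 1 ≤ ‖y‖ ^ 2 + b := by nlinarith
    rw [shellQuot, norm_smul, norm_inv, norm_pow, Real.norm_of_nonneg (h1.le.trans h2),
      inv_mul_le_iff₀ (pow_pos (h1.trans_le h2) _)]
    refine (hC y hy.le).trans ?_
    rw [pow_add, mul_left_comm]
    gcongr

lemma exists_bound_shellQuot {ψ : Momentum → E} (hψ : IsShellFun ψ) (m : ℕ) :
    ∃ C, 0 ≤ C ∧ ∀ b, -1 ≤ b → ∀ y, ‖shellQuot ψ b m y‖ ≤ C := by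
  obtain ⟨C, h0, hC⟩ := norm_shellQuot_le hψ m 0
  refine ⟨C, h0, fun b hb y => ?_⟩
  rcases le_total 1 ‖y‖ with hy | hy
  · simpa using hC b hb y hy
  · rw [shellQuot_inner hψ b m hy, norm_zero]
    exact h0

/-- `y ↦ d(y²) ⊗ ψ(y)`. -/
noncomputable def shellTensor (ψ : Momentum → E) (y : Momentum) : Momentum →L[ℝ] E :=
  (2 • innerSL ℝ y).smulRight (ψ y)

lemma IsShellFun.shellTensor {ψ : Momentum → E} (hψ : IsShellFun ψ) :
    IsShellFun (shellTensor ψ) where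
  smooth := by
    have h : ContDiff ℝ ∞ fun y : Momentum => 2 • innerSL ℝ y :=
      (innerSL ℝ (E := Momentum)).contDiff.const_smul (2 : ℕ)
    exact h.smulRight hψ.smooth
  inner y hy := by ext v; simp [_root_.shellTensor, hψ.inner y hy]
  outer y hy := by ext v; simp [_root_.shellTensor, hψ.outer y hy]

/-- Inside the unit ball the quotient is zero and outside it the quotient rule applies. On the
sphere, where the denominator may vanish, the quotient is quadratically small, so its derivative is
zero, in agreement with the formula. -/
lemma hasFDerivAt_shellQuot {ψ : Momentum → E} (hψ : IsShellFun ψ) {b : ℝ} (hb : -1 ≤ b) (m : ℕ)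
    (y : Momentum) :
    HasFDerivAt (shellQuot ψ b m)
      (shellQuot (fderiv ℝ ψ) b m y - (m : ℝ) • shellQuot (shellTensor ψ) b (m + 1) y) y := by
  rcases lt_trichotomy ‖y‖ 1 with hy | hy | hy
  · rw [shellQuot_inner hψ.fderiv b m hy.le, shellQuot_inner hψ.shellTensor b _ hy.le, smul_zero,
      sub_zero]
    refine (hasFDerivAt_const (0 : E) y).congr_of_eventuallyEq ?_
    filter_upwards [(isOpen_lt continuous_norm continuous_const).mem_nhds hy] with z hz
    exact shellQuot_inner hψ b m (le_of_lt hz)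
  · rw [shellQuot_inner hψ.fderiv b m hy.le, shellQuot_inner hψ.shellTensor b _ hy.le, smul_zero,
      sub_zero]
    obtain ⟨C, h0, hC⟩ := norm_shellQuot_le hψ m 2
    refine Asymptotics.IsBigO.hasFDerivAt (n := 2) ?_ one_lt_two
    refine Asymptotics.IsBigO.of_bound C (Filter.Eventually.of_forall fun z => ?_)
    rcases le_total 1 ‖z‖ with hz | hz
    · refine (hC b hb z hz).trans ?_
      rw [Real.norm_of_nonneg (by positivity)]
      gcongr
      rw [← hy]
      exact norm_sub_norm_le z y
    · rw [shellQuot_inner hψ b m hz, norm_zero]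
      positivity
  · have hpos : 0 < ‖y‖ ^ 2 + b := by nlinarith
    have h1 : HasFDerivAt (fun y : Momentum => ‖y‖ ^ 2 + b) (2 • innerSL ℝ y) y :=
      (hasStrictFDerivAt_norm_sq y).hasFDerivAt.add_const b
    have h2 : HasDerivAt (fun z : ℝ => (z ^ m)⁻¹)
        (-(m * ((‖y‖ ^ 2 + b) ^ (m + 1))⁻¹)) (‖y‖ ^ 2 + b) := by
      have := (hasDerivAt_pow m (‖y‖ ^ 2 + b)).fun_inv (pow_pos hpos m).ne'
      refine this.congr_deriv ?_
      rcases m with _ | m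
      · simp
      · simp only [Nat.add_sub_cancel]
        field_simp
        ring
    have h3 := (h2.comp_hasFDerivAt y h1).smul (hψ.smooth.diffAt y).hasFDerivAt
    refine h3.congr_fderiv ?_
    ext v
    simp [shellQuot, shellTensor, smul_smul]
    rw [← sub_eq_add_neg]

/-- The derivative of a shell quotient is a combination of shell quotients with values in a larger
space, so the induction must range over all target spaces `E` and all exponents `m`. -/
lemma contDiff_shellQuot {b : ℝ} (hb : -1 ≤ b) (N : ℕ) : ∀ {E : Type} [NormedAddCommGroup E]
    [NormedSpace ℝ E] {ψ : Momentum → E}, IsShellFun ψ → ∀ m, ContDiff ℝ N (shellQuot ψ b m) := by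
  induction N with
  | zero =>
    intro E _ _ ψ hψ m
    exact contDiff_zero.2 (continuous_iff_continuousAt.2 fun y =>
      (hasFDerivAt_shellQuot hψ hb m y).continuousAt)
  | succ N ih =>
    intro E _ _ ψ hψ m
    have e : fderiv ℝ (shellQuot ψ b m) = fun y =>
        shellQuot (fderiv ℝ ψ) b m y - (m : ℝ) • shellQuot (shellTensor ψ) b (m + 1) y :=
      funext fun y => (hasFDerivAt_shellQuot hψ hb m y).fderiv
    push_cast
    refine contDiff_succ_iff_fderiv.2 ⟨fun y =>
      (hasFDerivAt_shellQuot hψ hb m y).differentiableAt, by simp, ?_⟩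
    rw [e]
    exact (ih hψ.fderiv m).sub ((ih hψ.shellTensor (m + 1)).const_smul (m : ℝ))

lemma contDiff_top_shellQuot {ψ : Momentum → E} (hψ : IsShellFun ψ) {b : ℝ} (hb : -1 ≤ b)
    (m : ℕ) : ContDiff ℝ ∞ (shellQuot ψ b m) :=
  contDiff_infty.2 fun N => contDiff_shellQuot hb N hψ m

end Shell

lemma IsShellFun.apply {E : Type} [NormedAddCommGroup E] [NormedSpace ℝ E]
    {ψ : Momentum → Momentum →L[ℝ] E} (hψ : IsShellFun ψ)
    (v : Momentum) : IsShellFun fun y => ψ y v where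
  smooth := hψ.smooth.clm_apply contDiff_const
  inner y hy := by simp [hψ.inner y hy]
  outer y hy := by simp [hψ.outer y hy]

/-- `Λ^e ψ(y) / (y² + b)^m` at `y = K_S / Λ`. -/
noncomputable def shellKernel {n : ℕ} (S : Finset (Fin n)) (ψ : Momentum → ℝ) (b : ℝ) (m : ℕ)
    (e : ℤ) (Λ : ℝ) (k : Fin n → Momentum) : ℝ :=
  Λ ^ e * shellQuot ψ b m (Λ⁻¹ • ∑ i ∈ S, k i)

/-- `k ↦ Λ⁻¹ K_S`, linear in `k`. -/
noncomputable def scaledSum {n : ℕ} (S : Finset (Fin n)) (Λ : ℝ) :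
    (Fin n → Momentum) →L[ℝ] Momentum :=
  Λ⁻¹ • ∑ i ∈ S, ContinuousLinearMap.proj i

lemma scaledSum_apply {n : ℕ} (S : Finset (Fin n)) (Λ : ℝ) (k : Fin n → Momentum) :
    scaledSum S Λ k = Λ⁻¹ • ∑ i ∈ S, k i := by
  simp [scaledSum]

lemma contDiff_shellKernel {n : ℕ} (S : Finset (Fin n)) {ψ : Momentum → ℝ} (hψ : IsShellFun ψ)
    {b : ℝ} (hb : -1 ≤ b) (m : ℕ) (e : ℤ) (Λ : ℝ) :
    ContDiff ℝ ∞ (shellKernel S ψ b m e Λ) := by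
  have : shellKernel S ψ b m e Λ = fun k => Λ ^ e * shellQuot ψ b m (scaledSum S Λ k) := by
    funext k; rw [scaledSum_apply]; rfl
  rw [this]
  exact contDiff_const.mul ((contDiff_top_shellQuot hψ hb m).comp (scaledSum S Λ).contDiff)

/-- Kernels of this form are closed under tangential derivatives: each one lowers the power of `Λ`
by one and produces at most one more power of the denominator. -/
lemma momDiff_shellKernel {n : ℕ} (S : Finset (Fin n)) {ψ : Momentum → ℝ} (hψ : IsShellFun ψ)
    {b : ℝ} (hb : -1 ≤ b) (m : ℕ) (e : ℤ) {Λ : ℝ} (hΛ : 0 < Λ) (q : Fin n × Fin n × Fin 4) :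
    momDiff q.1 q.2.1 q.2.2 (shellKernel S ψ b m e Λ) = fun k =>
      shellKernel S (fun y => fderiv ℝ ψ y (∑ i ∈ S, dirVec q i)) b m (e - 1) Λ k +
      (-m) * shellKernel S (fun y => shellTensor ψ y (∑ i ∈ S, dirVec q i)) b (m + 1) (e - 1) Λ
        k := by
  funext k
  have : shellKernel S ψ b m e Λ = fun k => Λ ^ e * shellQuot ψ b m (scaledSum S Λ k) := by
    funext k; rw [scaledSum_apply]; rfl
  rw [momDiff_apply, this]
  have h := ((hasFDerivAt_shellQuot hψ hb m (scaledSum S Λ k)).comp k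
    (scaledSum S Λ).hasFDerivAt).const_mul (Λ ^ e)
  erw [h.fderiv]
  simp only [shellKernel, shellQuot, scaledSum_apply, zpow_sub_one₀ hΛ.ne', smul_eq_mul,
    _root_.smul_apply, ContinuousLinearMap.comp_apply,
    _root_.sub_apply, map_smul]
  ring

lemma exists_bound_multiDiff_shellKernel {n : ℕ} (S : Finset (Fin n))
    (I : List (Fin n × Fin n × Fin 4)) : ∀ {ψ : Momentum → ℝ}, IsShellFun ψ → ∀ (m : ℕ) (e : ℤ),
    ∃ C, 0 ≤ C ∧ ∀ b Λ, -1 ≤ b → 0 < Λ → ∀ k,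
      |multiDiff I (shellKernel S ψ b m e Λ) k| ≤ C * Λ ^ (e - I.length) := by
  induction I using List.reverseRecOn with
  | nil =>
    intro ψ hψ m e
    obtain ⟨C, h0, hC⟩ := exists_bound_shellQuot hψ m
    refine ⟨C, h0, fun b Λ hb hΛ k => ?_⟩
    simp only [multiDiff_nil, shellKernel, List.length_nil, Nat.cast_zero, sub_zero, abs_mul,
      abs_of_pos (zpow_pos hΛ e)]
    rw [mul_comm]
    gcongr
    exact hC b hb _
  | append_singleton I q ih =>
    intro ψ hψ m e
    have f1 := hψ.fderiv.apply (∑ i ∈ S, dirVec q i)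
    have f2 := hψ.shellTensor.apply (∑ i ∈ S, dirVec q i)
    obtain ⟨C₁, h1, hC₁⟩ := ih f1 m (e - 1)
    obtain ⟨C₂, h2, hC₂⟩ := ih f2 (m + 1) (e - 1)
    refine ⟨C₁ + m * C₂, by positivity, fun b Λ hb hΛ k => ?_⟩
    rw [multiDiff_concat, momDiff_shellKernel S hψ hb m e hΛ,
      multiDiff_add (contDiff_shellKernel S f1 hb _ _ _)
        (contDiff_const.mul (contDiff_shellKernel S f2 hb _ _ _)),
      multiDiff_const_mul (contDiff_shellKernel S f2 hb _ _ _)]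
    have e1 : e - ((I ++ [q]).length : ℤ) = e - 1 - I.length := by
      simp only [List.length_append, List.length_singleton]; push_cast; ring
    rw [e1]
    refine (abs_add_le _ _).trans ?_
    rw [abs_mul, abs_neg, Nat.abs_cast, add_mul, mul_assoc]
    gcongr
    · exact hC₁ b Λ hb hΛ k
    · exact hC₂ b Λ hb hΛ k

/-! ### The scale derivative of the propagator -/

/-- The numerator of the scale derivative of the propagator, in units of the scale. -/
noncomputable def cutoffShell (K : ℝ → ℝ) (y : Momentum) : ℝ :=
  -2 * ‖y‖ ^ 2 * deriv K (‖y‖ ^ 2)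

lemma IsCutoff.deriv_eq_zero {K : ℝ → ℝ} (hK : IsCutoff K) {z : ℝ} (h0 : 0 ≤ z)
    (hz : z ≤ 1 ∨ 4 ≤ z) : deriv K z = 0 := by
  have hc : IsClosed {z | deriv K z = 0} :=
    isClosed_eq (hK.smooth.continuous_deriv (by simp)) continuous_const
  rcases hz with hz | hz
  · have hsub : Set.Ioo (0 : ℝ) 1 ⊆ {z | deriv K z = 0} := fun w hw => by
      have : K =ᶠ[nhds w] fun _ => 1 := by
        filter_upwards [isOpen_Ioo.mem_nhds hw] with v hv using hK.eq_one v hv.1.le hv.2.le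
      simp [this.deriv_eq]
    have := closure_minimal hsub hc
    rw [closure_Ioo zero_ne_one] at this
    exact this ⟨h0, hz⟩
  · have hsub : Set.Ioi (4 : ℝ) ⊆ {z | deriv K z = 0} := fun w hw => by
      have : K =ᶠ[nhds w] fun _ => 0 := by
        filter_upwards [isOpen_Ioi.mem_nhds hw] with v hv using hK.eq_zero v (le_of_lt hv)
      simp [this.deriv_eq]
    have := closure_minimal hsub hc
    rw [closure_Ioi] at this
    exact this hz

lemma IsCutoff.isShellFun {K : ℝ → ℝ} (hK : IsCutoff K) : IsShellFun (cutoffShell K) where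
  smooth := by
    have h1 : ContDiff ℝ ∞ fun y : Momentum => ‖y‖ ^ 2 := contDiff_norm_sq ℝ
    have h2 : ContDiff ℝ ∞ (deriv K) := (contDiff_infty_iff_deriv.1 hK.smooth).2
    exact (contDiff_const.mul h1).mul (h2.comp h1)
  inner y hy := by
    rw [cutoffShell, hK.deriv_eq_zero (by positivity) (Or.inl (by nlinarith [norm_nonneg y])),
      mul_zero]
  outer y hy := by
    rw [cutoffShell, hK.deriv_eq_zero (by positivity) (Or.inr (by nlinarith)), mul_zero]

/-- In units of `Λ` only `b = B / Λ ^ 2` remembers the scale, and `|B| ≤ ΛR ^ 2` gives `b ≥ -1` for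
`Λ ≥ ΛR`. The identity also holds where the denominator vanishes, division by zero being zero on
both sides. -/
lemma regPropDeriv_eq {K : ℝ → ℝ} (hK : IsCutoff K) (B : ℝ) {Λ : ℝ} (hΛ : 0 < Λ)
    (q : Momentum) :
    regPropDeriv K B Λ q = Λ ^ (-3 : ℤ) * shellQuot (cutoffShell K) (B / Λ ^ 2) 1 (Λ⁻¹ • q) := by
  have h1 : HasDerivAt (fun s : ℝ => ‖q‖ ^ 2 / s ^ 2) (-2 * ‖q‖ ^ 2 / Λ ^ 3) Λ := by
    have := ((hasDerivAt_pow 2 Λ).fun_inv (pow_pos hΛ 2).ne').const_mul (‖q‖ ^ 2)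
    simp only [← div_eq_mul_inv] at this
    refine this.congr_deriv ?_
    field_simp
    push_cast
    ring
  have h2 : HasDerivAt (fun s => regProp K B s q)
      (deriv K (‖q‖ ^ 2 / Λ ^ 2) * (-2 * ‖q‖ ^ 2 / Λ ^ 3) / (‖q‖ ^ 2 + B)) Λ :=
    (((hK.smooth.diffAt _).hasDerivAt).comp Λ h1).div_const _
  rw [regPropDeriv, h2.deriv, shellQuot, cutoffShell, norm_smul, norm_inv,
    Real.norm_of_nonneg hΛ.le]
  have e1 : (Λ⁻¹ * ‖q‖) ^ 2 = ‖q‖ ^ 2 / Λ ^ 2 := by field_simp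
  have e2 : ‖q‖ ^ 2 / Λ ^ 2 + B / Λ ^ 2 = (‖q‖ ^ 2 + B) / Λ ^ 2 := by ring
  rw [e1, e2, pow_one, inv_div, smul_eq_mul, zpow_neg]
  norm_cast
  field_simp

lemma regPropDeriv_outer {K : ℝ → ℝ} (hK : IsCutoff K) (B : ℝ) {Λ : ℝ} (hΛ : 0 < Λ)
    {q : Momentum} (hq : 2 * Λ ≤ ‖q‖) : regPropDeriv K B Λ q = 0 := by
  rw [regPropDeriv_eq hK B hΛ, shellQuot_outer hK.isShellFun, mul_zero]
  rw [norm_smul, norm_inv, Real.norm_of_nonneg hΛ.le, le_inv_mul_iff₀ hΛ]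
  linarith

lemma regPropDeriv_zero {K : ℝ → ℝ} (hK : IsCutoff K) (B : ℝ) {Λ : ℝ} (hΛ : 0 < Λ) :
    regPropDeriv K B Λ 0 = 0 := by
  rw [regPropDeriv_eq hK B hΛ, shellQuot_inner hK.isShellFun _ _ (by simp), mul_zero]

lemma contDiff_regPropDeriv {K : ℝ → ℝ} (hK : IsCutoff K) {B Λ : ℝ} (hΛ : 0 < Λ)
    (hB : -1 ≤ B / Λ ^ 2) : ContDiff ℝ ∞ (regPropDeriv K B Λ) := by
  rw [funext (regPropDeriv_eq hK B hΛ)]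
  exact contDiff_const.mul ((contDiff_top_shellQuot hK.isShellFun hB 1).comp
    (contDiff_const_smul Λ⁻¹))

/-! ### One-sided differentiation of integrals in the cutoff -/

open MeasureTheory Filter Topology Set in
/-- Differentiation under the integral sign, one-sided, from a uniform Lipschitz bound and
pointwise derivatives. -/
lemma exists_hasDerivWithinAt_integral {α : Type*} [MeasurableSpace α] {μ : Measure α}
    [IsFiniteMeasure μ] {G : ℝ → α → ℝ} {s : Set ℝ} {x₀ δ M : ℝ} {b : α → ℝ} (hδ : 0 < δ)
    (hx : x₀ ∈ s) (hint : ∀ y ∈ s, |y - x₀| < δ → Integrable (G y) μ)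
    (hlip : ∀ᵐ a ∂μ, ∀ y ∈ s, |y - x₀| < δ → |G y a - G x₀ a| ≤ M * |y - x₀|)
    (hder : ∀ᵐ a ∂μ, ∃ v, HasDerivWithinAt (fun y => G y a) v s x₀ ∧ |v| ≤ b a)
    (hb : Integrable b μ) :
    ∃ V, HasDerivWithinAt (fun y => ∫ a, G y a ∂μ) V s x₀ ∧ |V| ≤ ∫ a, b a ∂μ := by
  classical
  set v : α → ℝ := fun a =>
    if h : ∃ v, HasDerivWithinAt (fun y => G y a) v s x₀ ∧ |v| ≤ b a then h.choose else 0 with hv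
  have hv' : ∀ᵐ a ∂μ, HasDerivWithinAt (fun y => G y a) (v a) s x₀ ∧ |v a| ≤ b a := by
    filter_upwards [hder] with a ha
    simp only [hv, dif_pos ha]
    exact ha.choose_spec
  have hnear : ∀ᶠ y in 𝓝[s \ {x₀}] x₀, y ∈ s ∧ y ≠ x₀ ∧ |y - x₀| < δ := by
    have h1 : ∀ᶠ y in 𝓝[s \ {x₀}] x₀, |y - x₀| < δ :=
      mem_nhdsWithin_of_mem_nhds (Metric.ball_mem_nhds x₀ hδ)
    filter_upwards [h1, self_mem_nhdsWithin] with y h2 h3 using ⟨h3.1, h3.2, h2⟩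
  have hle : ‖∫ a, v a ∂μ‖ ≤ ∫ a, b a ∂μ :=
    norm_integral_le_of_norm_le hb (hv'.mono fun a ha => ha.2)
  refine ⟨∫ a, v a ∂μ, ?_, hle⟩
  rw [hasDerivWithinAt_iff_tendsto_slope]
  have key := tendsto_integral_filter_of_dominated_convergence (μ := μ)
    (l := 𝓝[s \ {x₀}] x₀) (F := fun y a => slope (fun y => G y a) x₀ y) (f := v) (fun _ => M)
    ?_ ?_ (integrable_const M) ?_
  · refine key.congr' ?_
    filter_upwards [hnear] with y hy
    simp only [slope_def_module, smul_eq_mul]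
    rw [integral_const_mul, integral_sub (hint y hy.1 hy.2.2) (hint x₀ hx (by simpa using hδ))]
  · filter_upwards [hnear] with y hy
    simp only [slope_def_module, smul_eq_mul]
    exact (((hint y hy.1 hy.2.2).sub (hint x₀ hx (by simpa using hδ))).const_mul _).1
  · filter_upwards [hnear] with y hy
    filter_upwards [hlip] with a ha
    have hpos : 0 < |y - x₀| := abs_pos.2 (sub_ne_zero.2 hy.2.1)
    rw [slope_def_module, norm_smul, norm_inv, Real.norm_eq_abs, Real.norm_eq_abs,
      inv_mul_le_iff₀ hpos, mul_comm]
    exact ha y hy.1 hy.2.2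
  · filter_upwards [hv'] with a ha
    exact hasDerivWithinAt_iff_tendsto_slope.1 ha.1

open MeasureTheory Filter Topology Set in
/-- The right derivative of `y ↦ ∫_Λ^y g(s, y) ds`, where `g(s, y)` matters only for `s ≤ y`. -/
lemma exists_hasDerivWithinAt_flow_integral {g : ℝ → ℝ → ℝ} {Λ x₀ δ M : ℝ} {b : ℝ → ℝ}
    (hΛ : Λ ≤ x₀) (hδ : 0 < δ) (hM : 0 ≤ M)
    (hcont : ∀ y, Λ ≤ y → |y - x₀| < δ → ContinuousOn (fun s => g s y) (Icc Λ y))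
    (hlip : ∀ s y y', Λ ≤ s → s ≤ y → s ≤ y' → |y - x₀| < δ → |y' - x₀| < δ →
      |g s y - g s y'| ≤ M * |y - y'|)
    (hder : ∀ s, Λ ≤ s → s < x₀ → ∃ v, HasDerivWithinAt (g s) v (Ici s) x₀ ∧ |v| ≤ b s)
    (hb : ContinuousOn b (Icc Λ x₀)) :
    ∃ V, HasDerivWithinAt (fun y => ∫ s in Λ..y, g s y) V (Ici Λ) x₀ ∧
      |V| ≤ |g x₀ x₀| + ∫ s in Λ..x₀, b s := by
  -- Clamping the arguments extends `g` from `Λ ≤ s ≤ y` to all `s < x₀ + δ` while keeping the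
  -- Lipschitz bound in `y`.
  set h : ℝ → ℝ → ℝ := fun s y => g (max s Λ) (max (max s Λ) y) with hh
  have near_max : ∀ s y, s < x₀ + δ → |y - x₀| < δ → |max (max s Λ) y - x₀| < δ := by
    intro s y hs hy
    rw [abs_lt] at hy ⊢
    constructor
    · linarith [le_max_right (max s Λ) y]
    · have : max (max s Λ) y < x₀ + δ := max_lt (max_lt hs (by linarith)) (by linarith)
      linarith
  have hlip' : ∀ s y y', s < x₀ + δ → |y - x₀| < δ → |y' - x₀| < δ →
      |h s y - h s y'| ≤ M * |y - y'| := by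
    intro s y y' hs hy hy'
    refine (hlip _ _ _ (le_max_right _ _) (le_max_left _ _) (le_max_left _ _) (near_max s y hs hy)
      (near_max s y' hs hy')).trans ?_
    refine mul_le_mul_of_nonneg_left ?_ hM
    have := abs_max_sub_max_le_max (max s Λ) y (max s Λ) y'
    refine this.trans (max_le ?_ le_rfl)
    rw [sub_self, abs_zero]
    exact abs_nonneg _
  have hcont' : ∀ y, |y - x₀| < δ → ContinuousOn (fun s => h s y) (Iio (x₀ + δ)) := by
    intro y hy s₁ hs₁
    refine ContinuousAt.continuousWithinAt ?_
    refine Metric.continuousAt_iff'.2 fun ε hε => ?_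
    set w₁ := max (max s₁ Λ) y with hw₁
    have hw₁δ := near_max s₁ y hs₁ hy
    have hc : Tendsto (fun w => M * |w₁ - w|) (𝓝[>] w₁) (𝓝 0) := by
      have : ContinuousAt (fun w => M * |w₁ - w|) w₁ := by fun_prop
      have h2 := this.tendsto
      simp only [sub_self, abs_zero, mul_zero] at h2
      exact h2.mono_left nhdsWithin_le_nhds
    have hw₁lt : w₁ < x₀ + δ := by linarith [(abs_lt.1 hw₁δ).2]
    -- Continuity of `g` in its first argument is available only up to the second. Raising the
    -- second argument to `w₂ > w₁` leaves room on both sides of `s₁`, at a Lipschitz cost below `ε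
    -- / 3` paid twice.
    obtain ⟨w₂, ⟨hw₂e, hw₂δ⟩, hw₂⟩ := ((hc.eventually_lt_const (by positivity : 0 < ε / 3)).and
      (mem_nhdsWithin_of_mem_nhds (Iio_mem_nhds hw₁lt)) |>.and self_mem_nhdsWithin).exists
    replace hw₂δ : w₂ < x₀ + δ := hw₂δ
    replace hw₂ : w₁ < w₂ := hw₂
    have hw₂near : |w₂ - x₀| < δ := by
      rw [abs_lt] at hw₁δ ⊢
      constructor <;> linarith
    have hΛw : Λ ≤ w₁ := (le_max_right _ _).trans (le_max_left _ _)
    have hs₁w : max s₁ Λ ≤ w₁ := le_max_left _ _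
    have hF : ContinuousAt (fun s => g (max s Λ) w₂) s₁ := by
      have h1 : ContinuousOn (fun s => g (max s Λ) w₂) (Iio w₂) :=
        (hcont w₂ (hΛw.trans hw₂.le) hw₂near).comp (by fun_prop)
          fun s hs => ⟨le_max_right _ _, max_le (le_of_lt hs) (hΛw.trans hw₂.le)⟩
      exact h1.continuousAt (Iio_mem_nhds ((le_max_left _ _).trans_lt (hs₁w.trans_lt hw₂)))
    have e1 := Metric.continuousAt_iff'.1 hF (ε / 3) (by positivity)
    have hcm : ContinuousAt (fun s => M * |max (max s Λ) y - w₂|) s₁ := by fun_prop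
    have e2 := hcm.eventually_lt_const hw₂e
    have e3 : ∀ᶠ s in 𝓝 s₁, s < w₂ :=
      Iio_mem_nhds ((le_max_left _ _).trans_lt (hs₁w.trans_lt hw₂))
    filter_upwards [e1, e2, e3] with s f1 f2 f3
    rw [Real.dist_eq] at f1 ⊢
    have hsw : max s Λ ≤ w₂ := max_le f3.le (hΛw.trans hw₂.le)
    have g1 := hlip (max s Λ) (max (max s Λ) y) w₂ (le_max_right _ _) (le_max_left _ _) hsw
      (near_max s y (f3.trans hw₂δ) hy) hw₂near
    have g2 := hlip (max s₁ Λ) w₂ w₁ (le_max_right _ _) (hs₁w.trans hw₂.le) hs₁w hw₂near hw₁δ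
    rw [abs_sub_comm w₂ w₁] at g2
    have g3 : h s y - h s₁ y = (g (max s Λ) (max (max s Λ) y) - g (max s Λ) w₂) +
      (g (max s Λ) w₂ - g (max s₁ Λ) w₂) + (g (max s₁ Λ) w₂ - g (max s₁ Λ) w₁) := by
      simp only [hh, hw₁]; ring
    rw [g3]
    refine (abs_add_three _ _ _).trans_lt ?_
    linarith
  have hx₀δ : |x₀ - x₀| < δ := by simpa using hδ
  have hii : ∀ y, |y - x₀| < δ → ∀ a b, a < x₀ + δ → b < x₀ + δ →
      IntervalIntegrable (fun s => h s y) volume a b := fun y hy a b ha hb =>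
    ((hcont' y hy).mono fun s hs => (mem_uIcc.1 hs).elim (fun h => h.2.trans_lt hb)
      (fun h => h.2.trans_lt ha)).intervalIntegrable
  -- The three terms vary the integrand, the upper limit, and both at once; their derivatives at
  -- `x₀` are the integral of the derivative, the endpoint value, and zero.
  have hdecomp : ∀ y ∈ Ici Λ, |y - x₀| < δ → ∫ s in Λ..y, g s y =
      (∫ s in Λ..x₀, h s y) + (∫ s in x₀..y, h s x₀) + ∫ s in x₀..y, (h s y - h s x₀) := by
    intro y hy hyδ
    have hyl : y < x₀ + δ := by linarith [(abs_lt.1 hyδ).2]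
    have e1 : ∫ s in Λ..y, g s y = ∫ s in Λ..y, h s y := by
      refine intervalIntegral.integral_congr fun s hs => ?_
      rw [uIcc_of_le hy] at hs
      simp only [hh]
      rw [max_eq_left hs.1, max_eq_right hs.2]
    rw [e1, intervalIntegral.integral_sub (hii y hyδ _ _ (by linarith) hyl)
      (hii x₀ hx₀δ _ _ (by linarith) hyl), ← intervalIntegral.integral_add_adjacent_intervals
      (hii y hyδ Λ x₀ (by linarith) (by linarith)) (hii y hyδ x₀ y (by linarith) hyl)]
    ring
  have T1 : HasDerivAt (fun y => ∫ s in x₀..y, h s x₀) (h x₀ x₀) x₀ :=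
    intervalIntegral.integral_hasDerivAt_right (hii x₀ hx₀δ _ _ (by linarith) (by linarith))
      ((hcont' x₀ hx₀δ).stronglyMeasurableAtFilter isOpen_Iio x₀ (by simpa using hδ))
      ((hcont' x₀ hx₀δ).continuousAt (Iio_mem_nhds (by linarith)))
  -- An integrand of size `M * |y - x₀|` over an interval of length `|y - x₀|` is quadratically
  -- small.
  have T3 : HasDerivWithinAt (fun y => ∫ s in x₀..y, (h s y - h s x₀)) 0 (Ici Λ) x₀ := by
    have : HasFDerivAt (fun y => ∫ s in x₀..y, (h s y - h s x₀)) (0 : ℝ →L[ℝ] ℝ) x₀ := by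
      refine Asymptotics.IsBigO.hasFDerivAt (n := 2) ?_ one_lt_two
      refine Asymptotics.IsBigO.of_bound M ?_
      filter_upwards [Metric.ball_mem_nhds x₀ hδ] with y hy
      rw [Metric.mem_ball, Real.dist_eq] at hy
      have := intervalIntegral.norm_integral_le_of_norm_le_const (a := x₀) (b := y)
        (C := M * |y - x₀|) (f := fun s => h s y - h s x₀) fun s hs => by
          refine hlip' s y x₀ ?_ hy hx₀δ
          have h1 : s ≤ max x₀ y := hs.2
          exact h1.trans_lt (max_lt (by linarith) (by linarith [(abs_lt.1 hy).2]))
      refine this.trans (le_of_eq ?_)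
      simp only [norm_pow, Real.norm_eq_abs, abs_abs]
      ring
    simpa using this.hasDerivAt.hasDerivWithinAt
  -- The open interval is used because derivatives are supplied only for `s < x₀`, where clamping
  -- does not alter `g s` near `x₀`.
  obtain ⟨V, hV, hVb⟩ := exists_hasDerivWithinAt_integral (μ := volume.restrict (Ioo Λ x₀))
    (G := fun y s => h s y) (s := Ici Λ) (M := M) (b := b) hδ hΛ
    (fun y _ hyδ => by
      have := (hii y hyδ Λ x₀ (by linarith) (by linarith))
      rw [intervalIntegrable_iff_integrableOn_Ioc_of_le hΛ] at this
      exact this.mono_set Ioo_subset_Ioc_self)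
    ((ae_restrict_iff' measurableSet_Ioo).2 (Eventually.of_forall fun s hs y _ hyδ =>
      hlip' s y x₀ (by linarith [hs.2]) hyδ hx₀δ))
    ((ae_restrict_iff' measurableSet_Ioo).2 (Eventually.of_forall fun s hs => by
      obtain ⟨v, hv, hvb⟩ := hder s hs.1.le hs.2
      refine ⟨v, ?_, hvb⟩
      refine ((hv.hasDerivAt (Ici_mem_nhds hs.2)).congr_of_eventuallyEq ?_).hasDerivWithinAt
      filter_upwards [Ici_mem_nhds hs.2] with y hy
      simp only [hh]
      rw [max_eq_left hs.1.le, max_eq_right hy]))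
    ((hb.integrableOn_compact isCompact_Icc).mono_set Ioo_subset_Icc_self)
  refine ⟨V + h x₀ x₀ + 0, ?_, ?_⟩
  · have hV' : HasDerivWithinAt (fun y => ∫ s in Λ..x₀, h s y) V (Ici Λ) x₀ := by
      refine hV.congr_of_eventuallyEq (Eventually.of_forall fun y => ?_) ?_ <;> beta_reduce <;>
      rw [intervalIntegral.integral_of_le hΛ, integral_Ioc_eq_integral_Ioo]
    refine ((hV'.add T1.hasDerivWithinAt).add T3).congr_of_eventuallyEq ?_ ?_
    · filter_upwards [self_mem_nhdsWithin,
        mem_nhdsWithin_of_mem_nhds (Metric.ball_mem_nhds x₀ hδ)] with y hy hyδ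
      exact hdecomp y hy hyδ
    · exact hdecomp x₀ hΛ hx₀δ
  · have e : h x₀ x₀ = g x₀ x₀ := by simp only [hh]; rw [max_eq_left hΛ, max_self]
    rw [intervalIntegral.integral_of_le hΛ, integral_Ioc_eq_integral_Ioo, e, add_zero]
    refine (abs_add_le _ _).trans ?_
    linarith

/-! ### Momentum integrals with a compactly supported kernel -/

section Parameter

open MeasureTheory Filter Topology Set

variable {V W : Type} [NormedAddCommGroup V] [NormedSpace ℝ V] [NormedAddCommGroup W]
  [NormedSpace ℝ W]

lemma contDiff_integral_mul {u : W → ℝ} (hu : ContDiff ℝ ∞ u) (A : V →L[ℝ] W)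
    (C : Momentum →L[ℝ] W) {h : Momentum → ℝ} (hh : ContDiff ℝ ∞ h) {R : ℝ}
    (hR : ∀ q, R ≤ ‖q‖ → h q = 0) :
    ContDiff ℝ ∞ fun k => ∫ q, u (A k + C q) * h q := by
  -- The integral is the convolution of the constant `1` with a compactly supported function
  -- depending on the parameter, evaluated at `0`; the reflected arguments undo the sign in the
  -- convolution.
  have key := contDiffOn_convolution_right_with_param_comp (μ := (volume : Measure Momentum))
    (ContinuousLinearMap.mul ℝ ℝ) (n := ⊤) (s := (univ : Set V)) (v := fun _ => (0 : Momentum))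
    contDiffOn_const (f := fun _ => (1 : ℝ)) (g := fun k q => u (A k + C (-q)) * h (-q))
    (k := Metric.closedBall 0 R) isOpen_univ (isCompact_closedBall 0 R)
    (fun p x _ hx => by
      have : R ≤ ‖-x‖ := by
        rw [norm_neg]; simp only [Metric.mem_closedBall, dist_zero_right, not_le] at hx
        exact hx.le
      rw [hR _ this, mul_zero])
    (locallyIntegrable_const 1)
    (ContDiff.contDiffOn (by
      have h1 : ContDiff ℝ ∞ fun x : V × Momentum => A x.1 + C (-x.2) := by fun_prop
      exact (hu.comp h1).mul (hh.comp contDiff_snd.neg)))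
  rw [contDiffOn_univ] at key
  refine (congrArg (ContDiff ℝ ∞) (funext fun k => ?_)).mp key
  simp [convolution]

lemma fderiv_integral_mul {u : W → ℝ} (hu : ContDiff ℝ ∞ u) (A : V →L[ℝ] W)
    (C : Momentum →L[ℝ] W) {h : Momentum → ℝ} (hh : Continuous h) {R : ℝ}
    (hR : ∀ q, R ≤ ‖q‖ → h q = 0) [ProperSpace V] (k v : V) :
    fderiv ℝ (fun k => ∫ q, u (A k + C q) * h q) k v =
      ∫ q, fderiv ℝ u (A k + C q) (A v) * h q := by
  have hdu : Continuous (fderiv ℝ u) := hu.continuous_fderiv (by simp)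
  set F' : V → Momentum → V →L[ℝ] ℝ := fun k q => h q • (fderiv ℝ u (A k + C q)).comp A with hF'
  have hcs : HasCompactSupport h := HasCompactSupport.intro (isCompact_closedBall 0 R)
    fun q hq => hR q (by simp at hq; exact hq.le)
  have hF'c : Continuous fun x : V × Momentum => F' x.1 x.2 := by
    refine (hh.comp continuous_snd).smul (Continuous.clm_comp (hdu.comp ?_) continuous_const)
    fun_prop
  have hint : ∀ k, Integrable fun q => u (A k + C q) * h q := fun k =>
    ((hu.continuous.comp (by fun_prop)).mul hh).integrable_of_hasCompactSupport hcs.mul_left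
  have hint' : Integrable (F' k) := by
    refine (hF'c.comp (Continuous.prodMk_right k)).integrable_of_hasCompactSupport ?_
    exact hcs.smul_right
  obtain ⟨M, hM⟩ := ((isCompact_closedBall k 1).prod
    (isCompact_closedBall (0 : Momentum) R)).exists_bound_of_continuousOn hF'c.continuousOn
  have key := hasFDerivAt_integral_of_dominated_of_fderiv_le (μ := (volume : Measure Momentum))
    (F := fun k q => u (A k + C q) * h q) (F' := F') (x₀ := k) (s := Metric.closedBall k 1)
    (bound := (Metric.closedBall (0 : Momentum) R).indicator fun _ => M)
    (Metric.closedBall_mem_nhds k one_pos) (Eventually.of_forall fun l => (hint l).1) (hint k)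
    hint'.1
    (Eventually.of_forall fun q l hl => by
      by_cases hq : q ∈ Metric.closedBall (0 : Momentum) R
      · rw [indicator_of_mem hq]
        exact hM (l, q) ⟨hl, hq⟩
      · rw [indicator_of_notMem hq]
        simp only [Metric.mem_closedBall, dist_zero_right, not_le] at hq
        simp [hF', hR q hq.le])
    ((integrable_indicator_iff measurableSet_closedBall).2
      (integrableOn_const (isCompact_closedBall 0 R).measure_lt_top.ne))
    (Eventually.of_forall fun q l _ => by
      have h1 : HasFDerivAt (fun l => A l + C q) A l := A.hasFDerivAt.add_const (C q)
      have h2 := ((hu.diffAt (A l + C q)).hasFDerivAt.comp l h1).mul_const (h q)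
      exact h2)
  rw [key.fderiv, ContinuousLinearMap.integral_apply hint']
  refine integral_congr_ae (Eventually.of_forall fun q => ?_)
  simp [hF', mul_comm]

end Parameter

/-! ### Polynomials in the logarithm -/

lemma NonnegCoeffs.add {p q : Polynomial ℝ} (hp : NonnegCoeffs p) (hq : NonnegCoeffs q) :
    NonnegCoeffs (p + q) := fun i => by
  rw [Polynomial.coeff_add]; exact add_nonneg (hp i) (hq i)

lemma NonnegCoeffs.mul {p q : Polynomial ℝ} (hp : NonnegCoeffs p) (hq : NonnegCoeffs q) :
    NonnegCoeffs (p * q) := fun i => by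
  rw [Polynomial.coeff_mul]; exact Finset.sum_nonneg fun x _ => mul_nonneg (hp _) (hq _)

lemma nonnegCoeffs_zero : NonnegCoeffs 0 := fun i => by simp

lemma nonnegCoeffs_C {c : ℝ} (hc : 0 ≤ c) : NonnegCoeffs (Polynomial.C c) := fun i => by
  rw [Polynomial.coeff_C]; split_ifs <;> simp [hc]

lemma nonnegCoeffs_X : NonnegCoeffs Polynomial.X := fun i => by
  rw [Polynomial.coeff_X]; split_ifs <;> simp

lemma nonnegCoeffs_sum {ι : Type*} (s : Finset ι) {p : ι → Polynomial ℝ}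
    (h : ∀ a ∈ s, NonnegCoeffs (p a)) : NonnegCoeffs (∑ a ∈ s, p a) := fun i => by
  rw [Polynomial.finsetSum_coeff]; exact Finset.sum_nonneg fun a ha => h a ha i

lemma Pln_add (p q : Polynomial ℝ) (z : ℝ) : Pln (p + q) z = Pln p z + Pln q z := by simp [Pln]

lemma Pln_mul (p q : Polynomial ℝ) (z : ℝ) : Pln (p * q) z = Pln p z * Pln q z := by simp [Pln]

lemma Pln_C (c z : ℝ) : Pln (Polynomial.C c) z = c := by simp [Pln]

lemma Pln_X (z : ℝ) : Pln Polynomial.X z = Real.log z := by simp [Pln]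

lemma Pln_sum {ι : Type*} (s : Finset ι) (p : ι → Polynomial ℝ) (z : ℝ) :
    Pln (∑ a ∈ s, p a) z = ∑ a ∈ s, Pln (p a) z := by simp [Pln, Polynomial.eval_finsetSum]

lemma Pln_nonneg {p : Polynomial ℝ} (hp : NonnegCoeffs p) {z : ℝ} (hz : 1 ≤ z) : 0 ≤ Pln p z := by
  rw [Pln, Polynomial.eval_eq_sum]
  exact Finset.sum_nonneg fun i _ => mul_nonneg (hp i) (pow_nonneg (Real.log_nonneg hz) i)

lemma Pln_div_nonneg {p : Polynomial ℝ} (hp : NonnegCoeffs p) {ρ x : ℝ} (hρ : 0 < ρ)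
    (hx : ρ ≤ x) : 0 ≤ Pln p (x / ρ) :=
  Pln_nonneg hp ((one_le_div hρ).2 hx)

/-! ### Calculus of bounds uniform over theories -/

/-- Functions of the momenta depending on a theory, the UV cutoff and the scale. -/
abbrev ScaleFamily (𝒯 : Type) (n : ℕ) : Type := 𝒯 → ℝ → ℝ → (Fin n → Momentum) → ℝ

section Bounds

variable {𝒯 : Type} {ρ : 𝒯 → ℝ} {n : ℕ}

/-- `|f| ≤ Λ^d ρ^{-r} C(ln (Λ₀/ρ))` on `Dom Λ`, where `ρ` is the renormalization scale. -/
def ValBoundWith (C : Polynomial ℝ) (ρ : 𝒯 → ℝ) (Dom : ℝ → Set (Fin n → Momentum)) (d : ℤ)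
    (r : ℕ) (f : ScaleFamily 𝒯 n) : Prop :=
  ∀ T x Λ, ρ T < x → ρ T ≤ Λ → Λ ≤ x → ∀ k ∈ Dom Λ,
    |f T x Λ k| ≤ Λ ^ d * (ρ T ^ r)⁻¹ * Pln C (x / ρ T)

/-- The cutoff derivative of `f` exists and is at most `Λ^d ρ^{-r} Λ₀^{-2} C(ln (Λ₀/ρ))` on
`Dom Λ`. -/
def DerBoundWith (C : Polynomial ℝ) (ρ : 𝒯 → ℝ) (Dom : ℝ → Set (Fin n → Momentum)) (d : ℤ)
    (r : ℕ) (f : ScaleFamily 𝒯 n) : Prop :=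
  ∀ T x Λ, ρ T < x → ρ T ≤ Λ → Λ ≤ x → ∀ k ∈ Dom Λ,
    ∃ v, HasDerivWithinAt (fun y => f T y Λ k) v (Set.Ici Λ) x ∧
      |v| ≤ Λ ^ d * (ρ T ^ r)⁻¹ * (x ^ 2)⁻¹ * Pln C (x / ρ T)

/-- `ValBoundWith` for some polynomial with nonnegative coefficients. -/
def ValBound (ρ : 𝒯 → ℝ) (Dom : ℝ → Set (Fin n → Momentum)) (d : ℤ) (r : ℕ)
    (f : ScaleFamily 𝒯 n) : Prop := ∃ C, NonnegCoeffs C ∧ ValBoundWith C ρ Dom d r f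

/-- `DerBoundWith` for some polynomial with nonnegative coefficients. -/
def DerBound (ρ : 𝒯 → ℝ) (Dom : ℝ → Set (Fin n → Momentum)) (d : ℤ) (r : ℕ)
    (f : ScaleFamily 𝒯 n) : Prop := ∃ C, NonnegCoeffs C ∧ DerBoundWith C ρ Dom d r f

/-- A value bound of degree `d`, and a cutoff derivative that gains `Λ/Λ₀`. -/
def UBound (ρ : 𝒯 → ℝ) (Dom : ℝ → Set (Fin n → Momentum)) (d : ℤ) (r : ℕ)
    (f : ScaleFamily 𝒯 n) : Prop := ValBound ρ Dom d r f ∧ DerBound ρ Dom (d + 1) r f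

variable {Dom : ℝ → Set (Fin n → Momentum)} {d : ℤ} {r : ℕ} {f g : ScaleFamily 𝒯 n}

lemma ValBound.congr (hf : ValBound ρ Dom d r f)
    (h : ∀ T x Λ, ρ T < x → ρ T ≤ Λ → Λ ≤ x → ∀ k ∈ Dom Λ, g T x Λ k = f T x Λ k) :
    ValBound ρ Dom d r g := by
  obtain ⟨C, hC, H⟩ := hf
  exact ⟨C, hC, fun T x Λ h1 h2 h3 k hk => by
    rw [h T x Λ h1 h2 h3 k hk]
    exact H T x Λ h1 h2 h3 k hk⟩

/-- Near `x` and within `[Λ, ∞)` every cutoff is admissible, so agreement on admissible arguments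
determines the one-sided derivative. -/
lemma DerBound.congr (hf : DerBound ρ Dom d r f)
    (h : ∀ T x Λ, ρ T < x → ρ T ≤ Λ → Λ ≤ x → ∀ k ∈ Dom Λ, g T x Λ k = f T x Λ k) :
    DerBound ρ Dom d r g := by
  obtain ⟨C, hC, H⟩ := hf
  refine ⟨C, hC, fun T x Λ h1 h2 h3 k hk => ?_⟩
  obtain ⟨v, hv, hvb⟩ := H T x Λ h1 h2 h3 k hk
  refine ⟨v, hv.congr_of_eventuallyEq ?_ (h T x Λ h1 h2 h3 k hk), hvb⟩
  filter_upwards [self_mem_nhdsWithin, mem_nhdsWithin_of_mem_nhds (Ioi_mem_nhds h1)] with y hy hy'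
  exact h T y Λ hy' h2 hy k hk

lemma UBound.congr (hf : UBound ρ Dom d r f)
    (h : ∀ T x Λ, ρ T < x → ρ T ≤ Λ → Λ ≤ x → ∀ k ∈ Dom Λ, g T x Λ k = f T x Λ k) :
    UBound ρ Dom d r g := ⟨hf.1.congr h, hf.2.congr h⟩

lemma ValBound.add (hf : ValBound ρ Dom d r f) (hg : ValBound ρ Dom d r g) :
    ValBound ρ Dom d r fun T x Λ k => f T x Λ k + g T x Λ k := by
  obtain ⟨C, hC, H⟩ := hf
  obtain ⟨C', hC', H'⟩ := hg
  refine ⟨C + C', hC.add hC', fun T x Λ h1 h2 h3 k hk => ?_⟩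
  rw [Pln_add, mul_add]
  exact (abs_add_le _ _).trans (add_le_add (H T x Λ h1 h2 h3 k hk) (H' T x Λ h1 h2 h3 k hk))

lemma DerBound.add (hf : DerBound ρ Dom d r f) (hg : DerBound ρ Dom d r g) :
    DerBound ρ Dom d r fun T x Λ k => f T x Λ k + g T x Λ k := by
  obtain ⟨C, hC, H⟩ := hf
  obtain ⟨C', hC', H'⟩ := hg
  refine ⟨C + C', hC.add hC', fun T x Λ h1 h2 h3 k hk => ?_⟩
  obtain ⟨v, hv, hvb⟩ := H T x Λ h1 h2 h3 k hk
  obtain ⟨w, hw, hwb⟩ := H' T x Λ h1 h2 h3 k hk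
  refine ⟨v + w, hv.add hw, ?_⟩
  rw [Pln_add, mul_add]
  exact (abs_add_le _ _).trans (add_le_add hvb hwb)

lemma UBound.add (hf : UBound ρ Dom d r f) (hg : UBound ρ Dom d r g) :
    UBound ρ Dom d r fun T x Λ k => f T x Λ k + g T x Λ k :=
  ⟨hf.1.add hg.1, hf.2.add hg.2⟩

lemma DerBound.zero
    (h : ∀ T x Λ, ρ T < x → ρ T ≤ Λ → Λ ≤ x → ∀ k ∈ Dom Λ, f T x Λ k = 0) :
    DerBound ρ Dom d r f := by
  refine DerBound.congr (f := fun _ _ _ _ => 0) ⟨0, nonnegCoeffs_zero, fun T x Λ h1 h2 h3 k hk =>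
    ⟨0, hasDerivWithinAt_const _ _ _, ?_⟩⟩ h
  simp [Pln]

lemma UBound.zero
    (h : ∀ T x Λ, ρ T < x → ρ T ≤ Λ → Λ ≤ x → ∀ k ∈ Dom Λ, f T x Λ k = 0) :
    UBound ρ Dom d r f := by
  refine ⟨⟨0, nonnegCoeffs_zero, fun T x Λ h1 h2 h3 k hk => ?_⟩, DerBound.zero h⟩
  simp [Pln, h T x Λ h1 h2 h3 k hk]

lemma DerBound.sum {ι : Type*} (s : Finset ι) {F : ι → ScaleFamily 𝒯 n}
    (h : ∀ a ∈ s, DerBound ρ Dom d r (F a)) :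
    DerBound ρ Dom d r fun T x Λ k => ∑ a ∈ s, F a T x Λ k := by
  classical
  induction s using Finset.induction_on with
  | empty => exact DerBound.zero fun T x Λ _ _ _ k _ => by simp
  | insert a s ha ih =>
    simp only [Finset.sum_insert ha]
    exact (h a (by simp)).add (ih fun b hb => h b (by simp [hb]))

lemma UBound.union (hρ : ∀ T, 0 < ρ T) {Dom₁ Dom₂ : ℝ → Set (Fin n → Momentum)}
    (h₁ : UBound ρ Dom₁ d r f) (h₂ : UBound ρ Dom₂ d r f) (h : ∀ Λ, Dom Λ ⊆ Dom₁ Λ ∪ Dom₂ Λ) :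
    UBound ρ Dom d r f := by
  obtain ⟨⟨C₁, hC₁, H₁⟩, C₁', hC₁', H₁'⟩ := h₁
  obtain ⟨⟨C₂, hC₂, H₂⟩, C₂', hC₂', H₂'⟩ := h₂
  refine ⟨⟨C₁ + C₂, hC₁.add hC₂, fun T x Λ h1 h2 h3 k hk => ?_⟩,
    C₁' + C₂', hC₁'.add hC₂', fun T x Λ h1 h2 h3 k hk => ?_⟩
  all_goals
    have h0 := hρ T
    have hΛ : 0 < Λ := h0.trans_le h2
    rw [Pln_add, mul_add]
  · have p₁ : 0 ≤ Λ ^ d * (ρ T ^ r)⁻¹ * Pln C₁ (x / ρ T) :=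
      mul_nonneg (by positivity) (Pln_div_nonneg hC₁ h0 h1.le)
    have p₂ : 0 ≤ Λ ^ d * (ρ T ^ r)⁻¹ * Pln C₂ (x / ρ T) :=
      mul_nonneg (by positivity) (Pln_div_nonneg hC₂ h0 h1.le)
    rcases h Λ hk with hk | hk
    · linarith [H₁ T x Λ h1 h2 h3 k hk]
    · linarith [H₂ T x Λ h1 h2 h3 k hk]
  · have p₁ : 0 ≤ Λ ^ (d + 1) * (ρ T ^ r)⁻¹ * (x ^ 2)⁻¹ * Pln C₁' (x / ρ T) :=
      mul_nonneg (by positivity) (Pln_div_nonneg hC₁' h0 h1.le)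
    have p₂ : 0 ≤ Λ ^ (d + 1) * (ρ T ^ r)⁻¹ * (x ^ 2)⁻¹ * Pln C₂' (x / ρ T) :=
      mul_nonneg (by positivity) (Pln_div_nonneg hC₂' h0 h1.le)
    rcases h Λ hk with hk | hk
    · obtain ⟨v, hv, hvb⟩ := H₁' T x Λ h1 h2 h3 k hk
      exact ⟨v, hv, by linarith⟩
    · obtain ⟨v, hv, hvb⟩ := H₂' T x Λ h1 h2 h3 k hk
      exact ⟨v, hv, by linarith⟩

/-- In the Leibniz rule each term contains one value bound and one cutoff derivative, so the gain of
`Λ` over `Λ₀ ^ 2` occurs exactly once. -/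
lemma UBound.mul (hρ : ∀ T, 0 < ρ T) {d₁ d₂ : ℤ} {r₁ r₂ : ℕ} (hf : UBound ρ Dom d₁ r₁ f)
    (hg : UBound ρ Dom d₂ r₂ g) :
    UBound ρ Dom (d₁ + d₂) (r₁ + r₂) fun T x Λ k => f T x Λ k * g T x Λ k := by
  obtain ⟨⟨C₁, hC₁, H₁⟩, C₁', hC₁', H₁'⟩ := hf
  obtain ⟨⟨C₂, hC₂, H₂⟩, C₂', hC₂', H₂'⟩ := hg
  refine ⟨⟨C₁ * C₂, hC₁.mul hC₂, fun T x Λ h1 h2 h3 k hk => ?_⟩,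
    C₁' * C₂ + C₁ * C₂', (hC₁'.mul hC₂).add (hC₁.mul hC₂'), fun T x Λ h1 h2 h3 k hk => ?_⟩
  · have h0 := hρ T
    have hΛ : 0 < Λ := h0.trans_le h2
    have := mul_le_mul (H₁ T x Λ h1 h2 h3 k hk) (H₂ T x Λ h1 h2 h3 k hk) (abs_nonneg _)
      ((abs_nonneg _).trans (H₁ T x Λ h1 h2 h3 k hk))
    rw [abs_mul]
    refine this.trans (le_of_eq ?_)
    rw [Pln_mul, zpow_add₀ hΛ.ne', pow_add, mul_inv]
    ring
  · have h0 := hρ T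
    have hΛ : 0 < Λ := h0.trans_le h2
    obtain ⟨v, hv, hvb⟩ := H₁' T x Λ h1 h2 h3 k hk
    obtain ⟨w, hw, hwb⟩ := H₂' T x Λ h1 h2 h3 k hk
    refine ⟨_, hv.mul hw, ?_⟩
    have e₁ := mul_le_mul hvb (H₂ T x Λ h1 h2 h3 k hk) (abs_nonneg _) ((abs_nonneg _).trans hvb)
    have e₂ := mul_le_mul (H₁ T x Λ h1 h2 h3 k hk) hwb (abs_nonneg _)
      ((abs_nonneg _).trans (H₁ T x Λ h1 h2 h3 k hk))
    refine (abs_add_le _ _).trans ?_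
    rw [abs_mul, abs_mul]
    refine (add_le_add e₁ e₂).trans (le_of_eq ?_)
    rw [Pln_add, Pln_mul, Pln_mul, zpow_add₀ hΛ.ne' (d₁ + d₂), zpow_add₀ hΛ.ne' d₁ d₂, pow_add,
      mul_inv, zpow_add₀ hΛ.ne' d₁ 1, zpow_add₀ hΛ.ne' d₂ 1]
    ring

lemma ValBound.const_mul (hf : ValBound ρ Dom d r f) (c : ℝ) :
    ValBound ρ Dom d r fun T x Λ k => c * f T x Λ k := by
  obtain ⟨C, hC, H⟩ := hf
  refine ⟨Polynomial.C |c| * C, (nonnegCoeffs_C (abs_nonneg c)).mul hC,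
    fun T x Λ h1 h2 h3 k hk => ?_⟩
  rw [Pln_mul, Pln_C, abs_mul, mul_left_comm]
  exact mul_le_mul_of_nonneg_left (H T x Λ h1 h2 h3 k hk) (abs_nonneg c)

lemma DerBound.const_mul (hf : DerBound ρ Dom d r f) (c : ℝ) :
    DerBound ρ Dom d r fun T x Λ k => c * f T x Λ k := by
  obtain ⟨C, hC, H⟩ := hf
  refine ⟨Polynomial.C |c| * C, (nonnegCoeffs_C (abs_nonneg c)).mul hC,
    fun T x Λ h1 h2 h3 k hk => ?_⟩
  obtain ⟨v, hv, hvb⟩ := H T x Λ h1 h2 h3 k hk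
  refine ⟨c * v, hv.const_mul c, ?_⟩
  rw [Pln_mul, Pln_C, abs_mul, mul_left_comm]
  exact mul_le_mul_of_nonneg_left hvb (abs_nonneg c)

lemma UBound.const_mul (hf : UBound ρ Dom d r f) (c : ℝ) :
    UBound ρ Dom d r fun T x Λ k => c * f T x Λ k :=
  ⟨hf.1.const_mul c, hf.2.const_mul c⟩

lemma UBound.comp {m : ℕ} {Dom' : ℝ → Set (Fin m → Momentum)}
    {φ : (Fin m → Momentum) → (Fin n → Momentum)} (hf : UBound ρ Dom d r f)
    (h : ∀ Λ, ∀ k ∈ Dom' Λ, φ k ∈ Dom Λ) :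
    UBound ρ Dom' d r fun T x Λ k => f T x Λ (φ k) := by
  obtain ⟨⟨C, hC, H⟩, C', hC', H'⟩ := hf
  exact ⟨⟨C, hC, fun T x Λ h1 h2 h3 k hk => H T x Λ h1 h2 h3 _ (h Λ k hk)⟩,
    C', hC', fun T x Λ h1 h2 h3 k hk => H' T x Λ h1 h2 h3 _ (h Λ k hk)⟩

lemma UBound.of_const {u : 𝒯 → ℝ → (Fin n → Momentum) → ℝ} {c : ℝ}
    (hc : 0 ≤ c) (h : ∀ T Λ, ρ T ≤ Λ → ∀ k ∈ Dom Λ, |u T Λ k| ≤ c * Λ ^ d) :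
    UBound ρ Dom d 0 fun T _ Λ k => u T Λ k := by
  refine ⟨⟨Polynomial.C c, nonnegCoeffs_C hc, fun T x Λ h1 h2 h3 k hk => ?_⟩,
    0, nonnegCoeffs_zero, fun T x Λ h1 h2 h3 k hk => ⟨0, hasDerivWithinAt_const _ _ _, ?_⟩⟩
  · rw [Pln_C, pow_zero, inv_one, mul_one, mul_comm]
    exact h T Λ h2 k hk
  · simp [Pln]

lemma continuousOn_derBound (C : Polynomial ℝ) {ρ₀ : ℝ} (hρ : 0 < ρ₀) (d : ℤ) (r : ℕ) :
    ContinuousOn (fun p : ℝ × ℝ => p.1 ^ d * (ρ₀ ^ r)⁻¹ * (p.2 ^ 2)⁻¹ * Pln C (p.2 / ρ₀))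
      (Set.Ioi 0 ×ˢ Set.Ioi 0) := by
  have h1 : ContinuousOn (fun p : ℝ × ℝ => p.1 ^ d) (Set.Ioi 0 ×ˢ Set.Ioi 0) :=
    continuousOn_fst.zpow₀ d fun p hp => Or.inl (ne_of_gt hp.1)
  have h2 : ContinuousOn (fun p : ℝ × ℝ => (p.2 ^ 2)⁻¹) (Set.Ioi 0 ×ˢ Set.Ioi 0) :=
    (continuousOn_snd.pow 2).inv₀ fun p hp => (pow_pos hp.2 2).ne'
  have h3 : ContinuousOn (fun p : ℝ × ℝ => Pln C (p.2 / ρ₀)) (Set.Ioi 0 ×ˢ Set.Ioi 0) :=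
    C.continuous.comp_continuousOn ((continuousOn_snd.div_const _).log
      fun p hp => (div_pos hp.2 hρ).ne')
  exact ((h1.mul continuousOn_const).mul h2).mul h3

/-- A bound on the cutoff derivative gives a Lipschitz bound in the cutoff, locally uniform in
the cutoff and uniform in the scale. -/
lemma DerBound.lipschitz (hρ : ∀ T, 0 < ρ T) (hf : DerBound ρ Dom d r f) (T : 𝒯) {x₀ : ℝ}
    (hx₀ : ρ T < x₀) : ∃ δ M, 0 < δ ∧ 0 ≤ M ∧ ρ T < x₀ - δ ∧
      ∀ Λ, ρ T ≤ Λ → ∀ k ∈ Dom Λ, ∀ y y', Λ ≤ y → Λ ≤ y' → |y - x₀| < δ → |y' - x₀| < δ →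
        |f T y Λ k - f T y' Λ k| ≤ M * |y - y'| := by
  obtain ⟨C, hC, H⟩ := hf
  have h0 := hρ T
  -- This choice keeps every cutoff in the window above `ρ T`, so `H` applies and the bound is
  -- continuous on a compact set of positive pairs.
  set δ := (x₀ - ρ T) / 2 with hδ
  have hδ0 : 0 < δ := by rw [hδ]; linarith
  have hlow : ρ T < x₀ - δ := by rw [hδ]; linarith
  obtain ⟨M, hM⟩ := (isCompact_Icc.prod isCompact_Icc).exists_bound_of_continuousOn
    ((continuousOn_derBound C h0 d r).mono
    (Set.prod_mono (s₁ := Set.Icc (ρ T) (x₀ + δ)) (t₁ := Set.Icc (x₀ - δ) (x₀ + δ))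
      (fun s hs => h0.trans_le hs.1) (fun s hs => (h0.trans hlow).trans_le hs.1)))
  refine ⟨δ, max M 0, hδ0, le_max_right _ _, hlow, fun Λ hΛ k hk y y' hy hy' hyδ hyδ' => ?_⟩
  have hconv : Convex ℝ (Set.Ici Λ ∩ Set.Ioo (x₀ - δ) (x₀ + δ)) :=
    (convex_Ici Λ).inter (convex_Ioo _ _)
  choose! v hv hvb using fun (z : ℝ) (hz : z ∈ Set.Ici Λ ∩ Set.Ioo (x₀ - δ) (x₀ + δ)) =>
    H T z Λ (hlow.trans hz.2.1) hΛ hz.1 k hk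
  rw [abs_lt] at hyδ hyδ'
  refine hconv.norm_image_sub_le_of_norm_hasDerivWithin_le (f' := v)
    (fun z hz => (hv z hz).mono Set.inter_subset_left) (fun z hz => ?_)
    ⟨hy', by linarith, by linarith⟩ ⟨hy, by linarith, by linarith⟩
  refine (hvb z hz).trans ?_
  refine (le_abs_self _).trans ((hM (Λ, z) ⟨⟨hΛ, ?_⟩, hz.2.1.le, hz.2.2.le⟩).trans
    (le_max_left _ _))
  have : Λ ≤ z := hz.1
  linarith [hz.2.2]

open MeasureTheory in
/-- The cutoff derivative of an integral of `f` over scales and momenta. -/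
lemma DerBoundWith.integral (hρ : ∀ T, 0 < ρ T) {C : Polynomial ℝ} (hC : NonnegCoeffs C)
    (hf : DerBoundWith C ρ Dom d r f) {T : 𝒯} {x₀ Λ : ℝ} (hx₀ : ρ T < x₀) (hΛx : Λ ≤ x₀)
    {α : Type*} [MeasurableSpace α]
    {μ : Measure α} [IsFiniteMeasure μ] {Λ' : α → ℝ} {κ : α → Fin n → Momentum} {w : α → ℝ}
    {W w₀ : ℝ} (hΛ' : ∀ᵐ a ∂μ, ρ T ≤ Λ' a ∧ Λ' a ≤ Λ ∧ κ a ∈ Dom (Λ' a) ∧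
      |w a| * (Λ' a) ^ d ≤ W ∧ |w a| ≤ w₀)
    (hint : ∀ y, ρ T < y → Λ ≤ y → Integrable (fun a => w a * f T y (Λ' a) (κ a)) μ) :
    ∃ V, HasDerivWithinAt (fun y => ∫ a, w a * f T y (Λ' a) (κ a) ∂μ) V (Set.Ici Λ) x₀ ∧
      |V| ≤ μ.real Set.univ * (W * (ρ T ^ r)⁻¹ * (x₀ ^ 2)⁻¹ * Pln C (x₀ / ρ T)) := by
  have h0 := hρ T
  obtain ⟨δ, M, hδ, hM, hlow, hlip⟩ := DerBound.lipschitz hρ ⟨C, hC, hf⟩ T hx₀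
  have := exists_hasDerivWithinAt_integral (μ := μ) (G := fun y a => w a * f T y (Λ' a) (κ a))
    (s := Set.Ici Λ) (x₀ := x₀) (M := w₀ * M)
    (b := fun _ => W * (ρ T ^ r)⁻¹ * (x₀ ^ 2)⁻¹ * Pln C (x₀ / ρ T)) hδ hΛx
    (fun y hy hyδ => hint y (by linarith [(abs_lt.1 hyδ).1]) hy)
    (hΛ'.mono fun a ha y hy hyδ => by
      obtain ⟨h1, h2, h3, h4, h5⟩ := ha
      rw [← mul_sub, abs_mul, mul_assoc]
      exact mul_le_mul h5 (hlip (Λ' a) h1 (κ a) h3 y x₀ (h2.trans hy) (h2.trans hΛx) hyδ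
        (by simpa using hδ)) (abs_nonneg _) ((abs_nonneg _).trans h5))
    (hΛ'.mono fun a ha => by
      obtain ⟨h1, h2, h3, h4, h5⟩ := ha
      obtain ⟨v, hv, hvb⟩ := hf T x₀ (Λ' a) hx₀ h1 (h2.trans hΛx) (κ a) h3
      refine ⟨w a * v, (hv.mono (Set.Ici_subset_Ici.2 h2)).const_mul (w a), ?_⟩
      rw [abs_mul]
      refine (mul_le_mul_of_nonneg_left hvb (abs_nonneg _)).trans ?_
      have e : |w a| * ((Λ' a) ^ d * (ρ T ^ r)⁻¹ * (x₀ ^ 2)⁻¹ * Pln C (x₀ / ρ T)) =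
        (|w a| * (Λ' a) ^ d) * ((ρ T ^ r)⁻¹ * (x₀ ^ 2)⁻¹ * Pln C (x₀ / ρ T)) := by ring
      have hP := Pln_div_nonneg hC h0 hx₀.le
      rw [e]
      refine (mul_le_mul_of_nonneg_right h4 (by positivity)).trans (le_of_eq (by ring)))
    (integrable_const _)
  obtain ⟨V, hV, hVb⟩ := this
  refine ⟨V, hV, hVb.trans (le_of_eq ?_)⟩
  rw [integral_const, smul_eq_mul]

/-- Smooth families all of whose tangential derivatives obey `UBound`, each derivative lowering
the degree by one. -/
structure Adm (ρ : 𝒯 → ℝ) (Dom : ℝ → Set (Fin n → Momentum)) (d : ℤ) (r : ℕ)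
    (f : ScaleFamily 𝒯 n) : Prop where
  smooth : ∀ T x Λ, ρ T < x → ρ T ≤ Λ → Λ ≤ x → ContDiff ℝ ∞ (f T x Λ)
  bound : ∀ I, UBound ρ Dom (d - (I.length : ℤ)) r fun T x Λ => multiDiff I (f T x Λ)

lemma Adm.momDiff (hf : Adm ρ Dom d r f) (q : Fin n × Fin n × Fin 4) :
    Adm ρ Dom (d - 1) r fun T x Λ => momDiff q.1 q.2.1 q.2.2 (f T x Λ) where
  smooth T x Λ h1 h2 h3 := (hf.smooth T x Λ h1 h2 h3).momDiff _ _ _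
  bound I := by
    have := hf.bound (I ++ [q])
    simp only [multiDiff_concat, List.length_append, List.length_singleton] at this
    have e : d - ((I.length + 1 : ℕ) : ℤ) = d - 1 - I.length := by push_cast; ring
    rwa [e] at this

lemma Adm.add (hf : Adm ρ Dom d r f) (hg : Adm ρ Dom d r g) :
    Adm ρ Dom d r fun T x Λ k => f T x Λ k + g T x Λ k where
  smooth T x Λ h1 h2 h3 := (hf.smooth T x Λ h1 h2 h3).add (hg.smooth T x Λ h1 h2 h3)
  bound I := ((hf.bound I).add (hg.bound I)).congr fun T x Λ h1 h2 h3 k _ => by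
    rw [multiDiff_add (hf.smooth T x Λ h1 h2 h3) (hg.smooth T x Λ h1 h2 h3)]

lemma Adm.const_mul (hf : Adm ρ Dom d r f) (c : ℝ) :
    Adm ρ Dom d r fun T x Λ k => c * f T x Λ k where
  smooth T x Λ h1 h2 h3 := contDiff_const.mul (hf.smooth T x Λ h1 h2 h3)
  bound I := ((hf.bound I).const_mul c).congr fun T x Λ h1 h2 h3 k _ => by
    rw [multiDiff_const_mul (hf.smooth T x Λ h1 h2 h3)]

lemma Adm.zero : Adm ρ Dom d r fun (_ : 𝒯) _ _ (_ : Fin n → Momentum) => 0 where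
  smooth T x Λ h1 h2 h3 := contDiff_const
  bound I := UBound.zero fun T x Λ _ _ _ k _ => by rw [multiDiff_zero]

lemma Adm.sum {ι : Type*} (s : Finset ι) {F : ι → ScaleFamily 𝒯 n}
    (h : ∀ a ∈ s, Adm ρ Dom d r (F a)) :
    Adm ρ Dom d r fun T x Λ k => ∑ a ∈ s, F a T x Λ k := by
  classical
  induction s using Finset.induction_on with
  | empty => simpa using Adm.zero
  | insert a s ha ih =>
    simp only [Finset.sum_insert ha]
    exact (h a (by simp)).add (ih fun b hb => h b (by simp [hb]))

/-- Leibniz rule by induction on the order: the innermost derivative falls on one factor or the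
other, and either way the total degree drops by one. Both factors therefore vary in the induction.
-/
lemma Adm.uBound_mul (hρ : ∀ T, 0 < ρ T) (I : List (Fin n × Fin n × Fin 4)) :
    ∀ {d₁ d₂ : ℤ} {r₁ r₂ : ℕ} {f g : ScaleFamily 𝒯 n}, Adm ρ Dom d₁ r₁ f → Adm ρ Dom d₂ r₂ g →
    UBound ρ Dom (d₁ + d₂ - (I.length : ℤ)) (r₁ + r₂)
      fun T x Λ => multiDiff I fun k => f T x Λ k * g T x Λ k := by
  induction I using List.reverseRecOn with
  | nil =>
    intro d₁ d₂ r₁ r₂ f g hf hg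
    have h1 := hf.bound []
    have h2 := hg.bound []
    simp only [List.length_nil, Nat.cast_zero, sub_zero, multiDiff_nil] at h1 h2 ⊢
    exact h1.mul hρ h2
  | append_singleton I q ih =>
    intro d₁ d₂ r₁ r₂ f g hf hg
    have e : d₁ + d₂ - ((I ++ [q]).length : ℤ) = d₁ + d₂ - 1 - I.length := by
      simp only [List.length_append, List.length_singleton]; push_cast; ring
    have h1 := ih (hf.momDiff q) hg
    have h2 := ih hf (hg.momDiff q)
    rw [show d₁ - 1 + d₂ = d₁ + d₂ - 1 by ring] at h1
    rw [show d₁ + (d₂ - 1) = d₁ + d₂ - 1 by ring] at h2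
    rw [e]
    refine (h1.add h2).congr fun T x Λ v1 v2 v3 k _ => ?_
    have sf := hf.smooth T x Λ v1 v2 v3
    have sg := hg.smooth T x Λ v1 v2 v3
    rw [multiDiff_concat, momDiff_mul sf sg,
      multiDiff_add ((sf.momDiff _ _ _).mul sg) (sf.mul (sg.momDiff _ _ _))]

lemma Adm.mul (hρ : ∀ T, 0 < ρ T) {d₁ d₂ : ℤ} {r₁ r₂ : ℕ} (hf : Adm ρ Dom d₁ r₁ f)
    (hg : Adm ρ Dom d₂ r₂ g) :
    Adm ρ Dom (d₁ + d₂) (r₁ + r₂) fun T x Λ k => f T x Λ k * g T x Λ k where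
  smooth T x Λ h1 h2 h3 := (hf.smooth T x Λ h1 h2 h3).mul (hg.smooth T x Λ h1 h2 h3)
  bound I := Adm.uBound_mul hρ I hf hg

lemma Adm.comp {m : ℕ} {Dom' : ℝ → Set (Fin m → Momentum)} (hf : Adm ρ Dom d r f)
    {φ : (Fin m → Momentum) →L[ℝ] (Fin n → Momentum)} {τ : Fin m → Fin n}
    (hφ : ∀ i j μ, φ (dirVec (i, j, μ)) = dirVec (τ i, τ j, μ))
    (h : ∀ Λ, ∀ k ∈ Dom' Λ, φ k ∈ Dom Λ) :
    Adm ρ Dom' d r fun T x Λ k => f T x Λ (φ k) where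
  smooth T x Λ h1 h2 h3 := (hf.smooth T x Λ h1 h2 h3).comp φ.contDiff
  bound I := by
    have := hf.bound (I.map fun q => (τ q.1, τ q.2.1, q.2.2))
    rw [List.length_map] at this
    refine (this.comp h).congr fun T x Λ h1 h2 h3 k _ => ?_
    rw [multiDiff_comp (hf.smooth T x Λ h1 h2 h3) (fun k => φ.hasFDerivAt) hφ]

/-- A family that vanishes identically outside a smaller domain. -/
lemma Adm.extend (hρ : ∀ T, 0 < ρ T) {Dom' : ℝ → Set (Fin n → Momentum)} (hf : Adm ρ Dom' d r f)
    (h : ∀ T x Λ, ρ T < x → ρ T ≤ Λ → Λ ≤ x → ∀ k ∈ Dom Λ \ Dom' Λ,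
      f T x Λ =ᶠ[nhds k] fun _ => 0) : Adm ρ Dom d r f where
  smooth := hf.smooth
  bound I := by
    refine UBound.union hρ (hf.bound I) (Dom₂ := fun Λ => Dom Λ \ Dom' Λ)
      (UBound.zero fun T x Λ h1 h2 h3 k hk => ?_) fun Λ => by
        rw [Set.union_sdiff_self]; exact Set.subset_union_right
    have := ((h T x Λ h1 h2 h3 k hk).multiDiff I).eq_of_nhds
    rwa [multiDiff_zero] at this

end Bounds

/-! ### Bounds for the right-hand side of the flow equation -/

lemma exists_bound_regPropDeriv {K : ℝ → ℝ} (hK : IsCutoff K) : ∃ c, 0 ≤ c ∧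
    ∀ B Λ, 0 < Λ → -1 ≤ B / Λ ^ 2 → ∀ q, |regPropDeriv K B Λ q| ≤ c * Λ ^ (-3 : ℤ) := by
  obtain ⟨c, h0, hc⟩ := exists_bound_shellQuot hK.isShellFun 1
  refine ⟨c, h0, fun B Λ hΛ hB q => ?_⟩
  rw [regPropDeriv_eq hK B hΛ, abs_mul, abs_of_pos (zpow_pos hΛ _), mul_comm]
  exact mul_le_mul_of_nonneg_right (hc _ hB _) (zpow_pos hΛ _).le

lemma neg_one_le_div_sq {ρ B Λ : ℝ} (hρ : 0 < ρ) (hB : |B| ≤ ρ ^ 2) (hΛ : ρ ≤ Λ) :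
    -1 ≤ B / Λ ^ 2 := by
  rw [le_div_iff₀ (pow_pos (hρ.trans_le hΛ) 2)]
  have := (abs_le.1 hB).1
  have : ρ ^ 2 ≤ Λ ^ 2 := by gcongr
  linarith

open MeasureTheory in
lemma volume_real_closedBall (Λ : ℝ) (hΛ : 0 ≤ Λ) :
    (volume.restrict (Metric.closedBall (0 : Momentum) (2 * Λ))).real Set.univ =
      16 * volume.real (Metric.ball (0 : Momentum) 1) * Λ ^ 4 := by
  rw [measureReal_restrict_apply_univ, Measure.addHaar_real_closedBall _ _ (by positivity)]
  simp only [finrank_euclideanSpace, Fintype.card_fin]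
  ring

/-- The right-hand side of the Polchinski equation, with the vanishing terms omitted. -/
noncomputable def reducedRHS (K : ℝ → ℝ) (B : ℝ)
    (ℓ : (n : ℕ) → ℕ → ℕ → (Fin n → Momentum) → ℝ) (Λ : ℝ)
    (n r₁ r₂ : ℕ) (k : Fin n → Momentum) : ℝ :=
  (-(1 / 2)) * (∑ S : Finset (Fin n), ∑ a ∈ Finset.HasAntidiagonal.antidiagonal r₁,
    ∑ b ∈ Finset.HasAntidiagonal.antidiagonal r₂,
      if a.1 + b.1 = 0 ∨ a.2 + b.2 = 0 then 0 else
        regPropDeriv K B Λ (∑ i ∈ S, k i) * ℓ (S.card + 1) a.1 b.1 (cutMomenta S k) *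
          ℓ (Sᶜ.card + 1) a.2 b.2 (cutMomenta Sᶜ k)) +
  (-(1 / 2) * (1 / (2 * Real.pi) ^ 4)) *
    ∫ q : Momentum, ℓ (n + 2) r₁ r₂ (padMomenta n k + pairMomenta n q) * regPropDeriv K B Λ q

lemma sum_compl_eq_neg {n : ℕ} {k : Fin n → Momentum} (hk : ∑ i, k i = 0) (S : Finset (Fin n)) :
    ∑ i ∈ Sᶜ, k i = -∑ i ∈ S, k i := by
  rw [← Finset.sum_add_sum_compl S] at hk
  exact (neg_eq_of_add_eq_zero_right hk).symm

/-- The `A` term carries the factor `regPropDeriv K B Λ 0 = 0`, and a tree with a factor of order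
zero vanishes. Momentum conservation turns `K_S` into `-K_{Sᶜ}`, so both tree factors have the same
form. -/
lemma flowRHS_eq_reducedRHS {K : ℝ → ℝ} (hK : IsCutoff K) (A B : ℝ) {Λ : ℝ} (hΛ : 0 < Λ)
    {ℓ : (n : ℕ) → ℕ → ℕ → (Fin n → Momentum) → ℝ}
    (h0 : ∀ n, 1 ≤ n → ∀ k : Fin n → Momentum, ∑ i, k i = 0 → ℓ n 0 0 k = 0)
    (n r₁ r₂ : ℕ) {k : Fin n → Momentum} (hk : ∑ i, k i = 0) :
    flowRHS K A B ℓ Λ n r₁ r₂ k = reducedRHS K B ℓ Λ n r₁ r₂ k := by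
  rw [flowRHS, reducedRHS, regPropDeriv_zero hK B hΛ]
  simp only [addMomentum_pair, mul_zero, sub_zero]
  have e : ∀ S : Finset (Fin n), addMomentum (subMomenta k Sᶜ) (∑ i ∈ S, k i) =
      cutMomenta Sᶜ k := fun S => by
    rw [cutMomenta_apply, sum_compl_eq_neg hk, neg_neg]
  rw [sub_eq_add_neg]
  congr 1
  · rw [neg_mul, neg_mul]
    congr 2
    refine Finset.sum_congr rfl fun S _ => Finset.sum_congr rfl fun a _ =>
      Finset.sum_congr rfl fun b _ => ?_
    split_ifs with h
    · rcases h with h | h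
      · have h1 : a.1 = 0 := by omega
        have h2 : b.1 = 0 := by omega
        rw [← cutMomenta_apply, h1, h2, h0 _ (by omega) _ (sum_cutMomenta S k)]
        ring
      · have h1 : a.2 = 0 := by omega
        have h2 : b.2 = 0 := by omega
        rw [e, h1, h2, h0 _ (by omega) _ (sum_cutMomenta Sᶜ k)]
        ring
    · rw [e]
      rfl
  · ring

lemma contDiff_reducedRHS {K : ℝ → ℝ} (hK : IsCutoff K) {B Λ : ℝ} (hΛ : 0 < Λ)
    (hB : -1 ≤ B / Λ ^ 2) {ℓ : (n : ℕ) → ℕ → ℕ → (Fin n → Momentum) → ℝ}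
    (hℓ : ∀ n r₁ r₂, 1 ≤ n → ContDiff ℝ ∞ (ℓ n r₁ r₂)) (n r₁ r₂ : ℕ) :
    ContDiff ℝ ∞ (reducedRHS K B ℓ Λ n r₁ r₂) := by
  refine ContDiff.add (contDiff_const.mul (ContDiff.sum fun S _ => ContDiff.sum fun a _ =>
    ContDiff.sum fun b _ => ?_)) (contDiff_const.mul ?_)
  · split_ifs with h
    · exact contDiff_const
    · have h1 : ContDiff ℝ ∞ fun k : Fin n → Momentum => ∑ i ∈ S, k i := by fun_prop
      exact (((contDiff_regPropDeriv hK hΛ hB).comp h1).mul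
        ((hℓ _ _ _ (by omega)).comp (cutMomenta S).contDiff)).mul
        ((hℓ _ _ _ (by omega)).comp (cutMomenta Sᶜ).contDiff)
  · exact contDiff_integral_mul (hℓ _ _ _ (by omega)) (padMomenta n) (pairMomenta n)
      (contDiff_regPropDeriv hK hΛ hB) fun q hq => regPropDeriv_outer hK B hΛ hq

lemma padMomenta_add_mem {n : ℕ} {Λ : ℝ} {k : Fin n → Momentum} (hk : k ∈ momentumBall n Λ)
    (hΛ : 0 ≤ Λ) {q : Momentum} (hq : ‖q‖ ≤ 2 * Λ) :
    padMomenta n k + pairMomenta n q ∈ momentumBall (n + 2) Λ := by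
  rw [← addMomentum_pair]
  have hq' : ‖q‖ ^ 2 ≤ 4 * Λ ^ 2 := by nlinarith [norm_nonneg q]
  refine ⟨?_, fun i => ?_⟩
  · rw [Fin.sum_univ_castSucc, Fin.sum_univ_castSucc]
    simp [addMomentum, hk.1]
  · refine Fin.lastCases ?_ (fun i => ?_) i
    · simpa [addMomentum] using hq'
    · refine Fin.lastCases ?_ (fun i => ?_) i
      · simpa [addMomentum] using hq'
      · simpa [addMomentum] using hk.2 i

lemma cutMomenta_mem {n : ℕ} {Λ : ℝ} {k : Fin n → Momentum} (hk : k ∈ momentumBall n Λ)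
    {S : Finset (Fin n)} (hS : ‖∑ i ∈ S, k i‖ ^ 2 ≤ 4 * Λ ^ 2) :
    cutMomenta S k ∈ momentumBall (S.card + 1) Λ := by
  refine ⟨sum_cutMomenta S k, fun i => ?_⟩
  rw [cutMomenta_apply]
  refine Fin.lastCases ?_ (fun i => ?_) i
  · simpa [addMomentum] using hS
  · simpa [addMomentum, subMomenta] using hk.2 _

section Flow

variable {𝒯 : Type} {ρ : 𝒯 → ℝ} {n : ℕ}

lemma adm_regPropDeriv (hρ : ∀ T, 0 < ρ T) {K : ℝ → ℝ} (hK : IsCutoff K) {B : 𝒯 → ℝ}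
    (hB : ∀ T, |B T| ≤ ρ T ^ 2) (S : Finset (Fin n)) (Dom : ℝ → Set (Fin n → Momentum)) :
    Adm ρ Dom (-3) 0 fun T _ Λ k => regPropDeriv K (B T) Λ (∑ i ∈ S, k i) where
  smooth T x Λ h1 h2 h3 := by
    have h : ContDiff ℝ ∞ fun k : Fin n → Momentum => ∑ i ∈ S, k i := by fun_prop
    exact (contDiff_regPropDeriv hK ((hρ T).trans_le h2)
      (neg_one_le_div_sq (hρ T) (hB T) h2)).comp h
  bound I := by
    obtain ⟨c, h0, hc⟩ := exists_bound_multiDiff_shellKernel S I hK.isShellFun 1 (-3)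
    refine UBound.of_const h0 fun T Λ hΛ k _ => ?_
    have hpos := (hρ T).trans_le hΛ
    have e : (fun k : Fin n → Momentum => regPropDeriv K (B T) Λ (∑ i ∈ S, k i)) =
        shellKernel S (cutoffShell K) (B T / Λ ^ 2) 1 (-3) Λ :=
      funext fun k => regPropDeriv_eq hK (B T) hpos _
    rw [e]
    exact hc _ Λ (neg_one_le_div_sq (hρ T) (hB T) hΛ) hpos k

open MeasureTheory in
lemma integrableOn_loop {K : ℝ → ℝ} (hK : IsCutoff K) {B Λ : ℝ} (hΛ : 0 < Λ)
    (hB : -1 ≤ B / Λ ^ 2) {u : (Fin (n + 2) → Momentum) → ℝ} (hu : ContDiff ℝ ∞ u)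
    (k : Fin n → Momentum) :
    IntegrableOn (fun q => regPropDeriv K B Λ q * u (padMomenta n k + pairMomenta n q))
      (Metric.closedBall 0 (2 * Λ)) := by
  refine ContinuousOn.integrableOn_compact (isCompact_closedBall _ _) (Continuous.continuousOn ?_)
  exact (contDiff_regPropDeriv hK hΛ hB).continuous.mul (hu.continuous.comp (by fun_prop))

open MeasureTheory in
lemma loop_eq_setIntegral {K : ℝ → ℝ} (hK : IsCutoff K) (B : ℝ) {Λ : ℝ} (hΛ : 0 < Λ)
    (u : (Fin (n + 2) → Momentum) → ℝ) (k : Fin n → Momentum) :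
    ∫ q, u (padMomenta n k + pairMomenta n q) * regPropDeriv K B Λ q =
      ∫ q in Metric.closedBall 0 (2 * Λ),
        regPropDeriv K B Λ q * u (padMomenta n k + pairMomenta n q) := by
  rw [setIntegral_eq_integral_of_forall_compl_eq_zero]
  · simp only [mul_comm]
  · intro q hq
    simp only [Metric.mem_closedBall, dist_zero_right, not_le] at hq
    rw [regPropDeriv_outer hK B hΛ hq.le, zero_mul]

-- The propagator confines `q` to the ball of radius `2 * Λ`, exactly where the bounds on `f` hold.
-- Its size `Λ ^ (-3)` times the volume of order `Λ ^ 4` raises the degree by one.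
open MeasureTheory in
lemma UBound.loop (hρ : ∀ T, 0 < ρ T) {K : ℝ → ℝ} (hK : IsCutoff K) {B : 𝒯 → ℝ}
    (hB : ∀ T, |B T| ≤ ρ T ^ 2) {d : ℤ} {r : ℕ} {f : ScaleFamily 𝒯 (n + 2)}
    (hs : ∀ T x Λ, ρ T < x → ρ T ≤ Λ → Λ ≤ x → ContDiff ℝ ∞ (f T x Λ))
    (hf : UBound ρ (momentumBall (n + 2)) d r f) :
    UBound ρ (momentumBall n) (d + 1) r fun T x Λ k =>
      ∫ q, f T x Λ (padMomenta n k + pairMomenta n q) * regPropDeriv K (B T) Λ q := by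
  obtain ⟨c, hc0, hc⟩ := exists_bound_regPropDeriv hK
  obtain ⟨⟨C, hC, H⟩, C', hC', H'⟩ := hf
  set c₄ := 16 * volume.real (Metric.ball (0 : Momentum) 1) with hc₄
  have hc₄0 : 0 ≤ c₄ := by positivity
  refine ⟨⟨Polynomial.C (c₄ * c) * C, (nonnegCoeffs_C (by positivity)).mul hC,
    fun T x Λ h1 h2 h3 k hk => ?_⟩, Polynomial.C (c₄ * c) * C',
    (nonnegCoeffs_C (by positivity)).mul hC', fun T x Λ h1 h2 h3 k hk => ?_⟩
  · have hΛ := (hρ T).trans_le h2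
    have hb := neg_one_le_div_sq (hρ T) (hB T) h2
    beta_reduce
    rw [loop_eq_setIntegral hK _ hΛ, ← Real.norm_eq_abs]
    have hP := Pln_div_nonneg hC (hρ T) h1.le
    have := norm_setIntegral_le_of_norm_le_const (μ := volume)
      (s := Metric.closedBall (0 : Momentum) (2 * Λ))
      (f := fun q => regPropDeriv K (B T) Λ q * f T x Λ (padMomenta n k + pairMomenta n q))
      (C := c * Λ ^ (-3 : ℤ) * (Λ ^ d * (ρ T ^ r)⁻¹ * Pln C (x / ρ T)))
      (isCompact_closedBall _ _).measure_lt_top fun q hq => by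
        rw [norm_mul]
        exact mul_le_mul (hc _ _ hΛ hb q)
          (H T x Λ h1 h2 h3 _ (padMomenta_add_mem hk hΛ.le (by simpa using hq)))
          (norm_nonneg _) (by positivity)
    refine this.trans (le_of_eq ?_)
    have hv := volume_real_closedBall Λ hΛ.le
    rw [measureReal_restrict_apply_univ] at hv
    rw [hv, Pln_mul, Pln_C, zpow_add₀ hΛ.ne' d 1, show (1 : ℤ) = -3 + 4 by norm_num,
      zpow_add₀ hΛ.ne' (-3) 4]
    norm_cast
    ring
  · have hΛ := (hρ T).trans_le h2
    have hb := neg_one_le_div_sq (hρ T) (hB T) h2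
    have : IsFiniteMeasure (volume.restrict (Metric.closedBall (0 : Momentum) (2 * Λ))) :=
      ⟨by rw [Measure.restrict_apply_univ]; exact (isCompact_closedBall _ _).measure_lt_top⟩
    obtain ⟨V, hV, hVb⟩ := H'.integral hρ hC' h1 h3
      (μ := volume.restrict (Metric.closedBall (0 : Momentum) (2 * Λ)))
      (Λ' := fun _ => Λ) (κ := fun q => padMomenta n k + pairMomenta n q)
      (w := regPropDeriv K (B T) Λ) (W := c * Λ ^ (-3 : ℤ) * Λ ^ (d + 1))
      (w₀ := c * Λ ^ (-3 : ℤ))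
      ((ae_restrict_iff' measurableSet_closedBall).2 (Filter.Eventually.of_forall fun q hq =>
        ⟨h2, le_rfl, padMomenta_add_mem hk hΛ.le (by simpa using hq),
          mul_le_mul_of_nonneg_right (hc _ _ hΛ hb q) (zpow_pos hΛ _).le, hc _ _ hΛ hb q⟩))
      (fun y hy hy' => integrableOn_loop hK hΛ hb (hs T y Λ hy h2 hy') k)
    refine ⟨V, hV.congr_of_eventuallyEq (Filter.Eventually.of_forall fun y =>
      loop_eq_setIntegral hK _ hΛ _ _) (loop_eq_setIntegral hK _ hΛ _ _), hVb.trans (le_of_eq ?_)⟩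
    rw [volume_real_closedBall Λ hΛ.le, Pln_mul, Pln_C, zpow_add₀ hΛ.ne' (d + 1) 1,
      show (1 : ℤ) = -3 + 4 by norm_num, zpow_add₀ hΛ.ne' (-3) 4]
    norm_cast
    ring

lemma momDiff_loop {K : ℝ → ℝ} (hK : IsCutoff K) {B Λ : ℝ} (hΛ : 0 < Λ)
    (hB : -1 ≤ B / Λ ^ 2) {u : (Fin (n + 2) → Momentum) → ℝ} (hu : ContDiff ℝ ∞ u)
    (i j : Fin n) (μ : Fin 4) :
    momDiff i j μ (fun k => ∫ q, u (padMomenta n k + pairMomenta n q) * regPropDeriv K B Λ q) =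
      fun k => ∫ q, momDiff i.castSucc.castSucc j.castSucc.castSucc μ u
        (padMomenta n k + pairMomenta n q) * regPropDeriv K B Λ q := by
  funext k
  have := fderiv_integral_mul hu (padMomenta n) (pairMomenta n)
    (contDiff_regPropDeriv hK hΛ hB).continuous
    (fun q hq => regPropDeriv_outer hK B hΛ hq) k (dirVec (i, j, μ))
  rw [padMomenta_dirVec] at this
  exact this

/-- External tangential derivatives act under the integral on the first `n` slots only, so each
reduces to the loop of a differentiated family. -/
lemma Adm.loop (hρ : ∀ T, 0 < ρ T) {K : ℝ → ℝ} (hK : IsCutoff K) {B : 𝒯 → ℝ}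
    (hB : ∀ T, |B T| ≤ ρ T ^ 2) {d : ℤ} {r : ℕ} {f : ScaleFamily 𝒯 (n + 2)}
    (hf : Adm ρ (momentumBall (n + 2)) d r f) :
    Adm ρ (momentumBall n) (d + 1) r fun T x Λ k =>
      ∫ q, f T x Λ (padMomenta n k + pairMomenta n q) * regPropDeriv K (B T) Λ q where
  smooth T x Λ h1 h2 h3 := contDiff_integral_mul (hf.smooth T x Λ h1 h2 h3) (padMomenta n)
    (pairMomenta n) (contDiff_regPropDeriv hK ((hρ T).trans_le h2)
      (neg_one_le_div_sq (hρ T) (hB T) h2))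
    fun q hq => regPropDeriv_outer hK (B T) ((hρ T).trans_le h2) hq
  bound I := by
    induction I using List.reverseRecOn generalizing d f with
    | nil =>
      have h := hf.bound []
      simp only [List.length_nil, Nat.cast_zero, sub_zero, multiDiff_nil] at h ⊢
      exact h.loop hρ hK hB hf.smooth
    | append_singleton I q ih =>
      have h := ih (hf.momDiff (q.1.castSucc.castSucc, q.2.1.castSucc.castSucc, q.2.2))
      have e : d + 1 - ((I ++ [q]).length : ℤ) = d - 1 + 1 - I.length := by
        simp only [List.length_append, List.length_singleton]; push_cast; ring
      rw [e]
      refine h.congr fun T x Λ h1 h2 h3 k _ => ?_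
      rw [multiDiff_concat, momDiff_loop hK ((hρ T).trans_le h2)
        (neg_one_le_div_sq (hρ T) (hB T) h2) (hf.smooth T x Λ h1 h2 h3)]

/-- The internal momentum `K_S` need not lie in the ball where the factors are bounded. Where it
leaves that ball the propagator vanishes in a whole neighbourhood, and so do all derivatives of the
term; elsewhere the product rule for `Adm` applies. -/
lemma Adm.tree (hρ : ∀ T, 0 < ρ T) {K : ℝ → ℝ} (hK : IsCutoff K) {B : 𝒯 → ℝ}
    (hB : ∀ T, |B T| ≤ ρ T ^ 2) (S : Finset (Fin n)) {d₁ d₂ : ℤ} {r₁ r₂ : ℕ}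
    {f : ScaleFamily 𝒯 (S.card + 1)} {g : ScaleFamily 𝒯 (Sᶜ.card + 1)}
    (hf : Adm ρ (momentumBall (S.card + 1)) d₁ r₁ f)
    (hg : Adm ρ (momentumBall (Sᶜ.card + 1)) d₂ r₂ g) :
    Adm ρ (momentumBall n) (-3 + d₁ + d₂) (r₁ + r₂) fun T x Λ k =>
      regPropDeriv K (B T) Λ (∑ i ∈ S, k i) * f T x Λ (cutMomenta S k) *
        g T x Λ (cutMomenta Sᶜ k) := by
  set Dom : ℝ → Set (Fin n → Momentum) := fun Λ =>
    {k | k ∈ momentumBall n Λ ∧ ‖∑ i ∈ S, k i‖ ^ 2 ≤ 4 * Λ ^ 2} with hDom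
  have h1 : Adm ρ Dom d₁ r₁ fun T x Λ k => f T x Λ (cutMomenta S k) :=
    hf.comp (cutMomenta_dirVec S) fun Λ k hk => cutMomenta_mem hk.1 hk.2
  have h2 : Adm ρ Dom d₂ r₂ fun T x Λ k => g T x Λ (cutMomenta Sᶜ k) :=
    hg.comp (cutMomenta_dirVec Sᶜ) fun Λ k hk => cutMomenta_mem hk.1 (by
      rw [sum_compl_eq_neg hk.1.1, norm_neg]; exact hk.2)
  have h3 := ((adm_regPropDeriv hρ hK hB S Dom).mul hρ h1).mul hρ h2
  rw [zero_add] at h3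
  refine h3.extend hρ fun T x Λ v1 v2 v3 k hk => ?_
  have hpos := (hρ T).trans_le v2
  have hlt : 4 * Λ ^ 2 < ‖∑ i ∈ S, k i‖ ^ 2 := by
    by_contra hcon
    exact hk.2 ⟨hk.1, not_lt.1 hcon⟩
  have hopen : IsOpen {k : Fin n → Momentum | 4 * Λ ^ 2 < ‖∑ i ∈ S, k i‖ ^ 2} :=
    isOpen_lt continuous_const (by fun_prop)
  filter_upwards [hopen.mem_nhds hlt] with l hl
  have hl' : 2 * Λ ≤ ‖∑ i ∈ S, l i‖ :=
    le_of_sq_le_sq (by have : 4 * Λ ^ 2 < ‖∑ i ∈ S, l i‖ ^ 2 := hl; nlinarith) (norm_nonneg _)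
  rw [regPropDeriv_outer hK _ hpos hl']
  ring

/-- Power counting: a tree has degree `-3 + (4 - (|S| + 1)) + (4 - (|Sᶜ| + 1)) = 3 - n`, and a loop
has degree `4 - (n + 2) + 1 = 3 - n`. Omitting trees with a factor of order zero is what lets
`hlower` cover both remaining factors. -/
lemma adm_reducedRHS (hρ : ∀ T, 0 < ρ T) {K : ℝ → ℝ} (hK : IsCutoff K) {B : 𝒯 → ℝ}
    (hB : ∀ T, |B T| ≤ ρ T ^ 2) {r₁ r₂ : ℕ} {ℓ : (n : ℕ) → ℕ → ℕ → ScaleFamily 𝒯 n}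
    (hlower : ∀ m s₁ s₂, 1 ≤ m → s₁ ≤ r₁ → s₂ ≤ r₂ → s₁ + s₂ < r₁ + r₂ →
      Adm ρ (momentumBall m) (4 - m) s₁ (ℓ m s₁ s₂))
    (hnext : Adm ρ (momentumBall (n + 2)) (4 - (n + 2 : ℕ)) r₁ (ℓ (n + 2) r₁ r₂)) :
    Adm ρ (momentumBall n) (3 - n) r₁ fun T x Λ =>
      reducedRHS K (B T) (fun m s₁ s₂ => ℓ m s₁ s₂ T x Λ) Λ n r₁ r₂ := by
  refine Adm.add (Adm.const_mul (Adm.sum _ fun S _ => Adm.sum _ fun a ha => Adm.sum _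
    fun b hb => ?_) _) (Adm.const_mul ?_ _)
  · rw [Finset.HasAntidiagonal.mem_antidiagonal] at ha hb
    beta_reduce
    by_cases h : a.1 + b.1 = 0 ∨ a.2 + b.2 = 0
    · simp only [if_pos h]
      exact Adm.zero
    · simp only [if_neg h]
      have h1 := hlower (S.card + 1) a.1 b.1 (by omega) (by omega) (by omega) (by omega)
      have h2 := hlower (Sᶜ.card + 1) a.2 b.2 (by omega) (by omega) (by omega) (by omega)
      have h3 := Adm.tree hρ hK hB S h1 h2
      have hcard := Finset.card_add_card_compl S
      rw [Fintype.card_fin] at hcard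
      rw [ha] at h3
      convert h3 using 1
      push_cast
      omega
  · have h := hnext.loop hρ hK hB
    convert h using 1
    push_cast
    ring

end Flow

/-! ### The class of theories, Taylor's formula and symmetry at zero momentum -/

/-- The data and hypotheses of the convergence theorem. -/
structure Theory (K : ℝ → ℝ) (R₁ R₂ : ℕ) (P Q : ℕ → ℕ → ℕ → ℕ → Polynomial ℝ) : Type where
  ΛR : ℝ
  A : ℝ
  B : ℝ
  L : VertexFamily
  pos : 0 < ΛR
  abs_B_le : |B| ≤ ΛR ^ 2
  fam : IsVertexFamily K A B ΛR L
  ren : RenormalizationConditions ΛR L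
  val : ∀ n r₁ r₂ : ℕ, 1 ≤ n → r₁ ≤ R₁ → r₂ ≤ R₂ →
    ∀ I : List (Fin n × Fin n × Fin 4), ∀ Λ₀ Λ : ℝ, ΛR < Λ₀ → ΛR ≤ Λ → Λ ≤ Λ₀ →
      NormLE Λ (multiDiff I (dimless L n r₁ r₂ Λ₀ Λ))
        (Λ ^ (-(I.length : ℤ)) * (Λ / ΛR) ^ r₁ * Pln (P n I.length r₁ r₂) (Λ₀ / ΛR))
  bare : ∀ n r₁ r₂ : ℕ, 1 ≤ n → r₁ ≤ R₁ → r₂ ≤ R₂ →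
    ∀ I : List (Fin n × Fin n × Fin 4), 5 ≤ n + I.length → ∀ Λ₀ : ℝ, ΛR < Λ₀ →
      (∀ k ∈ momentumBall n Λ₀,
        DifferentiableAt ℝ (fun x => multiDiff I (dimless L n r₁ r₂ x x) k) Λ₀) ∧
      NormLE Λ₀
        (fun k => Λ₀ * deriv (fun x => multiDiff I (dimless L n r₁ r₂ x x) k) Λ₀)
        (Λ₀ ^ (-(I.length : ℤ)) * (Λ₀ / ΛR) ^ r₁ * Pln (Q n I.length r₁ r₂) (Λ₀ / ΛR))

lemma momentumBall_mono {n : ℕ} {Λ Λ' : ℝ} (h0 : 0 ≤ Λ) (h : Λ ≤ Λ') :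
    momentumBall n Λ ⊆ momentumBall n Λ' := fun k hk => ⟨hk.1, fun i => (hk.2 i).trans (by gcongr)⟩

lemma zero_mem_momentumBall (n : ℕ) (Λ : ℝ) : (0 : Fin n → Momentum) ∈ momentumBall n Λ :=
  ⟨by simp, fun i => by simp; positivity⟩

lemma smul_mem_momentumBall {n : ℕ} {Λ t : ℝ} {k : Fin n → Momentum} (hk : k ∈ momentumBall n Λ)
    (h0 : 0 ≤ t) (h1 : t ≤ 1) : t • k ∈ momentumBall n Λ := by
  refine ⟨by simp [← Finset.smul_sum, hk.1], fun i => ?_⟩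
  rw [Pi.smul_apply, norm_smul, Real.norm_of_nonneg h0, mul_pow]
  refine le_trans ?_ (hk.2 i)
  exact mul_le_of_le_one_left (by positivity) (pow_le_one₀ h0 h1)

/-- For a fixed reference label `j`, the vectors `e_i^μ - e_j^μ` span the hyperplane; the terms
placed at `j` add up to the total momentum, which is zero. -/
lemma eq_sum_dirVec {n : ℕ} {k : Fin n → Momentum} (hk : ∑ i, k i = 0) (j : Fin n) :
    k = ∑ i, ∑ μ, (k i μ) • dirVec (i, j, μ) := by
  have hs : ∀ v : Momentum, ∑ μ, v μ • EuclideanSpace.single μ (1 : ℝ) = v := fun v => by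
    ext ν
    simp [Pi.single_apply]
  have h1 : ∀ i, ∑ μ, (k i μ) • dirVec (i, j, μ) = Pi.single i (k i) - Pi.single j (k i) := by
    intro i
    conv_rhs => rw [← hs (k i)]
    simp only [dirVec, smul_sub, Finset.sum_sub_distrib]
    congr 1 <;>
    · ext l : 1
      simp only [Finset.sum_apply, Pi.smul_apply, Pi.single_apply]
      split_ifs <;> simp
  simp only [h1, Finset.sum_sub_distrib]
  rw [Finset.univ_sum_single]
  have : ∑ i, Pi.single (M := fun _ => Momentum) j (k i) = 0 := by
    have h2 : (Pi.single j (∑ i, k i) : Fin n → Momentum) = 0 := by rw [hk]; simp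
    rw [← h2]
    ext l : 1
    simp only [Finset.sum_apply, Pi.single_apply]
    split_ifs <;> simp
  rw [this, sub_zero]

open MeasureTheory in
/-- Taylor's formula to first order along the hyperplane of momentum conservation. -/
lemma eq_add_sum_integral_momDiff {n : ℕ} {F : (Fin n → Momentum) → ℝ} (hF : ContDiff ℝ ∞ F)
    {k : Fin n → Momentum} (hk : ∑ i, k i = 0) (j : Fin n) :
    F k = F 0 + ∑ i, ∑ μ, ∫ t in Set.Ioc (0 : ℝ) 1, k i μ * momDiff i j μ F (t • k) := by
  have hd : ∀ t : ℝ, HasDerivAt (fun t : ℝ => F (t • k))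
      (∑ i, ∑ μ, k i μ * momDiff i j μ F (t • k)) t := by
    intro t
    have h1 : HasDerivAt (fun t : ℝ => t • k) k t := by
      simpa using (hasDerivAt_id t).smul_const k
    have h2 := (hF.diffAt (t • k)).hasFDerivAt.comp_hasDerivAt t h1
    have e : fderiv ℝ F (t • k) k = ∑ i, ∑ μ, k i μ * momDiff i j μ F (t • k) := by
      conv_lhs => rw [eq_sum_dirVec hk j]
      simp only [map_sum, map_smul, smul_eq_mul]
      rw [← eq_sum_dirVec hk j]
      rfl
    rwa [e] at h2
  have hc : ∀ i μ, Continuous fun t : ℝ => k i μ * momDiff i j μ F (t • k) := fun i μ =>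
    continuous_const.mul ((hF.momDiff i j μ).continuous.comp (by fun_prop))
  have h := intervalIntegral.integral_eq_sub_of_hasDerivAt (fun t _ => hd t)
    ((continuous_finsetSum _ fun i _ => continuous_finsetSum _ fun μ _ =>
      hc i μ).intervalIntegrable 0 1)
  rw [one_smul, zero_smul, intervalIntegral.integral_of_le zero_le_one, integral_finsetSum] at h
  · rw [← sub_eq_iff_eq_add', ← h]
    refine Finset.sum_congr rfl fun i _ => ?_
    rw [integral_finsetSum]
    exact fun μ _ => ((hc i μ).integrableOn_Icc).mono_set Set.Ioc_subset_Icc_self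
  · exact fun i _ => integrable_finsetSum _ fun μ _ =>
      ((hc i μ).integrableOn_Icc).mono_set Set.Ioc_subset_Icc_self

lemma momDiff_eq_zero_of_even {n : ℕ} {F : (Fin n → Momentum) → ℝ} (hF : ContDiff ℝ ∞ F)
    (h : ∀ k, ∑ i, k i = 0 → F (-k) = F k) (i j : Fin n) (μ : Fin 4) : momDiff i j μ F 0 = 0 := by
  have key : ∀ v : Fin n → Momentum, HasDerivAt (fun t : ℝ => F (t • v)) (fderiv ℝ F 0 v) 0 := by
    intro v
    have h1 : HasDerivAt (fun t : ℝ => t • v) v 0 := by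
      simpa using (hasDerivAt_id (0 : ℝ)).smul_const v
    have h2 : HasFDerivAt F (fderiv ℝ F 0) ((0 : ℝ) • v) := by
      rw [zero_smul]; exact (hF.diffAt 0).hasFDerivAt
    exact h2.comp_hasDerivAt 0 h1
  have h1 := key (dirVec (i, j, μ))
  have h2 := key (-dirVec (i, j, μ))
  have e : (fun t : ℝ => F (t • -dirVec (i, j, μ))) = fun t : ℝ => F (t • dirVec (i, j, μ)) := by
    funext t
    rw [smul_neg]
    exact h _ (by simp only [Pi.smul_apply, ← Finset.smul_sum, sum_dirVec, smul_zero])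
  rw [e] at h2
  have h3 := h1.unique h2
  rw [map_neg] at h3
  change fderiv ℝ F 0 (dirVec (i, j, μ)) = 0
  linarith

/-- Two conserved momenta amount to a single four-vector, so each derivative is `0` or `±∂_{0,1}`
and the third renormalization condition covers them all. -/
lemma exists_momDiff_two (i j : Fin 2) : ∃ ε : ℝ, ∀ (μ : Fin 4)
    (F : (Fin 2 → Momentum) → ℝ), momDiff i j μ F = fun k => ε * momDiff 0 1 μ F k := by
  have h : ∀ (ε : ℝ), (∀ μ, dirVec (i, j, μ) = ε • dirVec ((0 : Fin 2), (1 : Fin 2), μ)) →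
      ∀ (μ : Fin 4) (F : (Fin 2 → Momentum) → ℝ),
        momDiff i j μ F = fun k => ε * momDiff 0 1 μ F k := by
    intro ε he μ F
    funext k
    change fderiv ℝ F k (dirVec (i, j, μ)) =
      ε * fderiv ℝ F k (dirVec ((0 : Fin 2), (1 : Fin 2), μ))
    rw [he, map_smul, smul_eq_mul]
  fin_cases i <;> fin_cases j
  · exact ⟨0, h 0 fun μ => by simp [dirVec]⟩
  · exact ⟨1, h 1 fun μ => by simp [dirVec]⟩
  · exact ⟨-1, h (-1) fun μ => by simp [dirVec]⟩
  · exact ⟨0, h 0 fun μ => by simp [dirVec]⟩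

/-! ### Vertex functions: integrated flow, hypotheses and boundary values -/

namespace Theory

variable {K : ℝ → ℝ} {R₁ R₂ : ℕ} {P Q : ℕ → ℕ → ℕ → ℕ → Polynomial ℝ} {n r₁ r₂ : ℕ}

/-- The vertex functions as families depending on the theory. -/
def vertex (n r₁ r₂ : ℕ) : ScaleFamily (Theory K R₁ R₂ P Q) n := fun T x Λ k => T.L n r₁ r₂ x Λ k

/-- The right-hand sides of the flow equations as families depending on the theory. -/
noncomputable def rhs (n r₁ r₂ : ℕ) : ScaleFamily (Theory K R₁ R₂ P Q) n := fun T x Λ =>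
  reducedRHS K T.B (fun m s₁ s₂ => vertex m s₁ s₂ T x Λ) Λ n r₁ r₂

lemma contDiff_vertex (hn : 1 ≤ n) (T : Theory K R₁ R₂ P Q) {x Λ : ℝ} (h1 : T.ΛR < x)
    (h2 : T.ΛR ≤ Λ) (h3 : Λ ≤ x) : ContDiff ℝ ∞ (vertex n r₁ r₂ T x Λ) :=
  (T.fam.smooth n r₁ r₂ hn x h1).slice (f := T.L n r₁ r₂ x) ⟨h2, h3⟩

/-- The flow equation is given on the hyperplane only. Both sides are smooth on the whole space, so
`multiDiff_eq_of_eqOn` carries the identity over to tangential derivatives. -/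
lemma scaleDeriv_eq_rhs (hK : IsCutoff K) (hn : 1 ≤ n) (T : Theory K R₁ R₂ P Q) {x s : ℝ}
    (h1 : T.ΛR < x) (hs : s ∈ Set.Icc T.ΛR x) (I : List (Fin n × Fin n × Fin 4))
    {k : Fin n → Momentum} (hk : ∑ i, k i = 0) :
    multiDiff I (scaleDeriv T.ΛR x (T.L n r₁ r₂ x) s) k = multiDiff I (rhs n r₁ r₂ T x s) k := by
  have hsm := T.fam.smooth n r₁ r₂ hn x h1
  have hpos := T.pos.trans_le hs.1
  refine multiDiff_eq_of_eqOn ((contDiffOn_scaleDeriv h1 hsm).slice hs)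
    (contDiff_reducedRHS hK hpos (neg_one_le_div_sq T.pos T.abs_B_le hs.1)
      (fun m s₁ s₂ hm => contDiff_vertex hm T h1 hs.1 hs.2) n r₁ r₂) (fun l hl => ?_) I k hk
  have e1 := hasDerivWithinAt_scaleDeriv hsm hs l
  have e2 := T.fam.flow n r₁ r₂ hn x s h1 hs l hl
  rw [(uniqueDiffOn_Icc h1 s hs).eq_deriv _ e1 e2,
    flowRHS_eq_reducedRHS hK T.A T.B hpos
      (fun m hm l hl => T.fam.zeroth m hm x s h1 hs l hl) n r₁ r₂ hl]
  rfl

lemma hasDerivWithinAt_vertex (hK : IsCutoff K) (hn : 1 ≤ n) (T : Theory K R₁ R₂ P Q) {x s : ℝ}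
    (h1 : T.ΛR < x) (hs : s ∈ Set.Icc T.ΛR x) (I : List (Fin n × Fin n × Fin 4))
    {k : Fin n → Momentum} (hk : ∑ i, k i = 0) :
    HasDerivWithinAt (fun s => multiDiff I (vertex n r₁ r₂ T x s) k)
      (multiDiff I (rhs n r₁ r₂ T x s) k) (Set.Icc T.ΛR x) s := by
  rw [← scaleDeriv_eq_rhs hK hn T h1 hs I hk]
  exact hasDerivWithinAt_multiDiff h1 I (T.fam.smooth n r₁ r₂ hn x h1) hs k

/-- Continuity in the scale is read off the smooth scale derivative of the vertex function, without
examining how the propagator depends on the scale. -/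
lemma continuousOn_rhs (hK : IsCutoff K) (hn : 1 ≤ n) (T : Theory K R₁ R₂ P Q) {x : ℝ}
    (h1 : T.ΛR < x) (I : List (Fin n × Fin n × Fin 4)) {k : Fin n → Momentum}
    (hk : ∑ i, k i = 0) :
    ContinuousOn (fun s => multiDiff I (rhs n r₁ r₂ T x s) k) (Set.Icc T.ΛR x) := by
  have h := (contDiffOn_multiDiff h1 (contDiffOn_scaleDeriv h1
    (T.fam.smooth n r₁ r₂ hn x h1)) I).continuousOn
  have h2 : ContinuousOn (fun s : ℝ => (s, k)) (Set.Icc T.ΛR x) := by fun_prop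
  have hm : Set.MapsTo (fun s : ℝ => (s, k)) (Set.Icc T.ΛR x)
    (Set.Icc T.ΛR x ×ˢ (Set.univ : Set (Fin n → Momentum))) := fun s hs => ⟨hs, trivial⟩
  exact (h.comp h2 hm).congr fun s hs => (scaleDeriv_eq_rhs hK hn T h1 hs I hk).symm

lemma integral_rhs (hK : IsCutoff K) (hn : 1 ≤ n) (T : Theory K R₁ R₂ P Q) {x a b : ℝ}
    (h1 : T.ΛR < x) (ha : T.ΛR ≤ a) (hab : a ≤ b) (hb : b ≤ x)
    (I : List (Fin n × Fin n × Fin 4)) {k : Fin n → Momentum} (hk : ∑ i, k i = 0) :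
    ∫ s in a..b, multiDiff I (rhs n r₁ r₂ T x s) k =
      multiDiff I (vertex n r₁ r₂ T x b) k - multiDiff I (vertex n r₁ r₂ T x a) k := by
  have hsub : Set.Icc a b ⊆ Set.Icc T.ΛR x := Set.Icc_subset_Icc ha hb
  refine intervalIntegral.integral_eq_sub_of_hasDerivAt_of_le hab
    (fun s hs => (hasDerivWithinAt_vertex hK hn T h1 (hsub hs) I hk).continuousWithinAt.mono hsub)
    (fun s hs => (hasDerivWithinAt_vertex hK hn T h1 (hsub (Set.Ioo_subset_Icc_self hs)) I
      hk).hasDerivAt (Icc_mem_nhds (ha.trans_lt hs.1) (hs.2.trans_le hb))) ?_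
  refine ((continuousOn_rhs hK hn T h1 I hk).mono ?_).intervalIntegrable
  rwa [Set.uIcc_of_le hab]

lemma multiDiff_dimless (hn : 1 ≤ n) (T : Theory K R₁ R₂ P Q) {x Λ : ℝ} (h1 : T.ΛR < x)
    (h2 : T.ΛR ≤ Λ) (h3 : Λ ≤ x) (I : List (Fin n × Fin n × Fin 4)) (k : Fin n → Momentum) :
    multiDiff I (dimless T.L n r₁ r₂ x Λ) k =
      Λ ^ ((n : ℤ) + (r₁ : ℤ) - 4) * multiDiff I (vertex n r₁ r₂ T x Λ) k :=
  congrFun (multiDiff_const_mul (contDiff_vertex hn T h1 h2 h3)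
    (Λ ^ ((n : ℤ) + (r₁ : ℤ) - 4)) I) k

lemma valBound_vertex (hP : ∀ n p r₁ r₂, NonnegCoeffs (P n p r₁ r₂)) (hn : 1 ≤ n) (h₁ : r₁ ≤ R₁)
    (h₂ : r₂ ≤ R₂) (I : List (Fin n × Fin n × Fin 4)) :
    ValBound (fun T : Theory K R₁ R₂ P Q => T.ΛR) (momentumBall n) (4 - n - (I.length : ℤ)) r₁
      fun T x Λ => multiDiff I (vertex n r₁ r₂ T x Λ) := by
  refine ⟨P n I.length r₁ r₂, hP _ _ _ _, fun T x Λ v1 v2 v3 k hk => ?_⟩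
  have hΛ : 0 < Λ := T.pos.trans_le v2
  have h := T.val n r₁ r₂ hn h₁ h₂ I x Λ v1 v2 v3 k hk
  rw [multiDiff_dimless hn T v1 v2 v3, abs_mul, abs_of_pos (zpow_pos hΛ _),
    ← le_div_iff₀' (zpow_pos hΛ _)] at h
  refine h.trans (le_of_eq ?_)
  have e : (4 : ℤ) - n - I.length = -I.length + r₁ - (n + r₁ - 4) := by ring
  rw [e, zpow_sub₀ hΛ.ne' _ ((n : ℤ) + r₁ - 4), zpow_add₀ hΛ.ne' (-(I.length : ℤ)), zpow_natCast,
    div_pow]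
  ring

lemma bareBound_vertex (hP : ∀ n p r₁ r₂, NonnegCoeffs (P n p r₁ r₂))
    (hQ : ∀ n p r₁ r₂, NonnegCoeffs (Q n p r₁ r₂)) (hn : 1 ≤ n) (h₁ : r₁ ≤ R₁)
    (h₂ : r₂ ≤ R₂) (I : List (Fin n × Fin n × Fin 4)) (hI : 5 ≤ n + I.length) :
    ∃ C, NonnegCoeffs C ∧ ∀ (T : Theory K R₁ R₂ P Q) (x : ℝ), T.ΛR < x →
      ∀ k ∈ momentumBall n x, ∃ v,
        HasDerivAt (fun y => multiDiff I (vertex n r₁ r₂ T y y) k) v x ∧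
        |v| ≤ x ^ (3 - n - (I.length : ℤ)) * (T.ΛR ^ r₁)⁻¹ * Pln C (x / T.ΛR) := by
  -- The exponent undoing the rescaling: `L_n = x ^ e * A_n`. In the product rule the derivative of
  -- `x ^ e` is controlled by `P` and that of `A_n` by `Q`.
  set e : ℤ := -((n : ℤ) + r₁ - 4) with he
  refine ⟨Polynomial.C |(e : ℝ)| * P n I.length r₁ r₂ + Q n I.length r₁ r₂,
    ((nonnegCoeffs_C (abs_nonneg _)).mul (hP _ _ _ _)).add (hQ _ _ _ _), fun T x v1 k hk => ?_⟩
  have hx : 0 < x := T.pos.trans v1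
  obtain ⟨hd, hb⟩ := T.bare n r₁ r₂ hn h₁ h₂ I hI x v1
  have ha := T.val n r₁ r₂ hn h₁ h₂ I x x v1 v1.le le_rfl k hk
  have hb' := hb k hk
  rw [abs_mul, abs_of_pos hx] at hb'
  have h := (hasDerivAt_zpow e x (Or.inl hx.ne')).mul (hd k hk).hasDerivAt
  refine ⟨_, h.congr_of_eventuallyEq ?_, ?_⟩
  · filter_upwards [Ioi_mem_nhds v1] with y hy
    have hy0 : 0 < y := T.pos.trans hy
    simp only [Pi.mul_apply]
    rw [multiDiff_dimless hn T hy (le_of_lt hy) le_rfl, ← mul_assoc, ← zpow_add₀ hy0.ne', he,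
      neg_add_cancel, zpow_zero, one_mul]
  · have hpe : 0 < x ^ (e - 1) := zpow_pos hx _
    have e1 : x ^ e = x ^ (e - 1) * x := by
      rw [← zpow_add_one₀ hx.ne', sub_add_cancel]
    have e2 : x ^ (3 - n - (I.length : ℤ)) * (T.ΛR ^ r₁)⁻¹ =
        x ^ (e - 1) * (x ^ (-(I.length : ℤ)) * (x / T.ΛR) ^ r₁) := by
      have : (3 : ℤ) - n - I.length = (e - 1) + -I.length + r₁ := by rw [he]; ring
      rw [this, zpow_add₀ hx.ne', zpow_add₀ hx.ne', zpow_natCast, div_pow]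
      ring
    refine (abs_add_le _ _).trans ?_
    rw [e2, Pln_add, Pln_mul, Pln_C, abs_mul, abs_mul, abs_mul, abs_of_pos hpe, e1, abs_mul,
      abs_of_pos hpe, abs_of_pos hx]
    have f1 := mul_le_mul_of_nonneg_left ha (mul_nonneg (abs_nonneg (e : ℝ)) hpe.le)
    have f2 := mul_le_mul_of_nonneg_left hb' hpe.le
    refine (add_le_add f1 (le_of_eq_of_le ?_ f2)).trans (le_of_eq ?_)
    · ring
    · ring

/-- The renormalization conditions cover orders `0` and `2` in the momenta. A single derivative
vanishes at zero because `-1 ∈ O(4)` makes the vertex functions even. For `n = 1` there is no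
tangential direction, so only `n = 2` admits a nontrivial second derivative. -/
lemma exists_ren_const (hn : 1 ≤ n) (I : List (Fin n × Fin n × Fin 4)) (hI : n + I.length ≤ 4)
    (T : Theory K R₁ R₂ P Q) :
    ∃ c, ∀ x, T.ΛR < x → multiDiff I (vertex n r₁ r₂ T x T.ΛR) 0 = c := by
  have heven : ∀ x, T.ΛR < x → ∀ k : Fin n → Momentum, ∑ i, k i = 0 →
      vertex n r₁ r₂ T x T.ΛR (-k) = vertex n r₁ r₂ T x T.ΛR k := fun x hx k hk =>
    T.fam.orthogonal n r₁ r₂ hn x T.ΛR hx ⟨le_rfl, hx.le⟩ k hk (LinearIsometryEquiv.neg ℝ)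
  match I, hI with
  | [], hI =>
    have : n = 1 ∨ n = 2 ∨ n = 3 ∨ n = 4 := by simp at hI; omega
    rcases this with rfl | rfl | rfl | rfl
    · exact ⟨_, T.ren.rho1 r₁ r₂⟩
    · exact ⟨_, T.ren.rho2 r₁ r₂⟩
    · exact ⟨_, T.ren.rho4 r₁ r₂⟩
    · exact ⟨_, T.ren.rho5 r₁ r₂⟩
  | [q], _ =>
    exact ⟨0, fun x hx => momDiff_eq_zero_of_even (contDiff_vertex hn T hx le_rfl hx.le)
      (heven x hx) _ _ _⟩
  | q :: q' :: I', hI =>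
    simp only [List.length_cons] at hI
    by_cases h1 : n = 1
    · subst h1
      refine ⟨0, fun x _ => ?_⟩
      have : dirVec q = 0 := by
        rw [dirVec, Subsingleton.elim q.1 q.2.1, sub_self]
      rw [multiDiff_cons, momDiff_apply, this, map_zero]
    · have hn2 : n = 2 := by omega
      subst hn2
      have hI' : I' = [] := List.length_eq_zero_iff.1 (by omega)
      subst hI'
      refine ⟨0, fun x hx => ?_⟩
      obtain ⟨ε, hε⟩ := exists_momDiff_two q.1 q.2.1
      obtain ⟨ε', hε'⟩ := exists_momDiff_two q'.1 q'.2.1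
      have hsm := contDiff_vertex (r₁ := r₁) (r₂ := r₂) hn T hx le_rfl hx.le
      rw [multiDiff_cons, multiDiff_cons, multiDiff_nil, hε, hε',
        momDiff_const_mul (hsm.momDiff _ _ _)]
      have h : momDiff 0 1 q.2.2 (momDiff 0 1 q'.2.2 (vertex 2 r₁ r₂ T x T.ΛR)) 0 = 0 :=
        T.ren.rho3 r₁ r₂ x hx q.2.2 q'.2.2
      beta_reduce
      rw [h, mul_zero, mul_zero]

end Theory

/-! ### Induction for the cutoff derivatives -/

lemma zpow_le_zpow_of_nonpos {a b : ℝ} (ha : 0 < a) (hab : a ≤ b) {e : ℤ} (he : e ≤ 0) :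
    b ^ e ≤ a ^ e := by
  obtain ⟨m, rfl⟩ : ∃ m : ℕ, e = -m := ⟨(-e).toNat, by omega⟩
  simp only [zpow_neg, zpow_natCast]
  gcongr

namespace Theory

variable {K : ℝ → ℝ} {R₁ R₂ : ℕ} {P Q : ℕ → ℕ → ℕ → ℕ → Polynomial ℝ} {n r₁ r₂ : ℕ}

/-- Irrelevant vertex functions: integrate the flow down from the UV cutoff. -/
lemma derBound_of_irrelevant (hK : IsCutoff K) (hP : ∀ n p r₁ r₂, NonnegCoeffs (P n p r₁ r₂))
    (hQ : ∀ n p r₁ r₂, NonnegCoeffs (Q n p r₁ r₂)) (hn : 1 ≤ n) (h₁ : r₁ ≤ R₁) (h₂ : r₂ ≤ R₂)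
    (hR : Adm (fun T : Theory K R₁ R₂ P Q => T.ΛR) (momentumBall n) (3 - n) r₁ (rhs n r₁ r₂))
    (I : List (Fin n × Fin n × Fin 4)) (hI : 5 ≤ n + I.length) :
    DerBound (fun T : Theory K R₁ R₂ P Q => T.ΛR) (momentumBall n) (5 - n - (I.length : ℤ)) r₁
      fun T x Λ => multiDiff I (vertex n r₁ r₂ T x Λ) := by
  have hρ : ∀ T : Theory K R₁ R₂ P Q, 0 < T.ΛR := fun T => T.pos
  obtain ⟨Cb, hCb, Hb⟩ := bareBound_vertex hP hQ hn h₁ h₂ I hI (r₁ := r₁) (r₂ := r₂) (K := K)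
  obtain ⟨⟨C₁, hC₁, H₁⟩, C₂, hC₂, H₂⟩ := hR.bound I
  refine ⟨Cb + C₁ + Polynomial.X * C₂, (hCb.add hC₁).add (nonnegCoeffs_X.mul hC₂),
    fun T x Λ v1 v2 v3 k hk => ?_⟩
  have hΛ : 0 < Λ := T.pos.trans_le v2
  have hx : 0 < x := T.pos.trans v1
  have hball : ∀ s, Λ ≤ s → k ∈ momentumBall n s := fun s hs => momentumBall_mono hΛ.le hs hk
  obtain ⟨δ, M, hδ, hM, hlow, hlip⟩ := DerBound.lipschitz hρ ⟨C₂, hC₂, H₂⟩ T v1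
  set e : ℤ := 5 - n - (I.length : ℤ) with he
  have he0 : e ≤ 0 := by omega
  set E : ℝ := (T.ΛR ^ r₁)⁻¹ * (x ^ 2)⁻¹ with hE
  have hE0 : 0 ≤ E := by have := T.pos; positivity
  have hP₂ := Pln_div_nonneg hC₂ T.pos v1.le
  have hP₁ := Pln_div_nonneg hC₁ T.pos v1.le
  have hPb := Pln_div_nonneg hCb T.pos v1.le
  set b : ℝ → ℝ := fun s =>
    s ^ (3 - n - (I.length : ℤ) + 1) * (T.ΛR ^ r₁)⁻¹ * (x ^ 2)⁻¹ * Pln C₂ (x / T.ΛR) with hb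
  have hbc : ContinuousOn b (Set.Icc Λ x) :=
    (((continuousOn_id.zpow₀ _ fun s hs => Or.inl (hΛ.trans_le hs.1).ne').mul
      continuousOn_const).mul continuousOn_const).mul continuousOn_const
  obtain ⟨V, hV, hVb⟩ := exists_hasDerivWithinAt_flow_integral (b := b) v3 hδ hM
    (g := fun s y => multiDiff I (rhs n r₁ r₂ T y s) k)
    (fun y _ hyδ => (continuousOn_rhs hK hn T (by linarith [(abs_lt.1 hyδ).1]) I hk.1).mono
      (Set.Icc_subset_Icc_left v2))
    (fun s y y' hs hy hy' hyδ hyδ' => hlip s (v2.trans hs) k (hball s hs) y y' hy hy' hyδ hyδ')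
    (fun s hs hsx => H₂ T x s v1 (v2.trans hs) hsx.le k (hball s hs)) hbc
  obtain ⟨v, hv, hvb⟩ := Hb T x v1 k (hball x v3)
  have hfl : ∀ y, T.ΛR < y → Λ ≤ y → multiDiff I (vertex n r₁ r₂ T y Λ) k =
      multiDiff I (vertex n r₁ r₂ T y y) k - ∫ s in Λ..y, multiDiff I (rhs n r₁ r₂ T y s) k :=
    fun y hy hy' => by rw [integral_rhs hK hn T hy v2 hy' le_rfl I hk.1]; ring
  refine ⟨v - V, (hv.hasDerivWithinAt.sub hV).congr_of_eventuallyEq ?_ (hfl x v1 v3), ?_⟩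
  · filter_upwards [self_mem_nhdsWithin, mem_nhdsWithin_of_mem_nhds (Ioi_mem_nhds v1)]
      with y hy hy' using hfl y hy' hy
  -- The bare datum and the moving endpoint both scale as `x ^ (e - 2)`; irrelevance means `e ≤ 0`,
  -- which allows replacing `x ^ e` by `Λ ^ e`.
  · have hxe : x ^ (3 - n - (I.length : ℤ)) ≤ Λ ^ e * (x ^ 2)⁻¹ := by
      have : (3 : ℤ) - n - I.length = e - 2 := by rw [he]; ring
      rw [this, zpow_sub₀ hx.ne', div_eq_mul_inv]
      exact mul_le_mul_of_nonneg_right (zpow_le_zpow_of_nonpos hΛ v3 he0) (by positivity)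
    have hcoef : ∀ p : ℝ, 0 ≤ p → x ^ (3 - n - (I.length : ℤ)) * (T.ΛR ^ r₁)⁻¹ * p ≤
        Λ ^ e * E * p := fun p hp => by
      have h0 := T.pos
      refine (mul_le_mul_of_nonneg_right (mul_le_mul_of_nonneg_right hxe (by positivity))
        hp).trans (le_of_eq ?_)
      rw [hE]; ring
    have f1 := hvb.trans (hcoef _ hPb)
    have f2 := (H₁ T x x v1 v1.le le_rfl k (hball x v3)).trans (hcoef _ hP₁)
    -- Since `s ^ (e - 1) ≤ Λ ^ e * s⁻¹`, the integral over scales costs a single logarithm; this is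
    -- the factor `Polynomial.X` in the final polynomial.
    have f3 : ∫ s in Λ..x, b s ≤ Λ ^ e * E * (Real.log (x / T.ΛR) * Pln C₂ (x / T.ΛR)) := by
      have hinv : ContinuousOn (fun s : ℝ => Λ ^ e * E * Pln C₂ (x / T.ΛR) * s⁻¹)
          (Set.uIcc Λ x) := by
        rw [Set.uIcc_of_le v3]
        exact continuousOn_const.mul (continuousOn_id.inv₀ fun s hs => (hΛ.trans_le hs.1).ne')
      have hmono := intervalIntegral.integral_mono_on (μ := MeasureTheory.volume) v3
        (ContinuousOn.intervalIntegrable (by rwa [Set.uIcc_of_le v3])) hinv.intervalIntegrable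
        (f := b) fun s hs => by
          have hs0 : 0 < s := hΛ.trans_le hs.1
          have : s ^ (3 - n - (I.length : ℤ) + 1) = s ^ e * s⁻¹ := by
            rw [← zpow_sub_one₀ hs0.ne', he]; congr 1; ring
          simp only [hb]
          rw [this]
          have h4 := mul_le_mul_of_nonneg_right (zpow_le_zpow_of_nonpos hΛ hs.1 he0)
            (show 0 ≤ s⁻¹ * (E * Pln C₂ (x / T.ΛR)) by positivity)
          refine (le_of_eq ?_).trans (h4.trans (le_of_eq ?_))
          · rw [hE]; ring
          · ring
      rw [intervalIntegral.integral_const_mul, integral_inv_of_pos hΛ hx] at hmono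
      have hlog : Real.log (x / Λ) ≤ Real.log (x / T.ΛR) := by
        have h0 := T.pos
        refine Real.log_le_log (by positivity) ?_
        gcongr
      refine hmono.trans ((mul_le_mul_of_nonneg_left hlog (by positivity)).trans (le_of_eq ?_))
      ring
    have f4 := abs_sub v V
    rw [Pln_add, Pln_add, Pln_mul, Pln_X]
    calc |v - V| ≤ |v| + |V| := f4
      _ ≤ Λ ^ e * E * Pln Cb (x / T.ΛR) + (Λ ^ e * E * Pln C₁ (x / T.ΛR) +
          Λ ^ e * E * (Real.log (x / T.ΛR) * Pln C₂ (x / T.ΛR))) :=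
        add_le_add f1 (hVb.trans (add_le_add f2 f3))
      _ = _ := by rw [hE]; ring

open MeasureTheory in
/-- Relevant and marginal vertex functions at zero momenta: integrate the flow up from the
renormalization scale. -/
lemma derBound_at_zero (hK : IsCutoff K) (hn : 1 ≤ n)
    (hR : Adm (fun T : Theory K R₁ R₂ P Q => T.ΛR) (momentumBall n) (3 - n) r₁ (rhs n r₁ r₂))
    (I : List (Fin n × Fin n × Fin 4)) (hI : n + I.length ≤ 4) :
    DerBound (fun T : Theory K R₁ R₂ P Q => T.ΛR) (fun _ => {0}) (5 - n - (I.length : ℤ)) r₁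
      fun T x Λ => multiDiff I (vertex n r₁ r₂ T x Λ) := by
  have hρ : ∀ T : Theory K R₁ R₂ P Q, 0 < T.ΛR := fun T => T.pos
  obtain ⟨-, C, hC, H⟩ := hR.bound I
  refine ⟨C, hC, fun T x Λ v1 v2 v3 k hk => ?_⟩
  rw [Set.mem_singleton_iff] at hk
  subst hk
  have hΛ : 0 < Λ := T.pos.trans_le v2
  have hz : ∑ i, (0 : Fin n → Momentum) i = 0 := by simp
  obtain ⟨c, hc⟩ := exists_ren_const hn I hI T (r₁ := r₁) (r₂ := r₂)
  set e : ℤ := 3 - n - (I.length : ℤ) + 1 with he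
  -- Here `e = 4 - n - p ≥ 0`, so `s ^ e` is at most `Λ ^ e` on the range of integration and no
  -- logarithm appears.
  obtain ⟨m, hm⟩ : ∃ m : ℕ, e = m := ⟨e.toNat, by omega⟩
  obtain ⟨V, hV, hVb⟩ := H.integral hρ hC v1 v3 (μ := volume.restrict (Set.Ioc T.ΛR Λ))
    (Λ' := fun s => s) (κ := fun _ => 0) (w := fun _ => 1) (W := Λ ^ e) (w₀ := 1)
    ((ae_restrict_iff' measurableSet_Ioc).2 (Filter.Eventually.of_forall fun s hs =>
      ⟨hs.1.le, hs.2, zero_mem_momentumBall n s, by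
        rw [abs_one, one_mul, hm, zpow_natCast, zpow_natCast]
        exact pow_le_pow_left₀ (T.pos.trans hs.1).le hs.2 m, by simp⟩))
    (fun y hy hy' => by
      simp only [one_mul]
      exact (((continuousOn_rhs hK hn T hy I hz).mono
        (Set.Icc_subset_Icc_right hy')).integrableOn_compact isCompact_Icc).mono_set
        Set.Ioc_subset_Icc_self)
  have hfl : ∀ y, T.ΛR < y → Λ ≤ y → multiDiff I (vertex n r₁ r₂ T y Λ) 0 =
      (∫ s in Set.Ioc T.ΛR Λ, 1 * multiDiff I (rhs n r₁ r₂ T y s) 0) + c := fun y hy hy' => by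
    simp only [one_mul]
    rw [← intervalIntegral.integral_of_le v2, integral_rhs hK hn T hy le_rfl v2 hy' I hz,
      hc y hy]
    ring
  refine ⟨V, (hV.add_const c).congr_of_eventuallyEq ?_ (hfl x v1 v3), hVb.trans ?_⟩
  · filter_upwards [self_mem_nhdsWithin, mem_nhdsWithin_of_mem_nhds (Ioi_mem_nhds v1)]
      with y hy hy' using hfl y hy' hy
  · have hP := Pln_div_nonneg hC T.pos v1.le
    have h0 := T.pos
    rw [measureReal_restrict_apply_univ, Real.volume_real_Ioc_of_le v2]
    have e1 : Λ ^ (5 - n - (I.length : ℤ)) = Λ * Λ ^ e := by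
      rw [← zpow_one_add₀ hΛ.ne', he]; congr 1; ring
    rw [e1]
    have : (Λ - T.ΛR) * (Λ ^ e * (T.ΛR ^ r₁)⁻¹ * (x ^ 2)⁻¹ * Pln C (x / T.ΛR)) ≤
        Λ * (Λ ^ e * (T.ΛR ^ r₁)⁻¹ * (x ^ 2)⁻¹ * Pln C (x / T.ΛR)) :=
      mul_le_mul_of_nonneg_right (by linarith) (by positivity)
    refine this.trans (le_of_eq (by ring))

open MeasureTheory in
/-- Taylor's formula recovers the bounds at nonzero momenta. -/
lemma derBound_of_taylor (hn : 1 ≤ n) (I : List (Fin n × Fin n × Fin 4))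
    (h0 : DerBound (fun T : Theory K R₁ R₂ P Q => T.ΛR) (fun _ => {0})
      (5 - n - (I.length : ℤ)) r₁ fun T x Λ => multiDiff I (vertex n r₁ r₂ T x Λ))
    (h : ∀ q, DerBound (fun T : Theory K R₁ R₂ P Q => T.ΛR) (momentumBall n)
      (5 - n - ((q :: I).length : ℤ)) r₁ fun T x Λ => multiDiff (q :: I) (vertex n r₁ r₂ T x Λ)) :
    DerBound (fun T : Theory K R₁ R₂ P Q => T.ΛR) (momentumBall n) (5 - n - (I.length : ℤ)) r₁
      fun T x Λ => multiDiff I (vertex n r₁ r₂ T x Λ) := by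
  have hρ : ∀ T : Theory K R₁ R₂ P Q, 0 < T.ΛR := fun T => T.pos
  set j : Fin n := ⟨0, hn⟩
  have hterm : ∀ i μ, DerBound (fun T : Theory K R₁ R₂ P Q => T.ΛR) (momentumBall n)
      (5 - n - (I.length : ℤ)) r₁ fun T x Λ k => ∫ t in Set.Ioc (0 : ℝ) 1,
        k i μ * momDiff i j μ (multiDiff I (vertex n r₁ r₂ T x Λ)) (t • k) := by
    intro i μ
    obtain ⟨C, hC, H⟩ := h (i, j, μ)
    refine ⟨Polynomial.C 2 * C, (nonnegCoeffs_C zero_le_two).mul hC,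
      fun T x Λ v1 v2 v3 k hk => ?_⟩
    have hΛ : 0 < Λ := T.pos.trans_le v2
    -- The factor `k_i^μ` restores the power of `Λ` lost to the extra derivative.
    have hki : |k i μ| ≤ 2 * Λ := by
      refine (PiLp.norm_apply_le (k i) μ).trans ?_
      have := hk.2 i
      nlinarith [norm_nonneg (k i)]
    obtain ⟨V, hV, hVb⟩ := H.integral hρ hC v1 v3 (μ := volume.restrict (Set.Ioc (0 : ℝ) 1))
      (Λ' := fun _ => Λ) (κ := fun t => t • k) (w := fun _ => k i μ)
      (W := 2 * Λ * Λ ^ (5 - n - (((i, j, μ) :: I).length : ℤ))) (w₀ := 2 * Λ)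
      ((ae_restrict_iff' measurableSet_Ioc).2 (Filter.Eventually.of_forall fun t ht =>
        ⟨v2, le_rfl, smul_mem_momentumBall hk ht.1.le ht.2,
          mul_le_mul_of_nonneg_right hki (zpow_pos hΛ _).le, hki⟩))
      (fun y hy hy' => by
        refine ((Continuous.integrableOn_Icc ?_).mono_set Set.Ioc_subset_Icc_self)
        exact continuous_const.mul (((contDiff_vertex hn T hy v2 hy').multiDiff
          ((i, j, μ) :: I)).continuous.comp (by fun_prop)))
    refine ⟨V, hV, hVb.trans (le_of_eq ?_)⟩
    rw [measureReal_restrict_apply_univ, Real.volume_real_Ioc_of_le zero_le_one, Pln_mul, Pln_C]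
    have e1 : Λ ^ (5 - n - (I.length : ℤ)) = Λ * Λ ^ (5 - n - (((i, j, μ) :: I).length : ℤ)) := by
      rw [← zpow_one_add₀ hΛ.ne']; congr 1; simp only [List.length_cons]; push_cast; ring
    rw [e1]
    ring
  have h0' : DerBound (fun T : Theory K R₁ R₂ P Q => T.ΛR) (momentumBall n)
      (5 - n - (I.length : ℤ)) r₁ fun T x Λ _ => multiDiff I (vertex n r₁ r₂ T x Λ) 0 := by
    obtain ⟨C, hC, H⟩ := h0
    exact ⟨C, hC, fun T x Λ v1 v2 v3 k _ => H T x Λ v1 v2 v3 0 rfl⟩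
  exact (h0'.add (DerBound.sum Finset.univ fun i _ => DerBound.sum Finset.univ fun μ _ =>
    hterm i μ)).congr fun T x Λ v1 v2 v3 k hk =>
      eq_add_sum_integral_momDiff ((contDiff_vertex hn T v1 v2 v3).multiDiff I) hk.1 j

/-- Induction on how far `n + p` falls short of `5`: Taylor's formula needs one more derivative, and
after finitely many steps every function is irrelevant. -/
lemma derBound_vertex (hK : IsCutoff K) (hP : ∀ n p r₁ r₂, NonnegCoeffs (P n p r₁ r₂))
    (hQ : ∀ n p r₁ r₂, NonnegCoeffs (Q n p r₁ r₂)) (hn : 1 ≤ n) (h₁ : r₁ ≤ R₁) (h₂ : r₂ ≤ R₂)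
    (hR : Adm (fun T : Theory K R₁ R₂ P Q => T.ΛR) (momentumBall n) (3 - n) r₁ (rhs n r₁ r₂))
    (j : ℕ) : ∀ I : List (Fin n × Fin n × Fin 4), 5 ≤ n + I.length + j →
    DerBound (fun T : Theory K R₁ R₂ P Q => T.ΛR) (momentumBall n) (5 - n - (I.length : ℤ)) r₁
      fun T x Λ => multiDiff I (vertex n r₁ r₂ T x Λ) := by
  induction j with
  | zero => exact fun I hI => derBound_of_irrelevant hK hP hQ hn h₁ h₂ hR I (by omega)
  | succ j ih =>
    intro I hI
    by_cases hI' : 5 ≤ n + I.length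
    · exact derBound_of_irrelevant hK hP hQ hn h₁ h₂ hR I hI'
    · exact derBound_of_taylor hn I (derBound_at_zero hK hn hR I (by omega)) fun q =>
        ih (q :: I) (by simp only [List.length_cons]; omega)

/-- Strong induction on the total order, with a descent in `n` inside. Value bounds are hypotheses
throughout; only cutoff derivatives are propagated. -/
lemma adm_vertex (hK : IsCutoff K) (hP : ∀ n p r₁ r₂, NonnegCoeffs (P n p r₁ r₂))
    (hQ : ∀ n p r₁ r₂, NonnegCoeffs (Q n p r₁ r₂)) (N : ℕ) : ∀ r₁ r₂, r₁ + r₂ = N → r₁ ≤ R₁ →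
    r₂ ≤ R₂ → ∀ n, 1 ≤ n → Adm (fun T : Theory K R₁ R₂ P Q => T.ΛR) (momentumBall n) (4 - n) r₁
      (vertex n r₁ r₂) := by
  have hρ : ∀ T : Theory K R₁ R₂ P Q, 0 < T.ΛR := fun T => T.pos
  induction N using Nat.strong_induction_on with
  | _ N IH =>
    intro r₁ r₂ hN h₁ h₂
    -- `m` bounds the remaining distance to the range where the vertex functions vanish. The loop
    -- raises `n` by two and `m` drops by one, so the inequality persists.
    have descend : ∀ m n : ℕ, 2 * (r₁ + r₂) + 2 < n + m → 1 ≤ n →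
        Adm (fun T : Theory K R₁ R₂ P Q => T.ΛR) (momentumBall n) (4 - n) r₁
          (vertex n r₁ r₂) := by
      intro m
      induction m with
      | zero =>
        refine fun n hn hn1 => ⟨fun T x Λ v1 v2 v3 => contDiff_vertex hn1 T v1 v2 v3, fun I =>
          UBound.zero fun T x Λ v1 v2 v3 k hk => ?_⟩
        have := multiDiff_eq_of_eqOn (contDiff_vertex hn1 T v1 v2 v3) contDiff_const
          (fun l hl => T.fam.truncated n r₁ r₂ hn x Λ v1 ⟨v2, v3⟩ l hl) I k hk.1
        rwa [multiDiff_zero] at this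
      | succ m ih =>
        intro n hn hn1
        have hR : Adm (fun T : Theory K R₁ R₂ P Q => T.ΛR) (momentumBall n) (3 - n) r₁
            (rhs n r₁ r₂) :=
          adm_reducedRHS hρ hK (fun T => T.abs_B_le)
            (fun l s₁ s₂ hl hs₁ hs₂ hlt => IH (s₁ + s₂) (hN ▸ hlt) s₁ s₂ rfl (hs₁.trans h₁)
              (hs₂.trans h₂) l hl)
            (ih (n + 2) (by omega) (by omega))
        refine ⟨fun T x Λ v1 v2 v3 => contDiff_vertex hn1 T v1 v2 v3, fun I =>
          ⟨valBound_vertex hP hn1 h₁ h₂ I, ?_⟩⟩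
        -- With deficit `5` the side condition holds for every list of derivatives.
        have := derBound_vertex hK hP hQ hn1 h₁ h₂ hR 5 I (by omega)
        have e : (4 : ℤ) - n - I.length + 1 = 5 - n - I.length := by ring
        rwa [e]
    exact fun n hn => descend (2 * (r₁ + r₂) + 3) n (by omega) hn

end Theory

/-! ### Uniform polynomials and the limit of infinite cutoff -/

lemma NonnegCoeffs.derivative {p : Polynomial ℝ} (hp : NonnegCoeffs p) :
    NonnegCoeffs (Polynomial.derivative p) := fun i => by
  rw [Polynomial.coeff_derivative]
  exact mul_nonneg (hp _) (by positivity)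

/-- The solution is the terminating series `p + p' + p'' + ⋯`, which keeps nonnegative coefficients.
-/
lemma exists_sub_derivative_eq (N : ℕ) : ∀ p : Polynomial ℝ, NonnegCoeffs p → p.natDegree ≤ N →
    ∃ D, NonnegCoeffs D ∧ D - Polynomial.derivative D = p := by
  induction N with
  | zero =>
    intro p hp hN
    refine ⟨p, hp, ?_⟩
    rw [Polynomial.eq_C_of_natDegree_le_zero hN]
    simp
  | succ N ih =>
    intro p hp hN
    obtain ⟨D, hD, e⟩ := ih (Polynomial.derivative p) hp.derivative
      ((Polynomial.natDegree_derivative_le p).trans (by omega))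
    refine ⟨p + D, hp.add hD, ?_⟩
    rw [Polynomial.derivative_add, ← e]
    ring

/-- An antiderivative of `x⁻² C(ln (x/ρ))`. -/
lemma hasDerivAt_neg_inv_mul_Pln {C D : Polynomial ℝ} (h : D - Polynomial.derivative D = C)
    {ρ x : ℝ} (hρ : 0 < ρ) (hx : 0 < x) :
    HasDerivAt (fun x => -(x⁻¹ * Pln D (x / ρ))) ((x ^ 2)⁻¹ * Pln C (x / ρ)) x := by
  have h1 : HasDerivAt (fun x : ℝ => Real.log (x / ρ)) x⁻¹ x := by
    have := ((hasDerivAt_id x).div_const ρ).log (div_pos hx hρ).ne'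
    refine this.congr_deriv ?_
    simp only [id]
    field_simp
  have h2 : HasDerivAt (fun x => Pln D (x / ρ))
      ((Polynomial.derivative D).eval (Real.log (x / ρ)) * x⁻¹) x :=
    HasDerivAt.comp (h₂ := fun z => D.eval z) x (D.hasDerivAt (Real.log (x / ρ))) h1
  refine ((hasDerivAt_inv hx.ne').mul h2).neg.congr_deriv ?_
  rw [← h]
  simp only [Pln, Polynomial.eval_sub]
  field_simp
  ring

/-- A function whose derivative is dominated by that of a nonpositive function has a limit at
infinity, with the corresponding rate. -/
lemma exists_tendsto_of_deriv_le {F G : ℝ → ℝ} {F' G' : ℝ → ℝ} {Λ x₀ : ℝ} (hΛ : Λ ≤ x₀)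
    (hF : ∀ x, x₀ ≤ x → HasDerivWithinAt F (F' x) (Set.Ici Λ) x)
    (hG : ∀ x, x₀ ≤ x → HasDerivAt G (G' x) x) (hle : ∀ x, x₀ ≤ x → |F' x| ≤ G' x)
    (hG0 : ∀ x, x₀ ≤ x → G x ≤ 0) :
    ∃ l, Filter.Tendsto F Filter.atTop (nhds l) ∧ ∀ x, x₀ ≤ x → |F x - l| ≤ -G x := by
  -- Increments of `F` are dominated by those of `G`, which is increasing and bounded above by `0`;
  -- hence `F` is Cauchy, and `-G x` bounds the tail.
  have key : ∀ x y, x₀ ≤ x → x ≤ y → |F y - F x| ≤ G y - G x := by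
    intro x y hx hxy
    refine image_norm_le_of_norm_deriv_right_le_deriv_boundary' (a := x) (b := y)
      (f := fun z => F z - F x) (f' := F') (B := fun z => G z - G x) (B' := G')
      (fun z hz => ?_) (fun z hz => ?_) (by simp) (fun z hz => ?_) (fun z hz => ?_)
      (fun z hz => hle z (hx.trans hz.1)) ⟨hxy, le_rfl⟩
    · exact ((hF z (hx.trans hz.1)).continuousWithinAt.mono fun w hw =>
        (hΛ.trans hx).trans hw.1).sub continuousWithinAt_const
    · exact ((hF z (hx.trans hz.1)).mono (Set.Ici_subset_Ici.2
        ((hΛ.trans hx).trans hz.1))).sub_const _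
    · exact (hG z (hx.trans hz.1)).continuousAt.continuousWithinAt.sub continuousWithinAt_const
    · exact (hG z (hx.trans hz.1)).hasDerivWithinAt.sub_const _
  have hmono : Monotone fun x => G (max x₀ x) := fun x y hxy => by
    have := key (max x₀ x) (max x₀ y) (le_max_left _ _) (max_le_max_left _ hxy)
    have := (abs_nonneg _).trans this
    simp only
    linarith
  have hcauchy := (tendsto_atTop_ciSup hmono
    ⟨0, by rintro _ ⟨x, rfl⟩; exact hG0 _ (le_max_left _ _)⟩).cauchySeq
  have hFc : CauchySeq F := by
    refine Metric.cauchySeq_iff'.2 fun ε hε => ?_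
    obtain ⟨N, hN⟩ := Metric.cauchySeq_iff'.1 hcauchy ε hε
    refine ⟨max x₀ N, fun y hy => ?_⟩
    have h1 := hN y ((le_max_right _ _).trans hy)
    rw [max_eq_right ((le_max_left _ _).trans hy), Real.dist_eq] at h1
    rw [Real.dist_eq]
    exact ((key _ y (le_max_left _ _) hy).trans (le_abs_self _)).trans_lt h1
  obtain ⟨l, hl⟩ := cauchySeq_tendsto_of_complete hFc
  refine ⟨l, hl, fun x hx => ?_⟩
  refine le_of_tendsto (tendsto_const_nhds.sub hl).abs ?_
  filter_upwards [Filter.eventually_ge_atTop x] with y hy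
  rw [abs_sub_comm]
  linarith [key x y hx hy, hG0 y (hx.trans hy)]

namespace Theory

variable {K : ℝ → ℝ} {R₁ R₂ : ℕ} {P Q : ℕ → ℕ → ℕ → ℕ → Polynomial ℝ} {n r₁ r₂ : ℕ}

/-- The polynomial may depend on the derivatives only through their number; the sum over the
finitely many index lists of length `p` dominates each of them. -/
lemma exists_derBoundWith_vertex (hK : IsCutoff K) (hP : ∀ n p r₁ r₂, NonnegCoeffs (P n p r₁ r₂))
    (hQ : ∀ n p r₁ r₂, NonnegCoeffs (Q n p r₁ r₂)) (R₁ R₂ n p r₁ r₂ : ℕ) :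
    ∃ C, NonnegCoeffs C ∧ (1 ≤ n → r₁ ≤ R₁ → r₂ ≤ R₂ →
      ∀ I : List (Fin n × Fin n × Fin 4), I.length = p →
        DerBoundWith C (fun T : Theory K R₁ R₂ P Q => T.ΛR) (momentumBall n) (5 - n - (p : ℤ)) r₁
          fun T x Λ => multiDiff I (vertex n r₁ r₂ T x Λ)) := by
  by_cases h : 1 ≤ n ∧ r₁ ≤ R₁ ∧ r₂ ≤ R₂
  · obtain ⟨hn, h₁, h₂⟩ := h
    choose C hC H using fun I : List (Fin n × Fin n × Fin 4) =>
      ((adm_vertex hK hP hQ _ r₁ r₂ rfl h₁ h₂ n hn).bound I).2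
    refine ⟨∑ v : List.Vector (Fin n × Fin n × Fin 4) p, C v.toList,
      nonnegCoeffs_sum _ fun v _ => hC _, fun _ _ _ I hI T x Λ v1 v2 v3 k hk => ?_⟩
    obtain ⟨v, hv, hvb⟩ := H I T x Λ v1 v2 v3 k hk
    refine ⟨v, hv, hvb.trans ?_⟩
    have hΛ : 0 < Λ := T.pos.trans_le v2
    have h0 := T.pos
    have e : (4 : ℤ) - n - I.length + 1 = 5 - n - p := by rw [hI]; ring
    rw [e, Pln_sum]
    refine mul_le_mul_of_nonneg_left ?_ (by positivity)
    let w : List.Vector (Fin n × Fin n × Fin 4) p := ⟨I, hI⟩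
    exact Finset.single_le_sum (f := fun v : List.Vector (Fin n × Fin n × Fin 4) p =>
      Pln (C v.toList) (x / T.ΛR)) (fun v _ => Pln_div_nonneg (hC _) h0 v1.le)
      (Finset.mem_univ w)
  · exact ⟨0, nonnegCoeffs_zero, fun hn h₁ h₂ => absurd ⟨hn, h₁, h₂⟩ h⟩

lemma exists_hasDerivWithinAt_dimless (hn : 1 ≤ n) {C : Polynomial ℝ}
    {I : List (Fin n × Fin n × Fin 4)}
    (hC : DerBoundWith C (fun T : Theory K R₁ R₂ P Q => T.ΛR) (momentumBall n)
      (5 - n - (I.length : ℤ)) r₁ fun T x Λ => multiDiff I (vertex n r₁ r₂ T x Λ))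
    (T : Theory K R₁ R₂ P Q) {Λ₀ Λ : ℝ} (h1 : T.ΛR < Λ₀) (h2 : T.ΛR ≤ Λ) (h3 : Λ ≤ Λ₀)
    {k : Fin n → Momentum} (hk : k ∈ momentumBall n Λ) :
    ∃ v, HasDerivWithinAt (fun x => multiDiff I (dimless T.L n r₁ r₂ x Λ) k) v (Set.Ici Λ) Λ₀ ∧
      |v| ≤ Λ ^ (-(I.length : ℤ)) * (Λ / T.ΛR) ^ r₁ * Λ * ((Λ₀ ^ 2)⁻¹ * Pln C (Λ₀ / T.ΛR)) := by
  obtain ⟨v, hv, hvb⟩ := hC T Λ₀ Λ h1 h2 h3 k hk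
  have hΛ : 0 < Λ := T.pos.trans_le h2
  refine ⟨Λ ^ ((n : ℤ) + (r₁ : ℤ) - 4) * v, (hv.const_mul _).congr_of_eventuallyEq ?_
    (multiDiff_dimless hn T h1 h2 h3 I k), ?_⟩
  · filter_upwards [self_mem_nhdsWithin, mem_nhdsWithin_of_mem_nhds (Ioi_mem_nhds h1)]
      with y hy hy' using multiDiff_dimless hn T hy' h2 hy I k
  · rw [abs_mul, abs_of_pos (zpow_pos hΛ _)]
    refine (mul_le_mul_of_nonneg_left hvb (zpow_pos hΛ _).le).trans (le_of_eq ?_)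
    have e : Λ ^ (-(I.length : ℤ)) * Λ ^ r₁ * Λ =
        Λ ^ ((n : ℤ) + (r₁ : ℤ) - 4) * Λ ^ (5 - n - (I.length : ℤ)) := by
      rw [← zpow_add₀ hΛ.ne', ← zpow_natCast Λ r₁, ← zpow_add₀ hΛ.ne', ← zpow_add_one₀ hΛ.ne']
      congr 1
      ring
    have e' : Λ ^ (-(I.length : ℤ)) * (Λ / T.ΛR) ^ r₁ * Λ =
        Λ ^ (-(I.length : ℤ)) * Λ ^ r₁ * Λ * (T.ΛR ^ r₁)⁻¹ := by
      rw [div_pow]; ring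
    rw [e', e]
    ring

lemma exists_tendsto_dimless (hn : 1 ≤ n) {C D : Polynomial ℝ} (hD : NonnegCoeffs D)
    (hDC : D - Polynomial.derivative D = C)
    (hC : DerBoundWith C (fun T : Theory K R₁ R₂ P Q => T.ΛR) (momentumBall n)
      (5 - n - ((0 : ℕ) : ℤ)) r₁ fun T x Λ => vertex n r₁ r₂ T x Λ)
    (T : Theory K R₁ R₂ P Q) {Λ : ℝ} (h2 : T.ΛR ≤ Λ)
    {k : Fin n → Momentum} (hk : k ∈ momentumBall n Λ) :
    ∃ l, Filter.Tendsto (fun Λ₀ => dimless T.L n r₁ r₂ Λ₀ Λ k) Filter.atTop (nhds l) ∧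
      ∀ Λ₀, T.ΛR < Λ₀ → Λ ≤ Λ₀ → |dimless T.L n r₁ r₂ Λ₀ Λ k - l| ≤
        (Λ / T.ΛR) ^ r₁ * (Λ / Λ₀) * Pln D (Λ₀ / T.ΛR) := by
  have hΛ : 0 < Λ := T.pos.trans_le h2
  have h0 := T.pos
  have main : ∀ x₀, T.ΛR < x₀ → Λ ≤ x₀ → ∃ l,
      Filter.Tendsto (fun Λ₀ => dimless T.L n r₁ r₂ Λ₀ Λ k) Filter.atTop (nhds l) ∧
      |dimless T.L n r₁ r₂ x₀ Λ k - l| ≤ (Λ / T.ΛR) ^ r₁ * (Λ / x₀) * Pln D (x₀ / T.ΛR) := by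
    intro x₀ hx₀ hx₀'
    have hd := fun (x : ℝ) (hx : x₀ ≤ x) =>
      exists_hasDerivWithinAt_dimless (I := []) hn hC T (hx₀.trans_le hx) h2 (hx₀'.trans hx) hk
    simp only [multiDiff_nil, List.length_nil, Nat.cast_zero, neg_zero, zpow_zero, one_mul] at hd
    choose! F' hF' hF'b using hd
    obtain ⟨l, hl, hlb⟩ := exists_tendsto_of_deriv_le hx₀' hF' (fun x hx =>
      (hasDerivAt_neg_inv_mul_Pln hDC h0 (h0.trans (hx₀.trans_le hx))).const_mul
        ((Λ / T.ΛR) ^ r₁ * Λ)) hF'b (fun x hx => by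
          have hx0 := h0.trans (hx₀.trans_le hx)
          have := Pln_div_nonneg hD h0 (hx₀.le.trans hx)
          rw [mul_neg, neg_nonpos]
          positivity)
    refine ⟨l, hl, (hlb x₀ le_rfl).trans (le_of_eq ?_)⟩
    rw [div_eq_mul_inv Λ x₀]
    ring
  -- The starting cutoff `Λ + 1` lies strictly above `ΛR` and fixes the limit once; uniqueness of
  -- limits then transfers the rate from any other starting cutoff.
  obtain ⟨l, hl, -⟩ := main (Λ + 1) (by linarith) (by linarith)
  refine ⟨l, hl, fun Λ₀ h1 h3 => ?_⟩
  obtain ⟨l', hl', hb⟩ := main Λ₀ h1 h3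
  rwa [tendsto_nhds_unique hl hl']

end Theory

theorem mainTheorem5 (K : ℝ → ℝ) (hK : IsCutoff K) (R₁ R₂ : ℕ)
    (P Q : ℕ → ℕ → ℕ → ℕ → Polynomial ℝ)
    (hP : ∀ n p r₁ r₂, NonnegCoeffs (P n p r₁ r₂))
    (hQ : ∀ n p r₁ r₂, NonnegCoeffs (Q n p r₁ r₂)) :
    ∃ (C : ℕ → ℕ → ℕ → ℕ → Polynomial ℝ) (D : ℕ → ℕ → ℕ → Polynomial ℝ),
      (∀ n p r₁ r₂, NonnegCoeffs (C n p r₁ r₂)) ∧ (∀ n r₁ r₂, NonnegCoeffs (D n r₁ r₂)) ∧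
      ∀ (ΛR A B : ℝ), 0 < ΛR → |B| ≤ ΛR ^ 2 → |A| ≤ ΛR ^ 3 →
      ∀ L : VertexFamily, IsVertexFamily K A B ΛR L → RenormalizationConditions ΛR L →
      -- boundedness of the vertex functions up to the order considered
      (∀ n r₁ r₂ : ℕ, 1 ≤ n → r₁ ≤ R₁ → r₂ ≤ R₂ →
        ∀ I : List (Fin n × Fin n × Fin 4), ∀ Λ₀ Λ : ℝ, ΛR < Λ₀ → ΛR ≤ Λ → Λ ≤ Λ₀ →
          NormLE Λ (multiDiff I (dimless L n r₁ r₂ Λ₀ Λ))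
            (Λ ^ (-(I.length : ℤ)) * (Λ / ΛR) ^ r₁ * Pln (P n I.length r₁ r₂) (Λ₀ / ΛR))) →
      -- boundedness of the `Λ₀`-derivatives of the irrelevant bare data
      (∀ n r₁ r₂ : ℕ, 1 ≤ n → r₁ ≤ R₁ → r₂ ≤ R₂ →
        ∀ I : List (Fin n × Fin n × Fin 4), 5 ≤ n + I.length → ∀ Λ₀ : ℝ, ΛR < Λ₀ →
          (∀ k ∈ momentumBall n Λ₀,
            DifferentiableAt ℝ (fun x => multiDiff I (dimless L n r₁ r₂ x x) k) Λ₀) ∧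
          NormLE Λ₀
            (fun k => Λ₀ * deriv (fun x => multiDiff I (dimless L n r₁ r₂ x x) k) Λ₀)
            (Λ₀ ^ (-(I.length : ℤ)) * (Λ₀ / ΛR) ^ r₁ *
              Pln (Q n I.length r₁ r₂) (Λ₀ / ΛR))) →
      -- the `Λ₀`-derivatives at a fixed scale `Λ` (one-sided if `Λ = Λ₀`) exist and are small
      (∀ n r₁ r₂ : ℕ, 1 ≤ n → r₁ ≤ R₁ → r₂ ≤ R₂ →
        ∀ I : List (Fin n × Fin n × Fin 4), ∀ Λ₀ Λ : ℝ, ΛR < Λ₀ → ΛR ≤ Λ → Λ ≤ Λ₀ →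
          (∀ k ∈ momentumBall n Λ,
            DifferentiableWithinAt ℝ (fun x => multiDiff I (dimless L n r₁ r₂ x Λ) k)
              (Set.Ici Λ) Λ₀) ∧
          NormLE Λ
            (fun k => Λ₀ * derivWithin (fun x => multiDiff I (dimless L n r₁ r₂ x Λ) k)
              (Set.Ici Λ) Λ₀)
            (Λ ^ (-(I.length : ℤ)) * (Λ / ΛR) ^ r₁ * (Λ / Λ₀) *
              Pln (C n I.length r₁ r₂) (Λ₀ / ΛR))) ∧
      -- convergence to a no-cutoff limit
      (∀ n r₁ r₂ : ℕ, 1 ≤ n → r₁ ≤ R₁ → r₂ ≤ R₂ → ∀ Λ : ℝ, ΛR ≤ Λ →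
        ∃ Acont : (Fin n → Momentum) → ℝ,
          (∀ k ∈ momentumBall n Λ,
            Filter.Tendsto (fun Λ₀ => dimless L n r₁ r₂ Λ₀ Λ k) Filter.atTop
              (nhds (Acont k))) ∧
          ∀ Λ₀ : ℝ, ΛR < Λ₀ → Λ ≤ Λ₀ →
            NormLE Λ (fun k => dimless L n r₁ r₂ Λ₀ Λ k - Acont k)
              ((Λ / ΛR) ^ r₁ * (Λ / Λ₀) * Pln (D n r₁ r₂) (Λ₀ / ΛR))) := by
  choose C hC H using Theory.exists_derBoundWith_vertex hK hP hQ R₁ R₂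
  choose D hD hDC using fun n r₁ r₂ : ℕ =>
    exists_sub_derivative_eq (C n 0 r₁ r₂).natDegree (C n 0 r₁ r₂) (hC n 0 r₁ r₂) le_rfl
  refine ⟨C, D, hC, hD, fun ΛR A B hΛR hB _ L hL hren hval hbare => ?_⟩
  let T : Theory K R₁ R₂ P Q := ⟨ΛR, A, B, L, hΛR, hB, hL, hren, hval, hbare⟩
  refine ⟨fun n r₁ r₂ hn h₁ h₂ I Λ₀ Λ v1 v2 v3 => ?_, fun n r₁ r₂ hn h₁ h₂ Λ v2 => ?_⟩
  · have key := fun (k : Fin n → Momentum) (hk : k ∈ momentumBall n Λ) =>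
      Theory.exists_hasDerivWithinAt_dimless hn (H n I.length r₁ r₂ hn h₁ h₂ I rfl) T v1 v2 v3 hk
    refine ⟨fun k hk => ?_, fun k hk => ?_⟩ <;> obtain ⟨v, hv, hvb⟩ := key k hk
    · exact hv.differentiableWithinAt
    · have hpos : 0 < Λ₀ := hΛR.trans v1
      beta_reduce
      rw [HasDerivWithinAt.derivWithin hv (uniqueDiffOn_Ici Λ Λ₀ v3), abs_mul, abs_of_pos hpos]
      refine (mul_le_mul_of_nonneg_left hvb hpos.le).trans (le_of_eq ?_)
      change Λ₀ * (Λ ^ (-(I.length : ℤ)) * (Λ / ΛR) ^ r₁ * Λ *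
        ((Λ₀ ^ 2)⁻¹ * Pln (C n I.length r₁ r₂) (Λ₀ / ΛR))) = _
      field_simp
  · have key := fun (k : Fin n → Momentum) (hk : k ∈ momentumBall n Λ) =>
      Theory.exists_tendsto_dimless hn (hD n r₁ r₂) (hDC n r₁ r₂)
        (H n 0 r₁ r₂ hn h₁ h₂ [] rfl) T v2 hk
    choose! l hl hlb using key
    exact ⟨l, hl, fun Λ₀ v1 v3 k hk => hlb k hk Λ₀ v1 v3⟩
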